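/- Let $W$ be a finite real reflection group acting on $V=\mathbb C^N$, generated by the orthogonal reflections $s_\alpha$, $\alpha\in R$, where $R\subset\mathbb R^N$ is a finite reduced (not necessarily crystallographic) root system with simple roots $S$ and positive roots $R_+$, and let $(\cdot,\cdot)$ be the standard $\mathbb C$-bilinear form on $V$. Let $c\colon R\to\mathbb C$ be $W$-invariant, and let $$\nabla_\xi=\partial_\xi-\sum_{\alpha\in R_+}\frac{c_\alpha(\alpha,\xi)}{(\alpha,x)}(1-s_\alpha)\quad(\xi\in V),\qquad \nabla_i=\nabla_{e_i},$$ be the Dunkl operators; the rational Cherednik algebra $\mathcal H_c$ is the algebra of operators on $\mathbb C[x_1,\dots,x_N]$ generated by the multiplications by polynomials, by $W$ and by the $\nabla_\xi$. Let $\Gamma_0\subseteq S$, let $W_0\subseteq W$ be the subgroup generated by the $s_\beta$, $\beta\in\Gamma_0$, let $\pi=\{x\in V\mid(\beta,x)=0\ \forall\beta\in\Gamma_0\}$ and $D=\bigcup_{w\in W}w(\pi)$, and for $\alpha\in R$ let $\widehat\alpha$ be the orthogonal projection of $\alpha$ onto $\pi$. Let $U$ be a complex vector space with a linear right action $u\mapsto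 u\cdot w$ of $W$, and put $P_\alpha u=u\cdot s_\alpha$. Let $x_0\in\pi$ be generic: every mirror $\{(\alpha,x)=0\}$, $\alpha\in R$, that contains $x_0$ contains $\pi$. For a point $x\in D$ let $\mathcal C_x(D,U)\cong U\otimes\mathcal C_x(D,\mathbb C)$ be the space of germs at $x$ of $U$-valued analytic functions on $D$ (finite sums $\sum_j f_ju_j$ with $u_j\in U$ and $f_j$ the restriction to $D$ of a function analytic near $x$ in $V$). The group $W$ acts on $\bigoplus_{x\in Wx_0}\mathcal C_x(D,U)$ by $(wF)(y)=F(w^{-1}y)\cdot w^{-1}$. Let $\mathcal C^{W_0}_{x_0}(D,U)$ be the space of $W_0$-invariant germs in $\mathcal C_{x_0}(D,U)$; taking the germ at $x_0$ identifies the $W$-invariant elements of the direct sum with $\mathcal C^{W_0}_{x_0}(D,U)$. Suppose that the ideal of all polynomials vanishing on $D$ is invariant under $\mathcal H_c$. Then the following hold. (1) For every $p\in\mathbb C[x]^W$ the operator $p(\nabla)=p(\nabla_1,\dots,\nabla_N)$ induces a unique linear operator $\widetilde{\mathrm{Res}}_\pi\,p(\nabla)$ on $\mathcal C^{W_0}_{x_0}(D,U)$,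 as follows: regard $g\in\mathcal C^{W_0}_{x_0}(D,U)$ as a $W$-invariant sum of germs on $D$ at the points of $Wx_0$, extend it to an analytic $U$-valued function $F$ near $Wx_0$ in $V$, and restrict $p(\nabla)F$ to $D$, where $\nabla_\xi$ acts on $U$-valued functions with $s_\alpha$ acting by $(s_\alpha F)(x)=F(s_\alpha x)$. The result is again a $W$-invariant sum of analytic germs, is independent of the extension $F$, and its germ at $x_0$ is $(\widetilde{\mathrm{Res}}_\pi\,p(\nabla))g$. (2) The operator $H_2=\widetilde{\mathrm{Res}}_\pi\bigl(\sum_{i=1}^N\nabla_i^2\bigr)$ is $$H_2=\Delta_y-\sum_{\substack{\alpha\in R_+\\ \widehat\alpha\ne0}}\frac{2c_\alpha}{(\widehat\alpha,y)}\,\partial_{\widehat\alpha}+\sum_{\substack{\alpha\in R_+\\ \widehat\alpha\ne0}}\frac{c_\alpha(\alpha,\alpha)}{(\widehat\alpha,y)^2}\,(1-P_\alpha),$$ where $y=(y_1,\dots,y_n)$ are any orthonormal coordinates on $\pi$ and $\Delta_y=\partial_{y_1}^2+\dots+\partial_{y_n}^2$. (3) The operators $\widetilde{\mathrm{Res}}_\pi\,p(\nabla)$,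 $p\in\mathbb C[x]^W$, commute pairwise; in particular, all of them commute with $H_2$. -/

import Mathlib

open Filter Topology Matrix

namespace SpinCM

noncomputable section

/-! ### Root systems and reflection groups -/

/-- Real Euclidean space `ℝ^N`, in which the roots live. -/
abbrev RSpace (N : ℕ) := EuclideanSpace ℝ (Fin N)

/-- The complexification `V = ℂ^N`. Its standard `ℂ`-bilinear form is the dot product `x ⬝ᵥ y`. -/
abbrev CSpace (N : ℕ) := Fin N → ℂ

variable {N : ℕ}

/-- The inclusion `ℝ^N ⊂ ℂ^N`. -/
def cx (a : RSpace N) : CSpace N := fun i => (a i : ℂ)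

/-- A finite reduced (not necessarily crystallographic) root system in `ℝ^N`. -/
structure IsRootSystem (R : Finset (RSpace N)) : Prop where
  zero_notMem : (0 : RSpace N) ∉ R
  reduced : ∀ α ∈ R, ∀ t : ℝ, t • α ∈ R → t = 1 ∨ t = -1
  reflection_mem : ∀ α ∈ R, ∀ β ∈ R, (ℝ ∙ α)ᗮ.reflection β ∈ R

/-- `α` is a linear combination of elements of `S` with non-negative coefficients. -/
def IsNonnegComb (S : Finset (RSpace N)) (α : RSpace N) : Prop :=
  ∃ a : RSpace N → ℝ, (∀ δ ∈ S, 0 ≤ a δ) ∧ α = ∑ δ ∈ S, a δ • δ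

/-- `S` is a system of simple roots of `R` (the vertices of the Coxeter graph). -/
structure IsSimpleSystem (R S : Finset (RSpace N)) : Prop where
  subset : S ⊆ R
  linearIndependent : LinearIndependent ℝ (fun δ : S => (δ : RSpace N))
  pos_or_neg : ∀ α ∈ R, IsNonnegComb S α ∨ IsNonnegComb S (-α)

open Classical in
/-- The positive roots determined by the simple roots `S`. -/
def posRoots (R S : Finset (RSpace N)) : Finset R :=
  Finset.univ.filter fun α => IsNonnegComb S (α : RSpace N)

theorem cx_eq_zero_of_dot {α : RSpace N} (h : cx α ⬝ᵥ cx α = 0) : cx α = 0 := by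
  have h1 : ∑ i, α i * α i = 0 := by
    have : ((∑ i, α i * α i : ℝ) : ℂ) = 0 := by
      rw [← h]; simp [dotProduct, cx]
    exact_mod_cast this
  have h2 := (Finset.sum_eq_zero_iff_of_nonneg
    (fun i _ => mul_self_nonneg (α i))).1 h1
  funext i
  simpa [cx] using h2 i (Finset.mem_univ i)

/-- The orthogonal reflection `s_α x = x - 2 (α, x) / (α, α) α` of `V = ℂ^N`. -/
def refl (α : RSpace N) : CSpace N ≃ₗ[ℂ] CSpace N :=
  LinearEquiv.ofInvolutive
    { toFun := fun x => x - (2 * (cx α ⬝ᵥ x) / (cx α ⬝ᵥ cx α)) • cx α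
      map_add' := by
        intro x y
        rw [dotProduct_add, mul_add, add_div, add_smul]; abel
      map_smul' := by
        intro t x
        rw [dotProduct_smul, RingHom.id_apply, smul_sub, smul_smul, smul_eq_mul]
        congr 2; ring }
    (by
      intro x
      by_cases h : cx α ⬝ᵥ cx α = 0
      · simp [cx_eq_zero_of_dot h]
      · simp only [LinearMap.coe_mk, AddHom.coe_mk, dotProduct_sub, dotProduct_smul, smul_eq_mul]
        rw [sub_sub, ← add_smul, sub_eq_self]
        convert zero_smul ℂ (cx α) using 2
        field_simp
        ring)

theorem refl_apply (α : RSpace N) (x : CSpace N) :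
    refl α x = x - (2 * (cx α ⬝ᵥ x) / (cx α ⬝ᵥ cx α)) • cx α := rfl

/-- The group generated by the reflections in the elements of `S`. It is the reflection group `W`
for `S = R`, and the parabolic subgroup `W₀` when `S` is a set of simple roots. -/
def reflGroup (S : Finset (RSpace N)) : Subgroup (CSpace N ≃ₗ[ℂ] CSpace N) :=
  Subgroup.closure (refl '' (S : Set (RSpace N)))

/-- The reflection `s_α` as an element of `W`. -/
def reflW {R : Finset (RSpace N)} (α : R) : reflGroup R :=
  ⟨refl α, Subgroup.subset_closure ⟨α, α.2, rfl⟩⟩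

/-- `c : R → ℂ` is a `W`-invariant function. -/
def IsInvariantMult {R : Finset (RSpace N)} (c : R → ℂ) : Prop :=
  ∀ w ∈ reflGroup R, ∀ α β : R, w (cx α) = cx β → c β = c α

/-! ### Parabolic strata -/

/-- `π = {x ∈ V | (β, x) = 0 for all β ∈ Γ₀}`. -/
def plane (Γ₀ : Finset (RSpace N)) : Submodule ℂ (CSpace N) where
  carrier := {x | ∀ β ∈ Γ₀, cx β ⬝ᵥ x = 0}
  add_mem' := by
    intro x y hx hy β hβ
    rw [dotProduct_add, hx β hβ, hy β hβ, add_zero]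
  zero_mem' := by
    intro β _
    exact dotProduct_zero _
  smul_mem' := by
    intro t x hx β hβ
    rw [dotProduct_smul, hx β hβ, smul_zero]

/-- The parabolic stratum `D`, the union of all `w(π)` with `w ∈ W`. -/
def stratum (R Γ₀ : Finset (RSpace N)) : Set (CSpace N) :=
  ⋃ w ∈ reflGroup R, (fun x => w x) '' (plane Γ₀ : Set (CSpace N))

/-- A point of `π` is generic if every mirror that contains it contains all of `π`. -/
def IsGeneric (R Γ₀ : Finset (RSpace N)) (x₀ : CSpace N) : Prop :=
  x₀ ∈ plane Γ₀ ∧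
    ∀ α ∈ R, cx α ⬝ᵥ x₀ = 0 → ∀ y ∈ plane Γ₀, cx α ⬝ᵥ y = 0

/-- The orthogonal projection `α̂` of `α` onto (the real points of) `π`. -/
def proj (Γ₀ : Finset (RSpace N)) (α : RSpace N) : RSpace N :=
  (Submodule.span ℝ (Γ₀ : Set (RSpace N)))ᗮ.starProjection α

/-- The orbit `W x₀`. -/
def orbit (R : Finset (RSpace N)) (x₀ : CSpace N) : Set (CSpace N) :=
  {x | ∃ w ∈ reflGroup R, w x₀ = x}

/-! ### The rational Cherednik algebra in its polynomial representation -/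

/-- The algebra `ℂ[x] = ℂ[x_1, …, x_N]`. -/
abbrev Poly (N : ℕ) := MvPolynomial (Fin N) ℂ

/-- The linear form `x ↦ (α, x)` as a polynomial. -/
def linForm (α : RSpace N) : Poly N := ∑ i, MvPolynomial.C (cx α i) * MvPolynomial.X i

/-- The action `(w p)(x) = p(w⁻¹ x)` on polynomials. -/
def polyAct (w : CSpace N ≃ₗ[ℂ] CSpace N) : Poly N →ₐ[ℂ] Poly N :=
  MvPolynomial.aeval fun i =>
    ∑ j, MvPolynomial.C (w⁻¹ (Pi.single j 1) i) * MvPolynomial.X j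

theorem eval_polyAct (w : CSpace N ≃ₗ[ℂ] CSpace N) (p : Poly N) (x : CSpace N) :
    MvPolynomial.eval x (polyAct w p) = MvPolynomial.eval (w⁻¹ x) p := by
  have h : ((MvPolynomial.aeval x : Poly N →ₐ[ℂ] ℂ).comp (polyAct w)) =
      MvPolynomial.aeval (w⁻¹ x) := by
    apply MvPolynomial.algHom_ext
    intro i
    have hx : x = ∑ j, x j • (Pi.single j (1 : ℂ) : CSpace N) := by
      funext k; simp [Finset.sum_apply, Pi.single_apply]
    conv_rhs => rw [hx]
    simp [polyAct, Finset.sum_apply, mul_comm]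
  have := congrArg (fun f => f p) h
  simpa [MvPolynomial.aeval_eq_eval] using this

theorem linForm_dvd (α : RSpace N) (p : Poly N) : linForm α ∣ p - polyAct (refl α) p := by
  rw [← Ideal.mem_span_singleton, ← Ideal.Quotient.mk_eq_mk_iff_sub_mem]
  have h : (Ideal.Quotient.mkₐ ℂ (Ideal.span {linForm α})) =
      (Ideal.Quotient.mkₐ ℂ (Ideal.span {linForm α})).comp (polyAct (refl α)) := by
    apply MvPolynomial.algHom_ext
    intro i
    simp only [AlgHom.comp_apply, Ideal.Quotient.mkₐ_eq_mk]
    rw [Ideal.Quotient.mk_eq_mk_iff_sub_mem, Ideal.mem_span_singleton]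
    refine ⟨MvPolynomial.C (2 / (cx α ⬝ᵥ cx α) * cx α i), ?_⟩
    apply MvPolynomial.funext
    intro x
    have hinv : (refl α)⁻¹ = refl α := rfl
    rw [map_sub, eval_polyAct, hinv]
    simp only [MvPolynomial.eval_X, refl_apply, linForm, map_mul, map_sum,
      MvPolynomial.eval_C, Pi.sub_apply, Pi.smul_apply, smul_eq_mul, dotProduct]
    ring
  exact congrArg (fun f => f p) h

open Classical in
/-- The operator `(α, x)⁻¹ (1 - s_α)` on polynomials (and `0` if `α = 0`). -/
def polyDivDiff (α : RSpace N) : Poly N →ₗ[ℂ] Poly N where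
  toFun := fun p => if linForm α = 0 then 0 else (linForm_dvd α p).choose
  map_add' := by
    intro p q
    by_cases h : linForm α = 0
    · simp [h]
    · simp only [h, if_false]
      apply mul_left_cancel₀ h
      rw [mul_add, ← (linForm_dvd α _).choose_spec, ← (linForm_dvd α p).choose_spec,
        ← (linForm_dvd α q).choose_spec, map_add]
      ring
  map_smul' := by
    intro t p
    by_cases h : linForm α = 0
    · simp [h]
    · simp only [h, if_false, RingHom.id_apply]
      apply mul_left_cancel₀ h
      rw [mul_smul_comm, ← (linForm_dvd α _).choose_spec, ← (linForm_dvd α p).choose_spec,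
        map_smul, smul_sub]

/-- The Dunkl operator
`∇_ξ = ∂_ξ - ∑_{α ∈ R₊} c_α (α, ξ) (α, x)⁻¹ (1 - s_α)` on polynomials. -/
def polyDunkl {R : Finset (RSpace N)} (S : Finset (RSpace N)) (c : R → ℂ) (ξ : CSpace N) :
    Module.End ℂ (Poly N) :=
  ∑ i, ξ i • (MvPolynomial.pderiv i : Derivation ℂ (Poly N) (Poly N)).toLinearMap
    - ∑ α ∈ posRoots R S, (c α * (cx α ⬝ᵥ ξ)) • polyDivDiff (α : RSpace N)

/-- The rational Cherednik algebra `H_c`, acting faithfully on `ℂ[x]`: it is generated by the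
multiplications by polynomials, the group `W` and the Dunkl operators. -/
def cherednikAlgebra {R : Finset (RSpace N)} (S : Finset (RSpace N)) (c : R → ℂ) :
    Subalgebra ℂ (Module.End ℂ (Poly N)) :=
  Algebra.adjoin ℂ
    (Set.range (fun q : Poly N => LinearMap.mulLeft ℂ q) ∪
      (fun w => (polyAct w).toLinearMap) '' (reflGroup R : Set (CSpace N ≃ₗ[ℂ] CSpace N)) ∪
      Set.range (polyDunkl S c))

/-- The ideal of the polynomials vanishing on the stratum is invariant under `H_c`. -/
def IsInvariantParabolic {R : Finset (RSpace N)} (S Γ₀ : Finset (RSpace N)) (c : R → ℂ) : Prop :=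
  ∀ h ∈ cherednikAlgebra S c, ∀ p ∈ MvPolynomial.vanishingIdeal ℂ (stratum R Γ₀),
    h p ∈ MvPolynomial.vanishingIdeal ℂ (stratum R Γ₀)

/-- The algebra `ℂ[x]^W` of invariant polynomials. -/
def invPoly (R : Finset (RSpace N)) : Subalgebra ℂ (Poly N) where
  carrier := {p | ∀ w ∈ reflGroup R, polyAct w p = p}
  mul_mem' := by
    intro p q hp hq w hw
    rw [map_mul, hp w hw, hq w hw]
  add_mem' := by
    intro p q hp hq w hw
    rw [map_add, hp w hw, hq w hw]
  algebraMap_mem' := by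
    intro t w _
    exact AlgHom.commutes _ t

theorem refl_dot (α : RSpace N) (x : CSpace N) : refl α x ⬝ᵥ refl α x = x ⬝ᵥ x := by
  by_cases h : cx α ⬝ᵥ cx α = 0
  · simp [refl_apply, cx_eq_zero_of_dot h]
  · simp only [refl_apply, dotProduct_sub, sub_dotProduct, dotProduct_smul, smul_dotProduct,
      smul_eq_mul, dotProduct_comm x (cx α)]
    field_simp
    ring

theorem reflGroup_dot {R : Finset (RSpace N)} {w : CSpace N ≃ₗ[ℂ] CSpace N}
    (hw : w ∈ reflGroup R) : ∀ x, w x ⬝ᵥ w x = x ⬝ᵥ x := by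
  induction hw using Subgroup.closure_induction with
  | mem w h => obtain ⟨α, -, rfl⟩ := h; exact refl_dot α
  | one => intro x; rfl
  | mul u v _ _ hu hv =>
    intro x
    rw [LinearEquiv.mul_apply, hu, hv]
  | inv u _ hu =>
    intro x
    have := hu (u⁻¹ x)
    rw [← LinearEquiv.mul_apply, mul_inv_cancel] at this
    exact this.symm

/-- The invariant polynomial `x_1 ^ 2 + ⋯ + x_N ^ 2`. -/
def sumSq (R : Finset (RSpace N)) : invPoly R :=
  ⟨∑ i, MvPolynomial.X i ^ 2, by
    intro w hw
    apply MvPolynomial.funext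
    intro x
    rw [eval_polyAct]
    have := reflGroup_dot (inv_mem hw) x
    simpa [dotProduct, sq] using this⟩

/-! ### Functions with values in a complex vector space -/

variable {U : Type*} [AddCommGroup U] [Module ℂ U]

/-- `d` is the derivative of `F : V → U` at `x` in the direction `ξ`. As `U` is a bare complex
vector space, this is tested against the linear functionals on `U`. -/
def HasDirDeriv (ξ : CSpace N) (F : CSpace N → U) (x : CSpace N) (d : U) : Prop :=
  ∀ φ : Module.Dual ℂ U, HasDerivAt (fun t : ℂ => φ (F (x + t • ξ))) (φ d) 0

open Classical in
/-- The directional derivative `∂_ξ F` (`0` where it does not exist). -/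
def dirDeriv (ξ : CSpace N) (F : CSpace N → U) (x : CSpace N) : U :=
  if h : ∃ d, HasDirDeriv ξ F x d then h.choose else 0

theorem HasDirDeriv.dirDeriv_eq {ξ : CSpace N} {F : CSpace N → U} {x : CSpace N} {d : U}
    (h : HasDirDeriv ξ F x d) : dirDeriv ξ F x = d := by
  have h' : ∃ d, HasDirDeriv ξ F x d := ⟨d, h⟩
  rw [dirDeriv, dif_pos h', ← sub_eq_zero, ← Module.forall_dual_apply_eq_zero_iff ℂ]
  intro φ
  rw [map_sub, sub_eq_zero]
  exact (h'.choose_spec φ).unique (h φ)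

/-- Derivatives act on the function factor of `∑ f_j ⊗ u_j`. -/
theorem dirDeriv_sum {ι : Type*} (s : Finset ι) (f : ι → CSpace N → ℂ) (u : ι → U)
    {x : CSpace N} (hf : ∀ j ∈ s, DifferentiableAt ℂ (f j) x) (ξ : CSpace N) :
    dirDeriv ξ (fun y => ∑ j ∈ s, f j y • u j) x = ∑ j ∈ s, fderiv ℂ (f j) x ξ • u j := by
  apply HasDirDeriv.dirDeriv_eq
  intro φ
  simp only [map_sum, map_smul, smul_eq_mul]
  refine HasDerivAt.fun_sum fun j hj => HasDerivAt.mul_const ?_ _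
  exact (hf j hj).hasFDerivAt.hasLineDerivAt ξ

open Classical in
/-- The operator `(α, x)⁻¹ (1 - s_α)`, where `s_α` acts by `(s_α F)(x) = F(s_α x)` (that is, as
`id ⊗ s_α`). On the mirror `(α, x) = 0` its value on an analytic function is the limit
`2 / (α, α) ∂_α F`. -/
def divDiff (α : RSpace N) (F : CSpace N → U) (x : CSpace N) : U :=
  if cx α ⬝ᵥ x = 0 then (2 / (cx α ⬝ᵥ cx α)) • dirDeriv (cx α) F x
  else (cx α ⬝ᵥ x)⁻¹ • (F x - F (refl α x))

/-- The Dunkl operator `∇_ξ` on functions with values in `U`. -/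
def dunkl {R : Finset (RSpace N)} (S : Finset (RSpace N)) (c : R → ℂ) (ξ : CSpace N)
    (F : CSpace N → U) (x : CSpace N) : U :=
  dirDeriv ξ F x - ∑ α ∈ posRoots R S, (c α * (cx α ⬝ᵥ ξ)) • divDiff (α : RSpace N) F x

/-- The operator `∇_1 ^ {m_1} ⋯ ∇_N ^ {m_N}`. -/
def dunklMonomial {R : Finset (RSpace N)} (S : Finset (RSpace N)) (c : R → ℂ) (m : Fin N →₀ ℕ)
    (F : CSpace N → U) : CSpace N → U :=
  (List.finRange N).foldr (fun i G => (dunkl S c (Pi.single i 1))^[m i] G) F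

/-- The operator `p(∇) = p(∇_1, …, ∇_N)`. -/
def dunklPoly {R : Finset (RSpace N)} (S : Finset (RSpace N)) (c : R → ℂ) (p : Poly N)
    (F : CSpace N → U) : CSpace N → U :=
  ∑ m ∈ p.support, p.coeff m • dunklMonomial S c m F

/-! ### Germs -/

/-- Germs along the filter `l` of the `U`-valued functions that are analytic at `x`, i.e. of finite
sums `∑ f_j ⊗ u_j` with `u_j ∈ U` and `f_j` analytic at `x`. For `l = 𝓝 x` these are the analytic
germs at `x` on `V`, for `l = 𝓝[D] x` the analytic germs at `x` on `D`, i.e. the restrictions to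
`D` of the former. -/
def analyticGerms (U : Type*) [AddCommGroup U] [Module ℂ U] (l : Filter (CSpace N))
    (x : CSpace N) : Submodule ℂ (Germ l U) :=
  Submodule.span ℂ {g | ∃ (f : CSpace N → ℂ) (u : U), AnalyticAt ℂ f x ∧
    g = ((fun y => f y • u : CSpace N → U) : Germ l U)}

/-- The diagonal action `(w F)(y) = F(w⁻¹ y) · w⁻¹`, for a right `W`-module `U`
(`v · w` is `ρ (op w) v`). -/
def diagAct {R : Finset (RSpace N)} (ρ : Representation ℂ (reflGroup R)ᵐᵒᵖ U) (w : reflGroup R)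
    (F : CSpace N → U) (y : CSpace N) : U :=
  ρ (MulOpposite.op w⁻¹) (F (((w⁻¹ : reflGroup R) : CSpace N ≃ₗ[ℂ] CSpace N) y))

/-- The space of `W₀`-invariant analytic `U`-valued germs on the stratum `D` at `x₀`. -/
def invGerms {R : Finset (RSpace N)} (Γ₀ : Finset (RSpace N))
    (ρ : Representation ℂ (reflGroup R)ᵐᵒᵖ U) (x₀ : CSpace N) :
    Submodule ℂ (Germ (𝓝[stratum R Γ₀] x₀) U) where
  carrier := {g | g ∈ analyticGerms U (𝓝[stratum R Γ₀] x₀) x₀ ∧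
    ∃ F : CSpace N → U, (F : Germ (𝓝[stratum R Γ₀] x₀) U) = g ∧
      ∀ w : reflGroup R, (w : CSpace N ≃ₗ[ℂ] CSpace N) ∈ reflGroup Γ₀ →
        diagAct ρ w F =ᶠ[𝓝[stratum R Γ₀] x₀] F}
  add_mem' := by
    rintro _ _ ⟨h1, F, rfl, hF⟩ ⟨h2, G, rfl, hG⟩
    refine ⟨add_mem h1 h2, F + G, rfl, fun w hw => ?_⟩
    filter_upwards [hF w hw, hG w hw] with y h h'
    rw [Pi.add_apply, ← h, ← h']
    simp [diagAct]
  zero_mem' := ⟨zero_mem _, 0, rfl, fun w _ => by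
    filter_upwards with y
    simp [diagAct]⟩
  smul_mem' := by
    rintro t _ ⟨h1, F, rfl, hF⟩
    refine ⟨Submodule.smul_mem _ t h1, t • F, rfl, fun w hw => ?_⟩
    filter_upwards [hF w hw] with y h
    rw [Pi.smul_apply, ← h]
    simp [diagAct]

/-- `F` is an analytic `U`-valued function near the orbit `W x₀` in `V` whose restriction to `D`
near `W x₀` is a `W`-invariant sum of germs, with germ `g` at `x₀`. -/
structure Represents {R : Finset (RSpace N)} (Γ₀ : Finset (RSpace N))
    (ρ : Representation ℂ (reflGroup R)ᵐᵒᵖ U) (x₀ : CSpace N) (F : CSpace N → U)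
    (g : invGerms Γ₀ ρ x₀) : Prop where
  analytic : ∀ x ∈ orbit R x₀, (F : Germ (𝓝 x) U) ∈ analyticGerms U (𝓝 x) x
  invariant : ∀ w : reflGroup R, ∀ x ∈ orbit R x₀, diagAct ρ w F =ᶠ[𝓝[stratum R Γ₀] x] F
  germ_eq : (F : Germ (𝓝[stratum R Γ₀] x₀) U) = g

/-- `T` is the operator on `W₀`-invariant germs induced by `p(∇)`: a germ `g` is the germ at `x₀`
of a `W`-invariant sum of germs on `D` near `W x₀`; this is extended analytically to `V`, `p(∇)` is
applied, and the result is restricted to `D`. It has to be `W`-invariant again and not to depend on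
the extension `F`, and `T g` is its germ at `x₀`. -/
def IsRestriction {R : Finset (RSpace N)} (S Γ₀ : Finset (RSpace N)) (c : R → ℂ)
    (ρ : Representation ℂ (reflGroup R)ᵐᵒᵖ U) (x₀ : CSpace N) (p : Poly N)
    (T : Module.End ℂ (invGerms Γ₀ ρ x₀)) : Prop :=
  ∀ (F : CSpace N → U) (g : invGerms Γ₀ ρ x₀),
    Represents Γ₀ ρ x₀ F g → Represents Γ₀ ρ x₀ (dunklPoly S c p F) (T g)

/-- `v` is an orthonormal basis of `π` (with respect to the bilinear form). -/
def IsOrthonormalBasis (Γ₀ : Finset (RSpace N)) {n : ℕ} (v : Fin n → CSpace N) : Prop :=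
  (∀ i j, v i ⬝ᵥ v j = if i = j then 1 else 0) ∧ Submodule.span ℂ (Set.range v) = plane Γ₀

open Classical in
/-- The generalised spin Calogero-Moser operator
`Δ_y - ∑ 2 c_α / (α̂, y) ∂_α̂ + ∑ c_α (α, α) / (α̂, y)² (1 - P_α)`, the sums being over the positive
roots with `α̂ ≠ 0`, where `Δ_y` is the Laplacian of `π` in the orthonormal basis `v` and
`P_α u = u · s_α`. All derivatives are along `π`. -/
def spinCM {R : Finset (RSpace N)} (S Γ₀ : Finset (RSpace N)) (c : R → ℂ)
    (ρ : Representation ℂ (reflGroup R)ᵐᵒᵖ U) {n : ℕ} (v : Fin n → CSpace N)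
    (F : CSpace N → U) (y : CSpace N) : U :=
  ∑ k, dirDeriv (v k) (dirDeriv (v k) F) y
    - ∑ α ∈ (posRoots R S).filter (fun α : R => proj Γ₀ (α : RSpace N) ≠ 0),
        (2 * c α / (cx (proj Γ₀ α) ⬝ᵥ y)) • dirDeriv (cx (proj Γ₀ α)) F y
    + ∑ α ∈ (posRoots R S).filter (fun α : R => proj Γ₀ (α : RSpace N) ≠ 0),
        (c α * (cx (α : RSpace N) ⬝ᵥ cx (α : RSpace N)) / (cx (proj Γ₀ α) ⬝ᵥ y) ^ 2) •
          (F y - ρ (MulOpposite.op (reflW α)) (F y))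

end

end SpinCM

open SpinCM

/-!
The proof works with the algebra of operators on the `U`-valued functions that are analytic on an
open set `Ω` invariant under `W`, where `U` is a bare vector space and analyticity refers to finite
sums `∑ f_j u_j` with scalar `f_j`. On this space the derivatives, the divided differences
`(α, x)⁻¹ (1 - s_α)` (analytic because the power series of `F - s_α F` can be divided by `(α, x)`),
the group and the multiplications by linear forms are honest operators.

*Operator identities.* A family of operators which is natural in `Ω`, commutes with the
multiplication by linear forms and kills the constants is zero, by Hadamard's lemma
(`IsNatural.eq_zero`). So identities between operators reduce to computations of commutators with
linear forms; this gives the commutativity of the Dunkl operators (`dunklEnd_comm`) and the vanishing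
of the part of `∑ ∇_i ^ 2` that is quadratic in `c` (`sum_dd_mul_dd`).

*Restriction.* On a function vanishing on the stratum `D`, the operator `∇_ξ` acts at a generic
point of `π` as the derivative along the vector
`ξ - ∑ 2 c_α (α, ξ) / (α, α) α`, the sum being over the positive roots orthogonal to `π`. Applying
the hypothesis on the ideal of `D` to suitable products of linear forms shows that this vector lies
in `π` (`residue_mem_plane`). Hence the Dunkl operators preserve the analytic functions vanishing on
`D` (`dunklEnd_mem_vanishing`), and `p(∇) F` restricted to `D` depends only on the restriction of
`F`. For `p ∈ ℂ[x]^W` it is invariant if `F` is, by equivariance. An invariant germ at `x₀` does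
extend to an invariant sum of germs along the orbit, because the stabilizer of `x₀` is `W₀`
(`IsGeneric.stabilizer`, `exists_represents`). The restricted operators commute because the Dunkl
operators do.

*The Laplacian.* To compute the restriction of `∑ ∇_i ^ 2`, a germ on `π` is extended to a function
constant in the directions normal to `π` (`IsRestriction.sumSq_eq`). Then the normal derivatives and
the roots orthogonal to `π` contribute nothing, the remaining roots give the terms of the
Calogero-Moser operator, and the reflections `s_α` turn into `P_α` by invariance.
-/

namespace SpinCM

noncomputable section

/-! ### Division of analytic functions by linear forms -/

section AnalyticDivision

variable {E F : Type*} [NormedAddCommGroup E] [NormedSpace ℂ E]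
  [NormedAddCommGroup F] [NormedSpace ℂ F]

/-- The vector which agrees with `y` in the first `j` places and with `s y` in the others. -/
def mixedVec (s : E →L[ℂ] E) (y : E) (m j : ℕ) : Fin m → E :=
  fun i => if (i : ℕ) < j then y else s y

/-- The coefficients of the quotient `(f (x + y) - f (x + s y)) / ℓ y`, where `y - s y = ℓ y • v`
and `p` is the power series of `f` at `x`: the telescoping sum of `p (y, …, y, v, s y, …, s y)`. -/
def quotSeries (p : FormalMultilinearSeries ℂ E F) (s : E →L[ℂ] E) (v : E) :
    FormalMultilinearSeries ℂ E F := fun n =>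
  ∑ j : Fin (n + 1), ((p (n + 1)).curryMid j v).compContinuousLinearMap
    (fun i : Fin n => if (i : ℕ) < j then ContinuousLinearMap.id ℂ E else s)

theorem quotSeries_apply (p : FormalMultilinearSeries ℂ E F) (s : E →L[ℂ] E) (v : E)
    (ℓ : E →L[ℂ] ℂ) (hs : ∀ y, y - s y = ℓ y • v) (n : ℕ) (y : E) :
    p (n + 1) (fun _ => y) - p (n + 1) (fun _ => s y) =
      ℓ y • quotSeries p s v n (fun _ => y) := by
  have key : ∀ j : Fin (n + 1), p (n + 1) (mixedVec s y (n + 1) (j + 1))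
      - p (n + 1) (mixedVec s y (n + 1) j)
      = ℓ y • (((p (n + 1)).curryMid j v).compContinuousLinearMap
    (fun i : Fin n => if (i : ℕ) < j then ContinuousLinearMap.id ℂ E else s)) (fun _ => y) := by
    intro j
    have h1 : mixedVec s y (n + 1) (j + 1) = Function.update (mixedVec s y (n + 1) j) j y := by
      funext i
      by_cases h : i = j
      · subst h; simp [mixedVec]
      · have h' : (i : ℕ) ≠ j := fun e => h (Fin.ext e)
        rw [Function.update_of_ne h]
        simp only [mixedVec]
        congr 1
        apply propext; omega
    have h2 : mixedVec s y (n + 1) j = Function.update (mixedVec s y (n + 1) j) j (s y) := by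
      rw [eq_comm, Function.update_eq_self_iff]
      simp [mixedVec]
    conv_lhs => rw [h1]; arg 2; rw [h2]
    rw [← ContinuousMultilinearMap.map_update_sub, hs, ContinuousMultilinearMap.map_update_smul]
    congr 1
    rw [ContinuousMultilinearMap.compContinuousLinearMap_apply,
      ContinuousMultilinearMap.curryMid_apply]
    congr 1
    funext i
    refine Fin.succAboveCases j ?_ (fun k => ?_) i
    · simp
    · rw [Function.update_of_ne (Fin.succAbove_ne j k), Fin.insertNth_apply_succAbove]
      have hiff : ((j.succAbove k : Fin (n + 1)) : ℕ) < j ↔ (k : ℕ) < j := by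
        rcases lt_or_ge (k : ℕ) (j : ℕ) with h | h
        · rw [Fin.succAbove_of_castSucc_lt j k (by simpa [Fin.lt_def] using h)]
          simp [h]
        · rw [Fin.succAbove_of_le_castSucc j k (by simpa [Fin.le_def] using h)]
          simp; omega
      simp only [mixedVec, hiff]
      split_ifs <;> simp
  have hsum := Finset.sum_congr rfl (fun j (_ : j ∈ (Finset.univ : Finset (Fin (n + 1)))) => key j)
  rw [← Finset.smul_sum, Fin.sum_univ_eq_sum_range
    (fun j => p (n + 1) (mixedVec s y (n + 1) (j + 1)) - p (n + 1) (mixedVec s y (n + 1) j)),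
    Finset.sum_range_sub (fun j => p (n + 1) (mixedVec s y (n + 1) j))] at hsum
  have e1 : mixedVec s y (n + 1) (n + 1) = fun _ => y := by
    funext i; simp only [mixedVec, i.2, if_true]
  have e0 : mixedVec s y (n + 1) 0 = fun _ => s y := by
    funext i; simp [mixedVec]
  rw [e1, e0] at hsum
  rw [hsum, quotSeries, _root_.sum_apply]

theorem quotSeries_radius_pos (p : FormalMultilinearSeries ℂ E F) (hp : 0 < p.radius)
    (s : E →L[ℂ] E) (v : E) : 0 < (quotSeries p s v).radius := by
  obtain ⟨K, r, hK, hr, hb⟩ := p.le_mul_pow_of_radius_pos hp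
  set C : ℝ := max 1 ‖s‖
  have hC : 1 ≤ C := le_max_left _ _
  have hbound : ∀ n, ‖quotSeries p s v n‖ ≤ (K * r * ‖v‖) * (2 * r * C) ^ n := by
    intro n
    have hterm : ∀ j : Fin (n + 1), ‖((p (n + 1)).curryMid j v).compContinuousLinearMap
        (fun i : Fin n => if (i : ℕ) < j then ContinuousLinearMap.id ℂ E else s)‖
        ≤ (K * r ^ (n + 1) * ‖v‖) * C ^ n := by
      intro j
      refine (ContinuousMultilinearMap.norm_compContinuousLinearMap_le _ _).trans ?_
      gcongr
      · refine (((p (n + 1)).curryMid j).le_opNorm v).trans ?_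
        rw [ContinuousMultilinearMap.norm_curryMid]
        gcongr
        exact hb _
      · calc ∏ i : Fin n, ‖if (i : ℕ) < j then ContinuousLinearMap.id ℂ E else s‖
            ≤ ∏ _i : Fin n, C := by
              apply Finset.prod_le_prod
              · intros; positivity
              · intro i _
                split_ifs
                · exact ContinuousLinearMap.norm_id_le.trans hC
                · exact le_max_right _ _
          _ = C ^ n := by simp
    calc ‖quotSeries p s v n‖ ≤ ∑ _j : Fin (n + 1), (K * r ^ (n + 1) * ‖v‖) * C ^ n :=
          (norm_sum_le _ _).trans (Finset.sum_le_sum fun j _ => hterm j)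
      _ = ((n + 1 : ℕ) : ℝ) * ((K * r ^ (n + 1) * ‖v‖) * C ^ n) := by simp
      _ ≤ (2 : ℝ) ^ n * ((K * r ^ (n + 1) * ‖v‖) * C ^ n) := by
          gcongr
          exact_mod_cast (Nat.lt_two_pow_self (n := n))
      _ = (K * r * ‖v‖) * (2 * r * C) ^ n := by rw [mul_pow, mul_pow]; ring
  have hpos : 0 < 2 * r * C := by positivity
  have hpos' : 0 < (2 * r * C)⁻¹ := inv_pos.2 hpos
  have := (quotSeries p s v).le_radius_of_bound (r := ((2 * r * C)⁻¹).toNNReal)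
    (K * r * ‖v‖) (fun n => by
      have := hbound n
      rw [Real.coe_toNNReal _ hpos'.le]
      calc ‖quotSeries p s v n‖ * ((2 * r * C)⁻¹) ^ n
          ≤ ((K * r * ‖v‖) * (2 * r * C) ^ n) * ((2 * r * C)⁻¹) ^ n := by gcongr
        _ = K * r * ‖v‖ := by
          rw [mul_assoc, ← mul_pow, mul_inv_cancel₀ hpos.ne', one_pow, mul_one])
  refine lt_of_lt_of_le ?_ this
  rw [ENNReal.coe_pos, Real.toNNReal_pos]
  exact hpos'

/-- Division of analytic functions by a linear form: if `y - s y = ℓ y • v`, then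
`f (x + y) - f (x + s y)` is divisible by `ℓ y`. -/
theorem exists_analytic_quotient [CompleteSpace F] {f : E → F} {x : E} (hf : AnalyticAt ℂ f x)
    (s : E →L[ℂ] E) (v : E) (ℓ : E →L[ℂ] ℂ) (hs : ∀ y, y - s y = ℓ y • v) :
    ∃ h : E → F, AnalyticAt ℂ h x ∧
      ∀ᶠ y in 𝓝 x, f y - f (x + s (y - x)) = ℓ (y - x) • h y := by
  obtain ⟨p, r, hp⟩ := hf
  have hq := quotSeries_radius_pos p (hp.r_pos.trans_le hp.r_le) s v
  have hQ := (quotSeries p s v).hasFPowerSeriesOnBall hq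
  have hQ' := hQ.comp_sub x
  rw [zero_add] at hQ'
  refine ⟨_, hQ'.analyticAt, ?_⟩
  have c1 : Tendsto (fun y : E => y - x) (𝓝 x) (𝓝 0) := by
    have : Continuous fun y : E => y - x := by fun_prop
    simpa using this.tendsto x
  have c2 : Tendsto (fun y : E => s (y - x)) (𝓝 x) (𝓝 0) := by
    have : Continuous fun y : E => s (y - x) := by fun_prop
    simpa using this.tendsto x
  filter_upwards [c1 (Metric.eball_mem_nhds 0 hp.r_pos), c2 (Metric.eball_mem_nhds 0 hp.r_pos),
    c1 (Metric.eball_mem_nhds 0 hq)] with y h1 h2 h3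
  have a1 := hp.hasSum h1
  have a2 := hp.hasSum h2
  have a3 := (hQ.hasSum h3).const_smul (ℓ (y - x))
  rw [add_sub_cancel] at a1
  rw [zero_add] at a3
  have a4 := a1.sub a2
  rw [← hasSum_nat_add_iff' 1] at a4
  have e : ∀ z : E, p 0 (fun _ => z) = p 0 (fun _ => 0) := fun z => by
    congr 1; funext i; exact i.elim0
  simp only [quotSeries_apply p s v ℓ hs, Finset.sum_range_one, e (y - x), e (s (y - x)), sub_self,
    sub_zero] at a4
  exact a4.unique a3

/-- Hadamard's lemma for analytic functions. -/
theorem exists_analytic_hadamard [CompleteSpace F] {f : E → F} {x : E} (hf : AnalyticAt ℂ f x) :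
    ∃ G : E → E →L[ℂ] F, AnalyticAt ℂ G x ∧ ∀ᶠ y in 𝓝 x, f y - f x = G y (y - x) := by
  obtain ⟨p, r, hp⟩ := hf
  have hq : 0 < p.shift.radius := by
    rw [FormalMultilinearSeries.radius_shift]; exact hp.r_pos.trans_le hp.r_le
  have hQ := p.shift.hasFPowerSeriesOnBall hq
  have hQ' := hQ.comp_sub x
  rw [zero_add] at hQ'
  refine ⟨_, hQ'.analyticAt, ?_⟩
  have c1 : Tendsto (fun y : E => y - x) (𝓝 x) (𝓝 0) := by
    have : Continuous fun y : E => y - x := by fun_prop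
    simpa using this.tendsto x
  filter_upwards [c1 (Metric.eball_mem_nhds 0 hp.r_pos), c1 (Metric.eball_mem_nhds 0 hq)]
    with y h1 h3
  have a1 := hp.hasSum h1
  have a3 := ((ContinuousLinearMap.apply ℂ F (y - x)).hasSum (hQ.hasSum h3))
  rw [add_sub_cancel, ← hasSum_nat_add_iff' 1] at a1
  rw [zero_add] at a3
  simp only [Finset.sum_range_one, hp.coeff_zero] at a1
  refine a1.unique ?_
  change HasSum _ (p.shift.sum (y - x) (y - x)) at a3
  convert a3 using 1
  funext n
  simp only [ContinuousLinearMap.apply_apply, FormalMultilinearSeries.shift,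
    ContinuousMultilinearMap.curryRight_apply]
  congr 1
  funext i
  refine Fin.lastCases ?_ (fun k => ?_) i <;> simp

end AnalyticDivision

/-! ### Real reflections -/

section RealReflections

open scoped InnerProductSpace

variable {N : ℕ}

/-- The real orthogonal reflection in the hyperplane orthogonal to `α`. -/
def rrefl (α : RSpace N) : RSpace N ≃ₗᵢ[ℝ] RSpace N := (ℝ ∙ α)ᗮ.reflection

theorem rrefl_apply (α x : RSpace N) :
    rrefl α x = x - (2 * ⟪α, x⟫_ℝ / ⟪α, α⟫_ℝ) • α := by
  rw [rrefl, Submodule.reflection_orthogonal_apply, Submodule.reflection_singleton_apply,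
    real_inner_self_eq_norm_sq]
  simp only [RCLike.ofReal_real_eq_id, id, two_smul, ← add_smul, neg_sub]
  congr 2
  ring

theorem rrefl_self (α : RSpace N) : rrefl α α = -α :=
  Submodule.reflection_orthogonalComplement_singleton_eq_neg α

theorem rrefl_mul_self (α : RSpace N) : rrefl α * rrefl α = 1 := by
  rw [rrefl]; exact Submodule.reflection_mul_reflection _

theorem rrefl_map (w : RSpace N ≃ₗᵢ[ℝ] RSpace N) (α : RSpace N) :
    rrefl (w α) = w * rrefl α * w⁻¹ := by
  ext1 x
  obtain ⟨y, rfl⟩ := w.surjective x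
  have : (w⁻¹ : RSpace N ≃ₗᵢ[ℝ] RSpace N) (w y) = y := w.symm_apply_apply y
  simp only [LinearIsometryEquiv.coe_mul, Function.comp_apply, this, rrefl_apply,
    LinearIsometryEquiv.inner_map_map, map_sub, map_smul]

theorem rrefl_neg (α : RSpace N) : rrefl (-α) = rrefl α := by
  ext1 x
  simp [rrefl_apply, neg_div]

/-- The real reflection group generated by the reflections in the elements of `S`. -/
def rGroup (S : Finset (RSpace N)) : Subgroup (RSpace N ≃ₗᵢ[ℝ] RSpace N) :=
  Subgroup.closure (rrefl '' (S : Set (RSpace N)))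

theorem rrefl_mem_rGroup {S : Finset (RSpace N)} {α : RSpace N} (h : α ∈ S) :
    rrefl α ∈ rGroup S := Subgroup.subset_closure ⟨α, h, rfl⟩

variable {R S : Finset (RSpace N)}

theorem IsRootSystem.map_mem (hR : IsRootSystem R) {w : RSpace N ≃ₗᵢ[ℝ] RSpace N}
    (hw : w ∈ rGroup R) : ∀ α ∈ R, w α ∈ R := by
  have hinj : ∀ α ∈ R, ∀ β ∈ R, rrefl α β ∈ R := hR.reflection_mem
  induction hw using Subgroup.closure_induction'' with
  | one => intro α h; exact h
  | mem x hx => obtain ⟨β, hβ, rfl⟩ := hx; exact hinj β hβ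
  | inv_mem x hx =>
    obtain ⟨β, hβ, rfl⟩ := hx
    rw [inv_eq_of_mul_eq_one_left (rrefl_mul_self β)]
    exact hinj β hβ
  | mul x y _ _ hx hy => intro α h; exact hx _ (hy _ h)

theorem IsRootSystem.neg_mem (hR : IsRootSystem R) {α : RSpace N} (h : α ∈ R) : -α ∈ R := by
  rw [← rrefl_self]; exact hR.reflection_mem α h α h

theorem IsRootSystem.ne_zero (hR : IsRootSystem R) {α : RSpace N} (h : α ∈ R) : α ≠ 0 := by
  rintro rfl; exact hR.zero_notMem h

theorem rGroup_sub_mem_span {w : RSpace N ≃ₗᵢ[ℝ] RSpace N} (hw : w ∈ rGroup R) (x : RSpace N) :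
    w x - x ∈ Submodule.span ℝ (R : Set (RSpace N)) := by
  have hr : ∀ α ∈ R, ∀ x, rrefl α x - x ∈ Submodule.span ℝ (R : Set (RSpace N)) := by
    intro α hα x
    rw [rrefl_apply, sub_sub_cancel_left]
    exact neg_mem (Submodule.smul_mem _ _ (Submodule.subset_span hα))
  induction hw using Subgroup.closure_induction'' generalizing x with
  | one => simp
  | mem y hy => obtain ⟨β, hβ, rfl⟩ := hy; exact hr β hβ x
  | inv_mem y hy =>
    obtain ⟨β, hβ, rfl⟩ := hy
    rw [inv_eq_of_mul_eq_one_left (rrefl_mul_self β)]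
    exact hr β hβ x
  | mul u v _ _ hu hv =>
    have := add_mem (hu (v x)) (hv x)
    rwa [sub_add_sub_cancel] at this

/-- The group acts faithfully on the roots: an element fixing all roots fixes their span, and it
moves every vector by an element of this span. -/
theorem IsRootSystem.finite_rGroup (hR : IsRootSystem R) : Finite (rGroup R) := by
  let f : rGroup R → (R → R) := fun w α => ⟨w.1 α, hR.map_mem w.2 α α.2⟩
  apply Finite.of_injective f
  intro u v huv
  have h : ∀ α ∈ R, u.1 α = v.1 α := fun α hα => congrArg Subtype.val (congrFun huv ⟨α, hα⟩)
  have hspan : ∀ z ∈ Submodule.span ℝ (R : Set (RSpace N)), u.1 z = v.1 z := by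
    intro z hz
    induction hz using Submodule.span_induction with
    | mem z hz => exact h z hz
    | zero => simp
    | add a b _ _ ha hb => simp [ha, hb]
    | smul t a _ ha => simp [ha]
  apply Subtype.ext
  ext1 x
  set z := (u.1⁻¹ * v.1) x - x with hz
  have hmem : u.1⁻¹ * v.1 ∈ rGroup R := mul_mem (inv_mem u.2) v.2
  have hzs : z ∈ Submodule.span ℝ (R : Set (RSpace N)) := rGroup_sub_mem_span hmem x
  have hfix : (u.1⁻¹ * v.1) z = z := by
    change u.1.symm (v.1 z) = z
    rw [← hspan z hzs, LinearIsometryEquiv.symm_apply_apply]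
  have h0 : ⟪z, z⟫_ℝ = 0 := by
    conv_lhs => rw [hz, inner_sub_left]
    rw [← hz]
    conv_lhs => arg 1; rw [← hfix]
    rw [LinearIsometryEquiv.inner_map_map, sub_self]
  rw [inner_self_eq_zero, hz, sub_eq_zero] at h0
  have : u.1 (u.1.symm (v.1 x)) = u.1 x := congrArg u.1 h0
  rw [LinearIsometryEquiv.apply_symm_apply] at this
  exact this.symm

/-! ### Simple systems -/

/-- A vector in the open dominant chamber. -/
theorem exists_inner_eq_one
    (hS : LinearIndependent ℝ (fun δ : S => (δ : RSpace N))) :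
    ∃ ρ : RSpace N, ∀ δ ∈ S, ⟪ρ, δ⟫_ℝ = 1 := by
  obtain ⟨f, hf⟩ := LinearMap.exists_extend ((Module.Basis.span hS).constr ℝ (fun _ => (1 : ℝ)))
  refine ⟨(InnerProductSpace.toDual ℝ (RSpace N)).symm (LinearMap.toContinuousLinearMap f),
    fun δ hδ => ?_⟩
  rw [InnerProductSpace.toDual_symm_apply]
  have h1 := (Module.Basis.span hS).constr_basis ℝ (fun _ => (1 : ℝ)) ⟨δ, hδ⟩
  rw [← hf] at h1
  rw [← h1]
  simp

theorem IsNonnegComb.inner_nonneg {α q : RSpace N} (h : IsNonnegComb S α)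
    (hq : ∀ δ ∈ S, 0 ≤ ⟪δ, q⟫_ℝ) : 0 ≤ ⟪α, q⟫_ℝ := by
  obtain ⟨a, ha, rfl⟩ := h
  rw [sum_inner]
  refine Finset.sum_nonneg fun δ hδ => ?_
  rw [real_inner_smul_left]
  exact mul_nonneg (ha δ hδ) (hq δ hδ)

theorem IsNonnegComb.inner_pos {α q : RSpace N} (h : IsNonnegComb S α) (h0 : α ≠ 0)
    (hq : ∀ δ ∈ S, 0 < ⟪δ, q⟫_ℝ) : 0 < ⟪α, q⟫_ℝ := by
  obtain ⟨a, ha, rfl⟩ := h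
  have : ∃ δ ∈ S, a δ ≠ 0 := by
    by_contra! hc
    exact h0 (Finset.sum_eq_zero fun δ hδ => by rw [hc δ hδ, zero_smul])
  obtain ⟨δ, hδ, hne⟩ := this
  rw [sum_inner]
  refine Finset.sum_pos' (fun γ hγ => ?_) ⟨δ, hδ, ?_⟩
  · rw [real_inner_smul_left]
    exact mul_nonneg (ha γ hγ) (hq γ hγ).le
  · rw [real_inner_smul_left]
    exact mul_pos (lt_of_le_of_ne (ha δ hδ) (Ne.symm hne)) (hq δ hδ)

theorem IsSimpleSystem.not_both (hS : IsSimpleSystem R S) {α : RSpace N} (h0 : α ≠ 0)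
    (h : IsNonnegComb S α) (h' : IsNonnegComb S (-α)) : False := by
  obtain ⟨ρ, hρ⟩ := exists_inner_eq_one hS.linearIndependent
  have hq : ∀ δ ∈ S, 0 < ⟪δ, ρ⟫_ℝ := fun δ hδ => by
    rw [real_inner_comm, hρ δ hδ]; exact one_pos
  have h1 := h.inner_pos h0 hq
  have h2 := h'.inner_pos (neg_ne_zero.2 h0) hq
  rw [inner_neg_left] at h2
  linarith

theorem isNonnegComb_of_mem {δ : RSpace N} (h : δ ∈ S) : IsNonnegComb S δ := by
  classical
  refine ⟨fun γ => if γ = δ then 1 else 0, fun γ _ => by positivity, ?_⟩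
  simp [h]

/-- A simple reflection permutes the positive roots other than its own root. -/
theorem IsSimpleSystem.rrefl_nonneg (hR : IsRootSystem R) (hS : IsSimpleSystem R S)
    {δ β : RSpace N} (hδ : δ ∈ S) (hβ : β ∈ R) (hβn : IsNonnegComb S β) (hne : β ≠ δ) :
    IsNonnegComb S (rrefl δ β) := by
  classical
  rcases hS.pos_or_neg _ (hR.reflection_mem δ (hS.subset hδ) β hβ) with h | h
  · exact h
  exfalso
  obtain ⟨a, ha, hβa⟩ := hβn
  have hex : ∃ γ ∈ S, γ ≠ δ ∧ 0 < a γ := by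
    by_contra! hc
    have h1 : β = a δ • δ := by
      rw [hβa]
      refine Finset.sum_eq_single_of_mem δ hδ fun γ hγ hγδ => ?_
      rw [le_antisymm (hc γ hγ hγδ) (ha γ hγ), zero_smul]
    rcases hR.reduced δ (hS.subset hδ) (a δ) (h1 ▸ hβ) with h2 | h2
    · rw [h2, one_smul] at h1; exact hne h1
    · have := ha δ hδ; linarith
  obtain ⟨γ, hγ, hγδ, hpos⟩ := hex
  obtain ⟨b, hb, hbe⟩ := h
  change -(rrefl δ β) = _ at hbe
  rw [rrefl_apply] at hbe
  set k := 2 * ⟪δ, β⟫_ℝ / ⟪δ, δ⟫_ℝ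
  have hli := (linearIndepOn_finset_iff (v := id)).1 hS.linearIndependent
    (fun ε => a ε + b ε - if ε = δ then k else 0) (by
      simp only [id, add_smul, sub_smul, Finset.sum_add_distrib, Finset.sum_sub_distrib, ← hβa,
        ← hbe, ite_smul, zero_smul, Finset.sum_ite_eq', hδ, if_true]
      abel) γ hγ
  simp only [hγδ, if_false, sub_zero] at hli
  have := hb γ hγ
  linarith

theorem rGroup_mono {S T : Finset (RSpace N)} (h : S ⊆ T) : rGroup S ≤ rGroup T :=
  Subgroup.closure_mono (Set.image_mono (by exact_mod_cast h))

/-- Every positive root is a simple root up to the action of the group: minimise the height. -/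
theorem IsSimpleSystem.exists_map_eq_pos (hR : IsRootSystem R) (hS : IsSimpleSystem R S)
    {α : RSpace N} (hα : α ∈ R) (hn : IsNonnegComb S α) :
    ∃ w ∈ rGroup S, ∃ δ ∈ S, w α = δ := by
  classical
  obtain ⟨ρ, hρ⟩ := exists_inner_eq_one hS.linearIndependent
  obtain ⟨β, hβ, hmin⟩ := Finset.exists_min_image
    (R.filter fun β => IsNonnegComb S β ∧ ∃ w ∈ rGroup S, w α = β) (fun β => ⟪ρ, β⟫_ℝ)
    ⟨α, by simp only [Finset.mem_filter]; exact ⟨hα, hn, 1, one_mem _, rfl⟩⟩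
  simp only [Finset.mem_filter] at hβ hmin
  obtain ⟨hβR, hβn, w, hw, hwβ⟩ := hβ
  have h1 : ∃ δ ∈ S, 0 < ⟪δ, β⟫_ℝ := by
    by_contra! hc
    have h2 : 0 ≤ ⟪β, -β⟫_ℝ := hβn.inner_nonneg fun δ hδ => by
      rw [inner_neg_right]; linarith [hc δ hδ]
    rw [inner_neg_right] at h2
    have h3 : 0 < ⟪β, β⟫_ℝ := real_inner_self_pos.2 (hR.ne_zero hβR)
    linarith
  obtain ⟨δ, hδ, hpos⟩ := h1
  by_cases hne : β = δ
  · exact ⟨w, hw, δ, hδ, hwβ.trans hne⟩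
  exfalso
  have := hmin (rrefl δ β) ⟨hR.reflection_mem δ (hS.subset hδ) β hβR,
    hS.rrefl_nonneg hR hδ hβR hβn hne, rrefl δ * w, mul_mem (rrefl_mem_rGroup hδ) hw, by
      rw [LinearIsometryEquiv.coe_mul, Function.comp_apply, hwβ]⟩
  rw [rrefl_apply, inner_sub_right, real_inner_smul_right, hρ δ hδ, mul_one] at this
  have h4 : 0 < 2 * ⟪δ, β⟫_ℝ / ⟪δ, δ⟫_ℝ :=
    div_pos (by linarith) (real_inner_self_pos.2 (hR.ne_zero (hS.subset hδ)))
  linarith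

/-- The reflections in all roots are generated by the simple reflections. -/
theorem IsSimpleSystem.rrefl_mem (hR : IsRootSystem R) (hS : IsSimpleSystem R S)
    {α : RSpace N} (hα : α ∈ R) : rrefl α ∈ rGroup S := by
  have key : ∀ α ∈ R, IsNonnegComb S α → rrefl α ∈ rGroup S := by
    intro α hα hn
    obtain ⟨w, hw, δ, hδ, e⟩ := hS.exists_map_eq_pos hR hα hn
    have e' : α = (w⁻¹ : RSpace N ≃ₗᵢ[ℝ] RSpace N) δ := by
      rw [← e]; exact (w.symm_apply_apply α).symm
    rw [e', rrefl_map]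
    exact mul_mem (mul_mem (inv_mem hw) (rrefl_mem_rGroup hδ)) (inv_mem (inv_mem hw))
  rcases hS.pos_or_neg α hα with h | h
  · exact key α hα h
  · rw [← rrefl_neg]; exact key _ (hR.neg_mem hα) h

theorem IsSimpleSystem.rGroup_eq (hR : IsRootSystem R) (hS : IsSimpleSystem R S) :
    rGroup R = rGroup S := by
  apply le_antisymm
  · rw [rGroup, Subgroup.closure_le]
    rintro _ ⟨α, hα, rfl⟩
    exact hS.rrefl_mem hR hα
  · exact rGroup_mono hS.subset

/-- Every vector can be moved into the closed dominant chamber. -/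
theorem IsSimpleSystem.exists_dominant (hR : IsRootSystem R) (hS : IsSimpleSystem R S)
    (q : RSpace N) : ∃ u ∈ rGroup S, ∀ δ ∈ S, 0 ≤ ⟪δ, u q⟫_ℝ := by
  obtain ⟨ρ, hρ⟩ := exists_inner_eq_one hS.linearIndependent
  have : Finite (rGroup S) := by rw [← hS.rGroup_eq hR]; exact hR.finite_rGroup
  obtain ⟨u, hu⟩ := Finite.exists_max (fun u : rGroup S => ⟪ρ, u.1 q⟫_ℝ)
  refine ⟨u, u.2, fun δ hδ => ?_⟩
  have := hu (⟨rrefl δ, rrefl_mem_rGroup hδ⟩ * u)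
  change ⟪ρ, rrefl δ (u.1 q)⟫_ℝ ≤ _ at this
  rw [rrefl_apply, inner_sub_right, real_inner_smul_right, hρ δ hδ, mul_one] at this
  have h0 : 0 < ⟪δ, δ⟫_ℝ := real_inner_self_pos.2 (hR.ne_zero (hS.subset hδ))
  have h1 : 0 ≤ 2 * ⟪δ, u.1 q⟫_ℝ / ⟪δ, δ⟫_ℝ := by linarith
  rw [le_div_iff₀ h0] at h1
  linarith

/-- The exchange condition. -/
theorem IsSimpleSystem.exchange (hR : IsRootSystem R) (hS : IsSimpleSystem R S)
    (l : List (RSpace N)) (hl : ∀ γ ∈ l, γ ∈ S) {δ : RSpace N} (hδ : δ ∈ S)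
    (hneg : ¬ IsNonnegComb S ((l.map rrefl).prod δ)) :
    ∃ l' : List (RSpace N), (∀ γ ∈ l', γ ∈ S) ∧ l'.length + 1 = l.length ∧
      (l.map rrefl).prod * rrefl δ = (l'.map rrefl).prod := by
  induction l with
  | nil => exact absurd (isNonnegComb_of_mem hδ) hneg
  | cons γ t ih =>
    simp only [List.mem_cons, forall_eq_or_imp] at hl
    simp only [List.map_cons, List.prod_cons] at hneg ⊢
    rw [LinearIsometryEquiv.coe_mul, Function.comp_apply] at hneg
    by_cases h : IsNonnegComb S ((t.map rrefl).prod δ)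
    · have hmem : (t.map rrefl).prod ∈ rGroup R := by
        apply Subgroup.list_prod_mem
        intro x hx
        obtain ⟨y, hy, rfl⟩ := List.mem_map.1 hx
        exact rrefl_mem_rGroup (hS.subset (hl.2 y hy))
      have heq : (t.map rrefl).prod δ = γ := by
        by_contra hne
        exact hneg (hS.rrefl_nonneg hR hl.1 (hR.map_mem hmem _ (hS.subset hδ)) h hne)
      refine ⟨t, hl.2, by simp, ?_⟩
      rw [← heq]
      generalize (t.map rrefl).prod = T
      rw [rrefl_map, inv_mul_cancel_right, mul_assoc, rrefl_mul_self, mul_one]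
    · obtain ⟨l', h1, h2, h3⟩ := ih hl.2 h
      refine ⟨γ :: l', by simp only [List.mem_cons, forall_eq_or_imp]; exact ⟨hl.1, h1⟩,
        by simp only [List.length_cons, h2], ?_⟩
      rw [List.map_cons, List.prod_cons, ← h3, mul_assoc]

theorem exists_list_of_mem_rGroup {w : RSpace N ≃ₗᵢ[ℝ] RSpace N} (hw : w ∈ rGroup S) :
    ∃ l : List (RSpace N), (∀ γ ∈ l, γ ∈ S) ∧ (l.map rrefl).prod = w := by
  induction hw using Subgroup.closure_induction'' with
  | one => exact ⟨[], by simp, rfl⟩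
  | mem y hy => obtain ⟨β, hβ, rfl⟩ := hy; exact ⟨[β], by simpa using hβ, by simp⟩
  | inv_mem y hy =>
    obtain ⟨β, hβ, rfl⟩ := hy
    rw [inv_eq_of_mul_eq_one_left (rrefl_mul_self β)]
    exact ⟨[β], by simpa using hβ, by simp⟩
  | mul u v _ _ hu hv =>
    obtain ⟨l, hl, rfl⟩ := hu
    obtain ⟨m, hm, rfl⟩ := hv
    refine ⟨l ++ m, fun γ h => ?_, by simp⟩
    rcases List.mem_append.1 h with h | h
    exacts [hl γ h, hm γ h]

/-- An element of the group which preserves positivity of the simple roots is trivial. -/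
theorem IsSimpleSystem.eq_one (hR : IsRootSystem R) (hS : IsSimpleSystem R S)
    {w : RSpace N ≃ₗᵢ[ℝ] RSpace N} (hw : w ∈ rGroup S)
    (hpos : ∀ δ ∈ S, IsNonnegComb S (w δ)) : w = 1 := by
  classical
  have hex : ∃ n, ∃ l : List (RSpace N), (∀ γ ∈ l, γ ∈ S) ∧ (l.map rrefl).prod = w ∧
      l.length = n := by
    obtain ⟨l, h1, h2⟩ := exists_list_of_mem_rGroup hw
    exact ⟨_, l, h1, h2, rfl⟩
  obtain ⟨l, h1, h2, h3⟩ := Nat.find_spec hex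
  -- A word of minimal length ending in `δ` could be shortened by the exchange condition.
  rcases List.eq_nil_or_concat l with rfl | ⟨t, δ, rfl⟩
  · simpa using h2.symm
  exfalso
  have ht : ∀ γ ∈ t, γ ∈ S := fun γ h => h1 γ (by simp [h])
  have hδ : δ ∈ S := h1 δ (by simp)
  have hw' : (t.map rrefl).prod * rrefl δ = w := by rw [← h2]; simp
  have hwδ : w δ = -(t.map rrefl).prod δ := by
    rw [← hw', LinearIsometryEquiv.coe_mul, Function.comp_apply, rrefl_self, map_neg]
  have hne : (t.map rrefl).prod δ ≠ 0 := by
    rw [Ne, LinearIsometryEquiv.map_eq_zero_iff]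
    exact hR.ne_zero (hS.subset hδ)
  obtain ⟨l', g1, g2, g3⟩ := hS.exchange hR t ht hδ (fun hc =>
    hS.not_both hne hc (hwδ ▸ hpos δ hδ))
  have := Nat.find_min' hex ⟨l', g1, by rw [← g3, hw'], rfl⟩
  rw [← h3] at this
  simp at this
  omega

/-! ### Parabolic subgroups as stabilizers -/

variable {Γ₀ : Finset (RSpace N)}

open Classical in
/-- The roots in the span of `Γ₀`. -/
def parabolicRoots (R Γ₀ : Finset (RSpace N)) : Finset (RSpace N) :=
  R.filter fun α => α ∈ Submodule.span ℝ (Γ₀ : Set (RSpace N))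

theorem mem_parabolicRoots {α : RSpace N} : α ∈ parabolicRoots R Γ₀ ↔
    α ∈ R ∧ α ∈ Submodule.span ℝ (Γ₀ : Set (RSpace N)) := by
  classical
  simp [parabolicRoots]

theorem IsRootSystem.parabolicRoots (hR : IsRootSystem R) (Γ₀ : Finset (RSpace N)) :
    IsRootSystem (parabolicRoots R Γ₀) where
  zero_notMem := fun h => hR.zero_notMem (mem_parabolicRoots.1 h).1
  reduced := fun α hα t ht =>
    hR.reduced α (mem_parabolicRoots.1 hα).1 t (mem_parabolicRoots.1 ht).1
  reflection_mem := fun α hα β hβ => by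
    rw [mem_parabolicRoots] at *
    refine ⟨hR.reflection_mem α hα.1 β hβ.1, ?_⟩
    change rrefl α β ∈ _
    rw [rrefl_apply]
    exact sub_mem hβ.2 (Submodule.smul_mem _ _ hα.2)

theorem IsSimpleSystem.parabolicRoots (hS : IsSimpleSystem R S) (hΓ : Γ₀ ⊆ S) :
    IsSimpleSystem (parabolicRoots R Γ₀) Γ₀ where
  subset := fun γ hγ => mem_parabolicRoots.2 ⟨hS.subset (hΓ hγ), Submodule.subset_span hγ⟩
  linearIndependent :=
    (show LinearIndepOn ℝ id (S : Set (RSpace N)) from hS.linearIndependent).mono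
      (by exact_mod_cast hΓ)
  pos_or_neg := by
    classical
    have key : ∀ α ∈ Submodule.span ℝ (Γ₀ : Set (RSpace N)), IsNonnegComb S α →
        IsNonnegComb Γ₀ α := by
      rintro α hα ⟨a, ha, e⟩
      obtain ⟨b, -, hb⟩ := Submodule.mem_span_finset.1 hα
      have hli := (linearIndepOn_finset_iff (v := id)).1 hS.linearIndependent
        (fun ε => a ε - if ε ∈ Γ₀ then b ε else 0) (by
          simp only [id, sub_smul, Finset.sum_sub_distrib, ← e, ite_smul, zero_smul,
            Finset.sum_ite_mem, Finset.inter_eq_right.2 hΓ, hb, sub_self])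
      refine ⟨a, fun δ hδ => ha δ (hΓ hδ), ?_⟩
      rw [e]
      refine (Finset.sum_subset hΓ fun δ hδ hδ' => ?_).symm
      have := hli δ hδ
      simp only [hδ', if_false, sub_zero] at this
      rw [this, zero_smul]
    intro α hα
    rw [mem_parabolicRoots] at hα
    rcases hS.pos_or_neg α hα.1 with h | h
    · exact Or.inl (key α hα.2 h)
    · exact Or.inr (key _ (neg_mem hα.2) h)

theorem rGroup_fix {a : RSpace N} (ha : ∀ γ ∈ Γ₀, ⟪γ, a⟫_ℝ = 0)
    {u : RSpace N ≃ₗᵢ[ℝ] RSpace N} (hu : u ∈ rGroup Γ₀) : u a = a := by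
  have hr : ∀ γ ∈ Γ₀, rrefl γ a = a := fun γ hγ => by
    rw [rrefl_apply, ha γ hγ]; simp
  induction hu using Subgroup.closure_induction'' with
  | one => rfl
  | mem y hy => obtain ⟨β, hβ, rfl⟩ := hy; exact hr β hβ
  | inv_mem y hy =>
    obtain ⟨β, hβ, rfl⟩ := hy
    rw [inv_eq_of_mul_eq_one_left (rrefl_mul_self β)]
    exact hr β hβ
  | mul u v _ _ hu hv => rw [LinearIsometryEquiv.coe_mul, Function.comp_apply, hv, hu]

/-- The stabiliser of a vector `a` is the parabolic subgroup of `Γ₀`, if the roots orthogonal to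
`a` are those in the span of `Γ₀`. -/
theorem IsSimpleSystem.stabilizer (hR : IsRootSystem R) (hS : IsSimpleSystem R S) (hΓ : Γ₀ ⊆ S)
    {a : RSpace N} (ha : ∀ γ ∈ Γ₀, ⟪γ, a⟫_ℝ = 0)
    (ha' : ∀ α ∈ R, ⟪α, a⟫_ℝ = 0 → α ∈ Submodule.span ℝ (Γ₀ : Set (RSpace N)))
    {w : RSpace N ≃ₗᵢ[ℝ] RSpace N} (hw : w ∈ rGroup R) (hwa : w a = a) : w ∈ rGroup Γ₀ := by
  have hS₀ := hS.parabolicRoots hΓ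
  have hR₀ := hR.parabolicRoots Γ₀
  obtain ⟨ρ, hρ⟩ := exists_inner_eq_one hS₀.linearIndependent
  have hρ' : ∀ γ ∈ Γ₀, 0 < ⟪γ, ρ⟫_ℝ := fun γ hγ => by
    rw [real_inner_comm, hρ γ hγ]; exact one_pos
  have hinv : ∀ (z : RSpace N ≃ₗᵢ[ℝ] RSpace N) (x y : RSpace N), ⟪x, z y⟫_ℝ = ⟪z⁻¹ x, y⟫_ℝ := by
    intro z x y
    rw [← z.inner_map_map (z⁻¹ x) y]
    congr 1
    exact (z.apply_symm_apply x).symm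
  obtain ⟨u, hu, hdom⟩ := hS₀.exists_dominant hR₀ (w ρ)
  -- The correction by `u ∈ W₀` makes `v = u w` preserve the dominant chamber of `Γ₀`; then `v = 1`.
  set v := u * w with hv
  have hvR : v ∈ rGroup R := mul_mem (rGroup_mono (hΓ.trans hS.subset) hu) hw
  have hva : v a = a := by
    rw [hv, LinearIsometryEquiv.coe_mul, Function.comp_apply, hwa, rGroup_fix ha hu]
  have hva' : v⁻¹ a = a := by
    conv_lhs => rw [← hva]
    exact v.symm_apply_apply a
  have hreg : ∀ α ∈ R, ⟪α, a⟫_ℝ = 0 → ⟪α, ρ⟫_ℝ ≠ 0 := by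
    intro α hα h0
    have hα₀ : α ∈ SpinCM.parabolicRoots R Γ₀ := mem_parabolicRoots.2 ⟨hα, ha' α hα h0⟩
    rcases hS₀.pos_or_neg α hα₀ with h | h
    · exact (h.inner_pos (hR.ne_zero hα) hρ').ne'
    · have := h.inner_pos (neg_ne_zero.2 (hR.ne_zero hα)) hρ'
      rw [inner_neg_left] at this
      intro h; linarith
  have hdom' : ∀ γ ∈ Γ₀, 0 < ⟪γ, v ρ⟫_ℝ := by
    intro γ hγ
    refine lt_of_le_of_ne (hdom γ hγ) (Ne.symm ?_)
    rw [hinv]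
    apply hreg _ (hR.map_mem (inv_mem hvR) γ (hS.subset (hΓ hγ)))
    have := hinv v γ a
    rw [hva, ha γ hγ] at this
    exact this.symm
  -- For small `ε`, the vector `a + ε ρ` and its image under `v` lie in the same chamber.
  have hchamber : ∀ᶠ ε : ℝ in 𝓝[>] 0, ∀ α ∈ R,
      0 < ⟪α, a + ε • ρ⟫_ℝ * ⟪α, a + ε • v ρ⟫_ℝ := by
    rw [Filter.eventually_all_finset]
    intro α hα
    simp only [inner_add_right, real_inner_smul_right]
    by_cases h0 : ⟪α, a⟫_ℝ = 0
    · have hα₀ : α ∈ SpinCM.parabolicRoots R Γ₀ := mem_parabolicRoots.2 ⟨hα, ha' α hα h0⟩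
      have hprod : 0 < ⟪α, ρ⟫_ℝ * ⟪α, v ρ⟫_ℝ := by
        rcases hS₀.pos_or_neg α hα₀ with h | h
        · exact mul_pos (h.inner_pos (hR.ne_zero hα) hρ') (h.inner_pos (hR.ne_zero hα) hdom')
        · have h1 := h.inner_pos (neg_ne_zero.2 (hR.ne_zero hα)) hρ'
          have h2 := h.inner_pos (neg_ne_zero.2 (hR.ne_zero hα)) hdom'
          rw [inner_neg_left] at h1 h2
          nlinarith
      filter_upwards [self_mem_nhdsWithin] with ε hε
      have hε' : (0 : ℝ) < ε := hε
      rw [h0]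
      have : 0 < ε * ε * (⟪α, ρ⟫_ℝ * ⟪α, v ρ⟫_ℝ) := by positivity
      nlinarith
    · have hc : Continuous fun ε : ℝ => (⟪α, a⟫_ℝ + ε * ⟪α, ρ⟫_ℝ) * (⟪α, a⟫_ℝ + ε * ⟪α, v ρ⟫_ℝ) := by
        fun_prop
      have hpos : (0 : ℝ) < (⟪α, a⟫_ℝ + 0 * ⟪α, ρ⟫_ℝ) * (⟪α, a⟫_ℝ + 0 * ⟪α, v ρ⟫_ℝ) := by
        rw [zero_mul, zero_mul, add_zero]
        exact mul_self_pos.2 h0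
      exact nhdsWithin_le_nhds (hc.continuousAt.eventually_const_lt hpos)
  obtain ⟨ε, hε⟩ := hchamber.exists
  set p := a + ε • ρ
  have hvp : v p = a + ε • v ρ := by simp only [p, map_add, map_smul, hva]
  rw [← hvp] at hε
  obtain ⟨t, ht, htdom⟩ := hS.exists_dominant hR p
  have htR : t ∈ rGroup R := rGroup_mono hS.subset ht
  have htdom' : ∀ δ ∈ S, 0 < ⟪δ, t p⟫_ℝ ∧ 0 < ⟪δ, t (v p)⟫_ℝ := by
    intro δ hδ
    have h1 := htdom δ hδ
    rw [hinv] at h1 ⊢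
    have h2 := hε _ (hR.map_mem (inv_mem htR) δ (hS.subset hδ))
    rw [hinv t δ]
    have h3 : 0 < ⟪t⁻¹ δ, p⟫_ℝ := lt_of_le_of_ne h1 (fun h => by rw [← h, zero_mul] at h2; exact lt_irrefl _ h2)
    exact ⟨h3, (mul_pos_iff_of_pos_left h3).1 h2⟩
  have hz : t * v * t⁻¹ = 1 := by
    have hzR : t * v * t⁻¹ ∈ rGroup R := mul_mem (mul_mem htR hvR) (inv_mem htR)
    apply hS.eq_one hR (by rwa [← hS.rGroup_eq hR])
    intro δ hδ
    rcases hS.pos_or_neg _ (hR.map_mem hzR δ (hS.subset hδ)) with h | h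
    · exact h
    exfalso
    have h1 := h.inner_nonneg (q := t (v p)) fun γ hγ => (htdom' γ hγ).2.le
    have h2 : ⟪(t * v * t⁻¹) δ, t (v p)⟫_ℝ = ⟪δ, t p⟫_ℝ := by
      change ⟪t (v (t⁻¹ δ)), t (v p)⟫_ℝ = _
      rw [LinearIsometryEquiv.inner_map_map, LinearIsometryEquiv.inner_map_map, hinv]
    rw [inner_neg_left, h2] at h1
    linarith [(htdom' δ hδ).1]
  have hv1 : v = 1 := by
    have := congrArg (fun z => t⁻¹ * z * t) hz
    simpa [mul_assoc] using this
  have : w = u⁻¹ := by rw [hv] at hv1; exact (inv_eq_of_mul_eq_one_right hv1).symm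
  rw [this]
  exact inv_mem hu

end RealReflections

section Reflections

open scoped InnerProductSpace

variable {N : ℕ} {R S Γ₀ : Finset (RSpace N)}

/-! ### Complexification -/

theorem cx_add (a b : RSpace N) : cx (a + b) = cx a + cx b := by
  funext i; simp [cx]

theorem cx_sub (a b : RSpace N) : cx (a - b) = cx a - cx b := by
  funext i; simp [cx]

theorem cx_neg (a : RSpace N) : cx (-a) = -cx a := by
  funext i; simp [cx]

theorem cx_smul (t : ℝ) (a : RSpace N) : cx (t • a) = (t : ℂ) • cx a := by
  funext i; simp [cx]

theorem cx_injective : Function.Injective (cx : RSpace N → CSpace N) := by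
  intro a b h
  ext i
  have := congrFun h i
  simpa [cx] using this

theorem cx_dot_cx (a b : RSpace N) : cx a ⬝ᵥ cx b = (⟪a, b⟫_ℝ : ℂ) := by
  rw [PiLp.inner_apply]
  simp [dotProduct, cx, mul_comm]

theorem cx_dot_self_ne_zero {a : RSpace N} (h : a ≠ 0) : cx a ⬝ᵥ cx a ≠ 0 := by
  rw [cx_dot_cx]
  exact_mod_cast (real_inner_self_pos.2 h).ne'

/-- The real part of a vector of `ℂ^N`. -/
def reV (x : CSpace N) : RSpace N := WithLp.toLp 2 fun i => (x i).re

/-- The imaginary part of a vector of `ℂ^N`. -/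
def imV (x : CSpace N) : RSpace N := WithLp.toLp 2 fun i => (x i).im

theorem cx_reV_add (x : CSpace N) : cx (reV x) + Complex.I • cx (imV x) = x := by
  funext i
  simp only [cx, reV, imV, Pi.add_apply, Pi.smul_apply, smul_eq_mul]
  rw [mul_comm]
  exact Complex.re_add_im (x i)

theorem reV_cx_add (a b : RSpace N) : reV (cx a + Complex.I • cx b) = a := by
  ext i; simp [reV, cx]

theorem imV_cx_add (a b : RSpace N) : imV (cx a + Complex.I • cx b) = b := by
  ext i; simp [imV, cx]

/-- The complexification of a real linear isometry, as a group homomorphism. -/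
def complexify : (RSpace N ≃ₗᵢ[ℝ] RSpace N) →* (CSpace N ≃ₗ[ℂ] CSpace N) where
  toFun w :=
    { toFun := fun x => cx (w (reV x)) + Complex.I • cx (w (imV x))
      invFun := fun x => cx (w.symm (reV x)) + Complex.I • cx (w.symm (imV x))
      map_add' := by
        intro x y
        have h1 : reV (x + y) = reV x + reV y := by ext i; simp [reV]
        have h2 : imV (x + y) = imV x + imV y := by ext i; simp [imV]
        rw [h1, h2, map_add, map_add, cx_add, cx_add, smul_add]
        abel
      map_smul' := by
        intro z x
        have h1 : reV (z • x) = z.re • reV x - z.im • imV x := by ext i; simp [reV, imV]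
        have h2 : imV (z • x) = z.re • imV x + z.im • reV x := by ext i; simp [reV, imV]
        rw [h1, h2, map_add, map_sub, map_smul, map_smul, map_smul, map_smul, cx_add, cx_sub,
          cx_smul, cx_smul, cx_smul, cx_smul, RingHom.id_apply]
        conv_rhs => rw [← Complex.re_add_im z]
        funext i
        simp only [Pi.add_apply, Pi.sub_apply, Pi.smul_apply, smul_eq_mul]
        ring_nf
        rw [Complex.I_sq]
        ring
      left_inv := fun x => by
        simp only [reV_cx_add, imV_cx_add, LinearIsometryEquiv.symm_apply_apply, cx_reV_add]
      right_inv := fun x => by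
        simp only [reV_cx_add, imV_cx_add, LinearIsometryEquiv.apply_symm_apply, cx_reV_add] }
  map_one' := by
    ext1 x
    exact cx_reV_add x
  map_mul' u v := by
    ext1 x
    change cx (u (v (reV x))) + Complex.I • cx (u (v (imV x))) =
      cx (u (reV (cx (v (reV x)) + Complex.I • cx (v (imV x))))) +
      Complex.I • cx (u (imV (cx (v (reV x)) + Complex.I • cx (v (imV x)))))
    rw [reV_cx_add, imV_cx_add]

theorem complexify_apply (w : RSpace N ≃ₗᵢ[ℝ] RSpace N) (x : CSpace N) :
    complexify w x = cx (w (reV x)) + Complex.I • cx (w (imV x)) := rfl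

theorem complexify_cx (w : RSpace N ≃ₗᵢ[ℝ] RSpace N) (a : RSpace N) :
    complexify w (cx a) = cx (w a) := by
  have h1 : reV (cx a) = a := by ext i; simp [reV, cx]
  have h2 : imV (cx a) = 0 := by ext i; simp [imV, cx]
  have h3 : cx (0 : RSpace N) = 0 := by funext i; simp [cx]
  rw [complexify_apply, h1, h2, map_zero, h3, smul_zero, add_zero]

theorem refl_cx (α a : RSpace N) : refl α (cx a) = cx (rrefl α a) := by
  rw [refl_apply, rrefl_apply, cx_sub, cx_smul, cx_dot_cx, cx_dot_cx]
  push_cast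
  rfl

theorem complexify_rrefl (α : RSpace N) : complexify (rrefl α) = refl α := by
  ext1 x
  conv_rhs => rw [← cx_reV_add x]
  rw [complexify_apply, map_add, map_smul, refl_cx, refl_cx]

theorem reflGroup_eq_map (S : Finset (RSpace N)) : reflGroup S = (rGroup S).map complexify := by
  rw [reflGroup, rGroup, MonoidHom.map_closure, ← Set.image_comp]
  congr 1
  exact Set.image_congr fun α _ => (complexify_rrefl α).symm

theorem IsRootSystem.finite_reflGroup (hR : IsRootSystem R) :
    (reflGroup R : Set (CSpace N ≃ₗ[ℂ] CSpace N)).Finite := by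
  rw [reflGroup_eq_map, Subgroup.coe_map]
  have := hR.finite_rGroup
  exact Set.Finite.image _ (Set.toFinite _)

theorem refl_mem_reflGroup {α : RSpace N} (h : α ∈ R) : refl α ∈ reflGroup R :=
  Subgroup.subset_closure ⟨α, h, rfl⟩

theorem reflGroup_dot_dot {w : CSpace N ≃ₗ[ℂ] CSpace N} (hw : w ∈ reflGroup R) (x y : CSpace N) :
    w x ⬝ᵥ w y = x ⬝ᵥ y := by
  have h := reflGroup_dot hw (x + y)
  rw [map_add, add_dotProduct, dotProduct_add, dotProduct_add, add_dotProduct, dotProduct_add,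
    dotProduct_add, reflGroup_dot hw, reflGroup_dot hw, dotProduct_comm (w y),
    dotProduct_comm y x] at h
  linear_combination h / 2

theorem dot_apply_eq {w : CSpace N ≃ₗ[ℂ] CSpace N} (hw : w ∈ reflGroup R) (x y : CSpace N) :
    x ⬝ᵥ w y = w⁻¹ x ⬝ᵥ y := by
  rw [← reflGroup_dot_dot hw (w⁻¹ x) y]
  congr 1
  exact (w.apply_symm_apply x).symm

theorem refl_refl (α : RSpace N) (x : CSpace N) : refl α (refl α x) = x :=
  (refl α).symm_apply_apply x

theorem refl_inv (α : RSpace N) : (refl α)⁻¹ = refl α := rfl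

theorem refl_eq_self {α : RSpace N} {x : CSpace N} (h : cx α ⬝ᵥ x = 0) : refl α x = x := by
  rw [refl_apply, h, mul_zero, zero_div, zero_smul, sub_zero]

/-- The group permutes the roots. -/
theorem IsRootSystem.exists_perm (hR : IsRootSystem R) {w : CSpace N ≃ₗ[ℂ] CSpace N}
    (hw : w ∈ reflGroup R) :
    ∃ σ : Equiv.Perm R, ∀ α : R, cx (σ α : RSpace N) = w (cx α) := by
  rw [reflGroup_eq_map] at hw
  obtain ⟨u, hu, rfl⟩ := hw
  refine ⟨⟨fun α => ⟨u α, hR.map_mem hu α α.2⟩, fun α => ⟨u⁻¹ α, hR.map_mem (inv_mem hu) α α.2⟩,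
    fun α => Subtype.ext (u.symm_apply_apply _), fun α => Subtype.ext (u.apply_symm_apply _)⟩,
    fun α => ?_⟩
  exact (complexify_cx u α).symm

/-! ### Sums over positive roots -/

theorem IsSimpleSystem.two_smul_sum_posRoots (hR : IsRootSystem R) (hS : IsSimpleSystem R S)
    {M : Type*} [AddCommGroup M] (h : R → M)
    (heven : ∀ α β : R, (β : RSpace N) = -α → h β = h α) :
    2 • ∑ α ∈ posRoots R S, h α = ∑ α, h α := by
  classical
  let neg : R → R := fun α => ⟨-α, hR.neg_mem α.2⟩
  rw [← Finset.sum_filter_add_sum_filter_not Finset.univ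
    (fun α : R => IsNonnegComb S (α : RSpace N)), two_smul]
  have h1 : posRoots R S = Finset.univ.filter fun α : R => IsNonnegComb S (α : RSpace N) := by
    unfold posRoots
    congr
  rw [h1]
  congr 1
  refine Finset.sum_bij' (fun α _ => neg α) (fun α _ => neg α) ?_ ?_ ?_ ?_ ?_
  · intro α hα
    simp only [Finset.mem_filter, Finset.mem_univ, true_and] at hα ⊢
    exact fun hc => hS.not_both (hR.ne_zero α.2) hα hc
  · intro α hα
    simp only [Finset.mem_filter, Finset.mem_univ, true_and] at hα ⊢
    exact (hS.pos_or_neg α α.2).resolve_left hα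
  · intro α _; exact Subtype.ext (neg_neg _)
  · intro α _; exact Subtype.ext (neg_neg _)
  · intro α _; exact (heven α (neg α) rfl).symm

/-- The sum of an even function over the positive roots is invariant under the group. -/
theorem IsSimpleSystem.sum_posRoots_perm (hR : IsRootSystem R) (hS : IsSimpleSystem R S)
    {M : Type*} [AddCommGroup M] [Module ℂ M] (h : R → M)
    (heven : ∀ α β : R, (β : RSpace N) = -α → h β = h α)
    {w : CSpace N ≃ₗ[ℂ] CSpace N} {σ : Equiv.Perm R}
    (hσ : ∀ α : R, cx (σ α : RSpace N) = w (cx α)) :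
    ∑ α ∈ posRoots R S, h (σ α) = ∑ α ∈ posRoots R S, h α := by
  have h1 := hS.two_smul_sum_posRoots hR (fun α => h (σ α)) (fun α β e => heven _ _ (by
    apply cx_injective
    rw [hσ, e, cx_neg, map_neg, cx_neg, hσ]))
  have h2 := hS.two_smul_sum_posRoots hR h heven
  rw [Equiv.sum_comp σ h, ← h2] at h1
  have h3 : ∀ a b : M, 2 • a = 2 • b → a = b := by
    intro a b e
    rw [← Nat.cast_smul_eq_nsmul ℂ, ← Nat.cast_smul_eq_nsmul ℂ] at e
    exact smul_right_injective M (by norm_num : ((2 : ℕ) : ℂ) ≠ 0) e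
  exact h3 _ _ h1

theorem IsInvariantMult.perm {c : R → ℂ} (hc : IsInvariantMult c)
    {w : CSpace N ≃ₗ[ℂ] CSpace N} (hw : w ∈ reflGroup R) {σ : Equiv.Perm R}
    (hσ : ∀ α : R, cx (σ α : RSpace N) = w (cx α)) (α : R) : c (σ α) = c α :=
  hc w hw α (σ α) (hσ α).symm

theorem IsInvariantMult.neg {c : R → ℂ} (hc : IsInvariantMult c) (α β : R)
    (h : (β : RSpace N) = -α) : c β = c α := by
  refine hc (refl α) (refl_mem_reflGroup α.2) α β ?_
  rw [refl_cx, rrefl_self, h]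

/-! ### Parabolic strata -/

theorem mem_plane {x : CSpace N} : x ∈ plane Γ₀ ↔ ∀ β ∈ Γ₀, cx β ⬝ᵥ x = 0 := Iff.rfl

theorem isClosed_plane : IsClosed (plane Γ₀ : Set (CSpace N)) :=
  (plane Γ₀).closed_of_finiteDimensional

theorem mem_stratum {x : CSpace N} :
    x ∈ stratum R Γ₀ ↔ ∃ w ∈ reflGroup R, w x ∈ plane Γ₀ := by
  simp only [stratum, Set.mem_iUnion, Set.mem_image, SetLike.mem_coe, exists_prop]
  constructor
  · rintro ⟨w, hw, z, hz, rfl⟩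
    refine ⟨w⁻¹, inv_mem hw, ?_⟩
    have : (w⁻¹ : CSpace N ≃ₗ[ℂ] CSpace N) (w z) = z := w.symm_apply_apply z
    rwa [this]
  · rintro ⟨w, hw, h⟩
    exact ⟨w⁻¹, inv_mem hw, w x, h, w.symm_apply_apply x⟩

theorem plane_subset_stratum {x : CSpace N} (h : x ∈ plane Γ₀) : x ∈ stratum R Γ₀ :=
  mem_stratum.2 ⟨1, one_mem _, h⟩

theorem map_mem_stratum {x : CSpace N} {w : CSpace N ≃ₗ[ℂ] CSpace N} (hw : w ∈ reflGroup R)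
    (h : x ∈ stratum R Γ₀) : w x ∈ stratum R Γ₀ := by
  obtain ⟨u, hu, hx⟩ := mem_stratum.1 h
  refine mem_stratum.2 ⟨u * w⁻¹, mul_mem hu (inv_mem hw), ?_⟩
  change u (w.symm (w x)) ∈ _
  rwa [w.symm_apply_apply]

/-- A group element that moves a generic point of `π` into `π` maps `π` onto itself. -/
theorem IsGeneric.map_plane (hR : IsRootSystem R) (hΓ : Γ₀ ⊆ R) {x : CSpace N}
    (hx : IsGeneric R Γ₀ x) {w : CSpace N ≃ₗ[ℂ] CSpace N} (hw : w ∈ reflGroup R)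
    (hwx : w x ∈ plane Γ₀) : (plane Γ₀).map (w : CSpace N →ₗ[ℂ] CSpace N) = plane Γ₀ := by
  apply Submodule.eq_of_le_of_finrank_eq
  · rintro _ ⟨z, hz, rfl⟩
    intro β hβ
    obtain ⟨σ, hσ⟩ := hR.exists_perm (inv_mem hw)
    change cx β ⬝ᵥ w z = 0
    have h1 := hwx β hβ
    rw [dot_apply_eq hw] at h1 ⊢
    have h2 := hσ ⟨β, hΓ hβ⟩
    simp only at h2
    rw [← h2] at h1 ⊢
    exact hx.2 _ (σ _).2 h1 z hz
  · exact LinearEquiv.finrank_map_eq w (plane Γ₀)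

theorem IsGeneric.map_mem (hR : IsRootSystem R) (hΓ : Γ₀ ⊆ R) {x : CSpace N}
    (hx : IsGeneric R Γ₀ x) {w : CSpace N ≃ₗ[ℂ] CSpace N} (hw : w ∈ reflGroup R)
    (hwx : w x ∈ plane Γ₀) (z : CSpace N) : w z ∈ plane Γ₀ ↔ z ∈ plane Γ₀ := by
  constructor
  · intro h
    rw [← hx.map_plane hR hΓ hw hwx] at h
    obtain ⟨z', hz', e⟩ := h
    rwa [← w.injective e]
  · intro h
    rw [← hx.map_plane hR hΓ hw hwx]
    exact ⟨z, h, rfl⟩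

theorem IsGeneric.map (hR : IsRootSystem R) (hΓ : Γ₀ ⊆ R) {x : CSpace N}
    (hx : IsGeneric R Γ₀ x) {w : CSpace N ≃ₗ[ℂ] CSpace N} (hw : w ∈ reflGroup R)
    (hwx : w x ∈ plane Γ₀) : IsGeneric R Γ₀ (w x) := by
  refine ⟨hwx, fun α hα h y hy => ?_⟩
  obtain ⟨σ, hσ⟩ := hR.exists_perm (inv_mem hw)
  obtain ⟨z, rfl⟩ := w.surjective y
  rw [hx.map_mem hR hΓ hw hwx] at hy
  rw [dot_apply_eq hw] at h ⊢
  have h2 := hσ ⟨α, hα⟩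
  simp only at h2
  rw [← h2] at h ⊢
  exact hx.2 _ (σ _).2 h z hy

/-- All points of the orbit of `x` that lie in `π` are generic. -/
def OrbitGeneric (R Γ₀ : Finset (RSpace N)) (x : CSpace N) : Prop :=
  ∀ w ∈ reflGroup R, w x ∈ plane Γ₀ → IsGeneric R Γ₀ (w x)

theorem continuous_dot (a : CSpace N) : Continuous fun x : CSpace N => a ⬝ᵥ x := by
  unfold dotProduct; fun_prop

theorem continuous_equiv (w : CSpace N ≃ₗ[ℂ] CSpace N) : Continuous w :=
  w.toContinuousLinearEquiv.continuous

theorem OrbitGeneric.eventually (hR : IsRootSystem R) {x : CSpace N}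
    (hx : OrbitGeneric R Γ₀ x) : ∀ᶠ y in 𝓝 x, OrbitGeneric R Γ₀ y := by
  unfold OrbitGeneric
  have := (Filter.eventually_all_finite hR.finite_reflGroup (l := 𝓝 x)
    (p := fun w y => w y ∈ plane Γ₀ → IsGeneric R Γ₀ (w y))).2
  refine this fun w hw => ?_
  by_cases hwx : w x ∈ plane Γ₀
  · have h1 : ∀ᶠ y in 𝓝 x, ∀ α ∈ R, cx α ⬝ᵥ w x ≠ 0 → cx α ⬝ᵥ w y ≠ 0 := by
      rw [Filter.eventually_all_finset]
      intro α _
      by_cases h0 : cx α ⬝ᵥ w x = 0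
      · simp [h0]
      · have hc : Continuous fun y => cx α ⬝ᵥ w y :=
          (continuous_dot _).comp (continuous_equiv w)
        filter_upwards [hc.continuousAt.eventually_ne h0] with y hy _ using hy
    filter_upwards [h1] with y hy hyp
    exact ⟨hyp, fun α hα h0 => (hx w hw hwx).2 α hα (by_contra fun hc => hy α hα hc h0)⟩
  · have ho : IsOpen {y : CSpace N | w y ∉ plane Γ₀} :=
      isClosed_plane.isOpen_compl.preimage (continuous_equiv w)
    filter_upwards [ho.mem_nhds hwx] with y hy h
    exact absurd h hy

theorem IsGeneric.orbitGeneric (hR : IsRootSystem R) (hΓ : Γ₀ ⊆ R) {x : CSpace N}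
    (hx : IsGeneric R Γ₀ x) : OrbitGeneric R Γ₀ x :=
  fun _ hw hwx => hx.map hR hΓ hw hwx

theorem OrbitGeneric.map {x : CSpace N} (hx : OrbitGeneric R Γ₀ x)
    {w : CSpace N ≃ₗ[ℂ] CSpace N} (hw : w ∈ reflGroup R) : OrbitGeneric R Γ₀ (w x) :=
  fun u hu h => hx (u * w) (mul_mem hu hw) h

/-- Near a generic point the stratum is the plane `π`. -/
theorem IsGeneric.eventually_mem_plane (hR : IsRootSystem R) (hΓ : Γ₀ ⊆ R) {x : CSpace N}
    (hx : IsGeneric R Γ₀ x) : ∀ᶠ y in 𝓝 x, y ∈ stratum R Γ₀ → y ∈ plane Γ₀ := by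
  have h1 : ∀ᶠ y in 𝓝 x, ∀ w ∈ (reflGroup R : Set (CSpace N ≃ₗ[ℂ] CSpace N)),
      w y ∈ plane Γ₀ → y ∈ plane Γ₀ := by
    refine (Filter.eventually_all_finite hR.finite_reflGroup (l := 𝓝 x)
      (p := fun w y => w y ∈ plane Γ₀ → y ∈ plane Γ₀)).2 fun w hw => ?_
    by_cases hwx : w x ∈ plane Γ₀
    · exact Eventually.of_forall fun y => (hx.map_mem hR hΓ hw hwx y).1
    · have ho : IsOpen {y : CSpace N | w y ∉ plane Γ₀} :=
        isClosed_plane.isOpen_compl.preimage (continuous_equiv w)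
      filter_upwards [ho.mem_nhds hwx] with y hy h
      exact absurd h hy
  filter_upwards [h1] with y hy hyD
  obtain ⟨w, hw, h⟩ := mem_stratum.1 hyD
  exact hy w hw h

/-! ### Roots orthogonal to `π` -/

theorem cx_mem_plane {a : RSpace N} :
    cx a ∈ plane Γ₀ ↔ a ∈ (Submodule.span ℝ (Γ₀ : Set (RSpace N)))ᗮ := by
  rw [mem_plane]
  have h : ∀ β : RSpace N, cx β ⬝ᵥ cx a = 0 ↔ ⟪β, a⟫_ℝ = 0 := fun β => by
    rw [cx_dot_cx]; exact_mod_cast Iff.rfl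
  simp only [h]
  constructor
  · intro hh
    rw [Submodule.mem_orthogonal]
    intro u hu
    induction hu using Submodule.span_induction with
    | mem z hz => exact hh z hz
    | zero => simp
    | add a b _ _ ha hb => rw [inner_add_left, ha, hb, add_zero]
    | smul t a _ ha => rw [real_inner_smul_left, ha, mul_zero]
  · intro hh β hβ
    exact (Submodule.mem_orthogonal _ _).1 hh β (Submodule.subset_span hβ)

theorem cx_proj_mem_plane (α : RSpace N) : cx (proj Γ₀ α) ∈ plane Γ₀ :=
  cx_mem_plane.2 (Submodule.starProjection_apply_mem _ _)

theorem dot_of_mem_span {a : RSpace N} (ha : a ∈ Submodule.span ℝ (Γ₀ : Set (RSpace N)))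
    {y : CSpace N} (hy : y ∈ plane Γ₀) : cx a ⬝ᵥ y = 0 := by
  induction ha using Submodule.span_induction with
  | mem z hz => exact hy z hz
  | zero => simp [cx, dotProduct]
  | add a b _ _ ha hb => rw [cx_add, add_dotProduct, ha, hb, add_zero]
  | smul t a _ ha => rw [cx_smul, smul_dotProduct, ha, smul_zero]

theorem proj_dot (α : RSpace N) {y : CSpace N} (hy : y ∈ plane Γ₀) :
    cx (proj Γ₀ α) ⬝ᵥ y = cx α ⬝ᵥ y := by
  have h : α - proj Γ₀ α ∈ Submodule.span ℝ (Γ₀ : Set (RSpace N)) := by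
    have := Submodule.sub_starProjection_mem_orthogonal
      (K := (Submodule.span ℝ (Γ₀ : Set (RSpace N)))ᗮ) α
    rwa [Submodule.orthogonal_orthogonal] at this
  have := dot_of_mem_span h hy
  rw [cx_sub, sub_dotProduct] at this
  linear_combination -this

theorem proj_eq_zero_iff {α : RSpace N} :
    proj Γ₀ α = 0 ↔ ∀ y ∈ plane Γ₀, cx α ⬝ᵥ y = 0 := by
  constructor
  · intro h y hy
    rw [← proj_dot α hy, h]
    simp [cx, dotProduct]
  · intro h
    have h1 := h _ (cx_proj_mem_plane α)
    rw [← proj_dot α (cx_proj_mem_plane α)] at h1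
    by_contra h0
    exact cx_dot_self_ne_zero h0 h1

theorem IsGeneric.proj_eq_zero_iff {x : CSpace N} (hx : IsGeneric R Γ₀ x) {α : RSpace N}
    (hα : α ∈ R) : proj Γ₀ α = 0 ↔ cx α ⬝ᵥ x = 0 :=
  ⟨fun h => SpinCM.proj_eq_zero_iff.1 h x hx.1, fun h => SpinCM.proj_eq_zero_iff.2 (hx.2 α hα h)⟩

theorem mem_span_of_proj_eq_zero {α : RSpace N} (h : proj Γ₀ α = 0) :
    α ∈ Submodule.span ℝ (Γ₀ : Set (RSpace N)) := by
  have := Submodule.sub_starProjection_mem_orthogonal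
    (K := (Submodule.span ℝ (Γ₀ : Set (RSpace N)))ᗮ) α
  rw [Submodule.orthogonal_orthogonal] at this
  change α - proj Γ₀ α ∈ _ at this
  rwa [h, sub_zero] at this

/-- The stabiliser of a generic point of `π` is the parabolic subgroup `W₀`. -/
theorem IsGeneric.stabilizer (hR : IsRootSystem R) (hS : IsSimpleSystem R S) (hΓ : Γ₀ ⊆ S)
    {x : CSpace N} (hx : IsGeneric R Γ₀ x) {w : CSpace N ≃ₗ[ℂ] CSpace N}
    (hw : w ∈ reflGroup R) (hwx : w x = x) : w ∈ reflGroup Γ₀ := by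
  rw [reflGroup_eq_map] at hw ⊢
  obtain ⟨u, hu, rfl⟩ := hw
  have hre : u (reV x) = reV x := by
    conv_rhs => rw [← hwx]
    rw [complexify_apply, reV_cx_add]
  have him : u (imV x) = imV x := by
    conv_rhs => rw [← hwx]
    rw [complexify_apply, imV_cx_add]
  have hdot : ∀ α : RSpace N, cx α ⬝ᵥ x = (⟪α, reV x⟫_ℝ : ℂ) + Complex.I * (⟪α, imV x⟫_ℝ : ℂ) := by
    intro α
    conv_lhs => rw [← cx_reV_add x]
    rw [dotProduct_add, dotProduct_smul, cx_dot_cx, cx_dot_cx, smul_eq_mul]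
  -- For all but finitely many `t`, the roots orthogonal to `reV x + t • imV x` are those
  -- orthogonal to `x`.
  obtain ⟨t, ht⟩ := Infinite.exists_notMem_finset
    (R.image fun α => -⟪α, reV x⟫_ℝ / ⟪α, imV x⟫_ℝ)
  have hzero : ∀ α : RSpace N, cx α ⬝ᵥ x = 0 ↔ ⟪α, reV x⟫_ℝ = 0 ∧ ⟪α, imV x⟫_ℝ = 0 := by
    intro α
    rw [hdot, Complex.ext_iff]
    simp
  refine ⟨u, ?_, rfl⟩
  refine hS.stabilizer hR hΓ (a := reV x + t • imV x) (fun γ hγ => ?_) (fun α hα h => ?_) hu ?_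
  · have := (hzero γ).1 (hx.1 γ hγ)
    rw [inner_add_right, real_inner_smul_right, this.1, this.2, mul_zero, add_zero]
  · rw [inner_add_right, real_inner_smul_right] at h
    have h2 : ⟪α, imV x⟫_ℝ = 0 := by
      by_contra hne
      apply ht
      rw [Finset.mem_image]
      refine ⟨α, hα, ?_⟩
      rw [div_eq_iff hne]
      linarith
    rw [h2, mul_zero, add_zero] at h
    exact mem_span_of_proj_eq_zero ((hx.proj_eq_zero_iff hα).2 ((hzero α).2 ⟨h, h2⟩))
  · rw [map_add, map_smul, hre, him]

/-- A neighbourhood property of an orbit holds on an invariant open set. -/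
theorem IsRootSystem.exists_invariant_open (hR : IsRootSystem R) {x : CSpace N}
    {P : CSpace N → Prop} (h : ∀ w ∈ reflGroup R, ∀ᶠ y in 𝓝 (w x), P y) :
    ∃ O : Set (CSpace N), IsOpen O ∧ x ∈ O ∧ (∀ w ∈ reflGroup R, ∀ y ∈ O, w y ∈ O) ∧
      ∀ y ∈ O, P y := by
  refine ⟨⋂ w ∈ (reflGroup R : Set (CSpace N ≃ₗ[ℂ] CSpace N)),
    (fun y => w y) ⁻¹' {y | ∀ᶠ z in 𝓝 y, P z}, ?_, ?_, ?_, ?_⟩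
  · exact hR.finite_reflGroup.isOpen_biInter fun w _ =>
      isOpen_setOfPred_eventually_nhds.preimage (continuous_equiv w)
  · simpa using h
  · intro u hu y hy
    simp only [Set.mem_iInter, Set.mem_preimage, Set.mem_ofPred_eq] at hy ⊢
    exact fun w hw => hy (w * u) (mul_mem hw hu)
  · intro y hy
    simp only [Set.mem_iInter, Set.mem_preimage, Set.mem_ofPred_eq] at hy
    exact (hy 1 (one_mem _)).self_of_nhds

end Reflections

section AnalyticGerms

variable {N : ℕ} {U : Type*} [AddCommGroup U] [Module ℂ U]

/-! ### Analytic functions with values in a vector space -/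

theorem mem_analyticGerms_iff {l : Filter (CSpace N)} {x : CSpace N} {g : Germ l U} :
    g ∈ analyticGerms U l x ↔ ∃ (n : ℕ) (f : Fin n → CSpace N → ℂ) (u : Fin n → U),
      (∀ j, AnalyticAt ℂ (f j) x) ∧ g = ((fun y => ∑ j, f j y • u j : CSpace N → U) : Germ l U) := by
  have hcoe : ∀ (n : ℕ) (G : Fin n → CSpace N → U),
      ∑ j, ((G j : CSpace N → U) : Germ l U) = ((fun y => ∑ j, G j y : CSpace N → U) : Germ l U) := by
    intro n G
    have h := map_sum (Germ.coeAddHom l : (CSpace N → U) →+ Germ l U) G Finset.univ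
    have h2 : (fun y => ∑ j, G j y) = ∑ j, G j := by funext y; simp
    rw [h2]
    exact h.symm
  constructor
  · intro h
    rw [analyticGerms, Submodule.mem_span_set'] at h
    obtain ⟨n, a, G, rfl⟩ := h
    choose f u hf hg using fun i => (G i).2
    refine ⟨n, fun j y => a j * f j y, u, fun j => analyticAt_const.mul (hf j), ?_⟩
    rw [← hcoe n fun j y => (a j * f j y) • u j]
    refine Finset.sum_congr rfl fun j _ => ?_
    rw [hg j, ← Germ.coe_smul]
    congr 1
    funext y
    simp [mul_smul]
  · rintro ⟨n, f, u, hf, rfl⟩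
    rw [← hcoe n fun j y => f j y • u j]
    exact sum_mem fun j _ => Submodule.subset_span ⟨f j, u j, hf j, rfl⟩

/-- `F` is analytic at `x`: it is near `x` a finite sum `∑ f_j u_j` with `f_j` analytic at `x`. -/
def AnAt (F : CSpace N → U) (x : CSpace N) : Prop :=
  (F : Germ (𝓝 x) U) ∈ analyticGerms U (𝓝 x) x

theorem anAt_iff {F : CSpace N → U} {x : CSpace N} :
    AnAt F x ↔ ∃ (n : ℕ) (f : Fin n → CSpace N → ℂ) (u : Fin n → U),
      (∀ j, AnalyticAt ℂ (f j) x) ∧ F =ᶠ[𝓝 x] fun y => ∑ j, f j y • u j := by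
  rw [AnAt, mem_analyticGerms_iff]
  simp only [Germ.coe_eq]

theorem AnAt.congr {F G : CSpace N → U} {x : CSpace N} (h : AnAt F x) (e : F =ᶠ[𝓝 x] G) :
    AnAt G x := by
  unfold AnAt at *
  rwa [← Germ.coe_eq.2 e]

theorem AnAt.add {F G : CSpace N → U} {x : CSpace N} (h : AnAt F x) (h' : AnAt G x) :
    AnAt (fun y => F y + G y) x := add_mem h h'

theorem AnAt.sub {F G : CSpace N → U} {x : CSpace N} (h : AnAt F x) (h' : AnAt G x) :
    AnAt (fun y => F y - G y) x := sub_mem h h'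

theorem AnAt.const_smul {F : CSpace N → U} {x : CSpace N} (h : AnAt F x) (t : ℂ) :
    AnAt (fun y => t • F y) x := Submodule.smul_mem _ t h

theorem anAt_zero {x : CSpace N} : AnAt (fun _ => (0 : U)) x :=
  zero_mem (analyticGerms U (𝓝 x) x)

theorem anAt_smul_const {f : CSpace N → ℂ} {x : CSpace N} (hf : AnalyticAt ℂ f x) (u : U) :
    AnAt (fun y => f y • u) x := Submodule.subset_span ⟨f, u, hf, rfl⟩

theorem anAt_const {x : CSpace N} (u : U) : AnAt (fun _ => u) x := by
  simpa using anAt_smul_const (f := fun _ => (1 : ℂ)) (x := x) analyticAt_const u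

theorem AnAt.smul {F : CSpace N → U} {x : CSpace N} (h : AnAt F x) {g : CSpace N → ℂ}
    (hg : AnalyticAt ℂ g x) : AnAt (fun y => g y • F y) x := by
  obtain ⟨n, f, u, hf, e⟩ := anAt_iff.1 h
  refine anAt_iff.2 ⟨n, fun j y => g y * f j y, u, fun j => hg.mul (hf j), ?_⟩
  filter_upwards [e] with y hy
  simp [hy, Finset.smul_sum, mul_smul]

theorem AnAt.comp_equiv {F : CSpace N → U} {x : CSpace N} (w : CSpace N ≃ₗ[ℂ] CSpace N)
    (h : AnAt F (w x)) : AnAt (fun y => F (w y)) x := by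
  obtain ⟨n, f, u, hf, e⟩ := anAt_iff.1 h
  refine anAt_iff.2 ⟨n, fun j y => f j (w y), u, fun j => ?_, ?_⟩
  · exact AnalyticAt.comp (hf j)
      ((w.toContinuousLinearEquiv : CSpace N →L[ℂ] CSpace N).analyticAt x)
  · exact (continuous_equiv w).continuousAt.eventually e

theorem AnAt.postcomp {U' : Type*} [AddCommGroup U'] [Module ℂ U'] {F : CSpace N → U}
    {x : CSpace N} (h : AnAt F x) (L : U →ₗ[ℂ] U') : AnAt (fun y => L (F y)) x := by
  obtain ⟨n, f, u, hf, e⟩ := anAt_iff.1 h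
  refine anAt_iff.2 ⟨n, f, fun j => L (u j), hf, ?_⟩
  filter_upwards [e] with y hy
  simp [hy]

theorem AnAt.eventually {F : CSpace N → U} {x : CSpace N} (h : AnAt F x) :
    ∀ᶠ y in 𝓝 x, AnAt F y := by
  obtain ⟨n, f, u, hf, e⟩ := anAt_iff.1 h
  have h1 : ∀ᶠ y in 𝓝 x, ∀ j, AnalyticAt ℂ (f j) y :=
    Filter.eventually_all.2 fun j => (hf j).eventually_analyticAt
  filter_upwards [h1, eventually_eventually_nhds.2 e] with y h2 h3
  exact anAt_iff.2 ⟨n, f, u, h2, h3⟩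

/-! ### Directional derivatives -/

theorem dirDeriv_eq_of_iff {ξ η : CSpace N} {F G : CSpace N → U} {x y : CSpace N}
    (h : ∀ d, HasDirDeriv ξ F x d ↔ HasDirDeriv η G y d) : dirDeriv ξ F x = dirDeriv η G y := by
  by_cases hex : ∃ d, HasDirDeriv ξ F x d
  · obtain ⟨d, hd⟩ := hex
    rw [hd.dirDeriv_eq, ((h d).1 hd).dirDeriv_eq]
  · have hex' : ¬ ∃ d, HasDirDeriv η G y d := fun ⟨d, hd⟩ => hex ⟨d, (h d).2 hd⟩
    rw [dirDeriv, dirDeriv, dif_neg hex, dif_neg hex']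

theorem dirDeriv_congr_line {ξ : CSpace N} {F G : CSpace N → U} {x : CSpace N}
    (h : ∀ᶠ t : ℂ in 𝓝 0, F (x + t • ξ) = G (x + t • ξ)) : dirDeriv ξ F x = dirDeriv ξ G x := by
  refine dirDeriv_eq_of_iff fun d => forall_congr' fun φ => Filter.EventuallyEq.hasDerivAt_iff ?_
  filter_upwards [h] with t ht
  rw [ht]

theorem tendsto_line (ξ x : CSpace N) : Tendsto (fun t : ℂ => x + t • ξ) (𝓝 0) (𝓝 x) := by
  have : Continuous fun t : ℂ => x + t • ξ := by fun_prop
  simpa using this.tendsto 0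

theorem dirDeriv_congr {ξ : CSpace N} {F G : CSpace N → U} {x : CSpace N}
    (h : F =ᶠ[𝓝 x] G) : dirDeriv ξ F x = dirDeriv ξ G x :=
  dirDeriv_congr_line ((tendsto_line ξ x).eventually h)

theorem dirDeriv_comp_equiv (w : CSpace N ≃ₗ[ℂ] CSpace N) (ξ : CSpace N) (F : CSpace N → U)
    (x : CSpace N) : dirDeriv ξ (fun y => F (w y)) x = dirDeriv (w ξ) F (w x) := by
  refine dirDeriv_eq_of_iff fun d => ?_
  simp only [HasDirDeriv, map_add, map_smul]

theorem dirDeriv_eventually {F : CSpace N → U} {x : CSpace N} {n : ℕ} {f : Fin n → CSpace N → ℂ}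
    {u : Fin n → U} (hf : ∀ j, AnalyticAt ℂ (f j) x) (e : F =ᶠ[𝓝 x] fun y => ∑ j, f j y • u j)
    (ξ : CSpace N) :
    ∀ᶠ y in 𝓝 x, dirDeriv ξ F y = ∑ j, fderiv ℂ (f j) y ξ • u j := by
  have h1 : ∀ᶠ y in 𝓝 x, ∀ j, AnalyticAt ℂ (f j) y :=
    Filter.eventually_all.2 fun j => (hf j).eventually_analyticAt
  filter_upwards [h1, eventually_eventually_nhds.2 e] with y h2 h3
  rw [dirDeriv_congr h3]
  exact dirDeriv_sum Finset.univ f u (fun j _ => (h2 j).differentiableAt) ξ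

theorem AnAt.hasDirDeriv {F : CSpace N → U} {x : CSpace N} (h : AnAt F x) (ξ : CSpace N) :
    HasDirDeriv ξ F x (dirDeriv ξ F x) := by
  obtain ⟨n, f, u, hf, e⟩ := anAt_iff.1 h
  rw [(dirDeriv_eventually hf e ξ).self_of_nhds]
  intro φ
  have h1 : HasDerivAt (fun t : ℂ => φ (∑ j, f j (x + t • ξ) • u j))
      (φ (∑ j, fderiv ℂ (f j) x ξ • u j)) 0 := by
    simp only [map_sum, map_smul, smul_eq_mul]
    refine HasDerivAt.fun_sum fun j hj => HasDerivAt.mul_const ?_ _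
    exact (hf j).differentiableAt.hasFDerivAt.hasLineDerivAt ξ
  refine h1.congr_of_eventuallyEq ?_
  filter_upwards [(tendsto_line ξ x).eventually e] with t ht
  rw [ht]

theorem AnAt.dirDeriv {F : CSpace N → U} {x : CSpace N} (h : AnAt F x) (ξ : CSpace N) :
    AnAt (dirDeriv ξ F) x := by
  obtain ⟨n, f, u, hf, e⟩ := anAt_iff.1 h
  refine anAt_iff.2 ⟨n, fun j y => fderiv ℂ (f j) y ξ, u, fun j => ?_, dirDeriv_eventually hf e ξ⟩
  exact (ContinuousLinearMap.apply ℂ ℂ ξ).analyticAt _ |>.comp (hf j).fderiv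

theorem AnAt.dirDeriv_add_vec {F : CSpace N → U} {x : CSpace N} (h : AnAt F x)
    (ξ η : CSpace N) :
    SpinCM.dirDeriv (ξ + η) F x = SpinCM.dirDeriv ξ F x + SpinCM.dirDeriv η F x := by
  obtain ⟨n, f, u, hf, e⟩ := anAt_iff.1 h
  rw [(dirDeriv_eventually hf e _).self_of_nhds, (dirDeriv_eventually hf e _).self_of_nhds,
    (dirDeriv_eventually hf e _).self_of_nhds]
  simp [add_smul, Finset.sum_add_distrib]

theorem AnAt.dirDeriv_smul_vec {F : CSpace N → U} {x : CSpace N} (h : AnAt F x) (t : ℂ)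
    (ξ : CSpace N) : SpinCM.dirDeriv (t • ξ) F x = t • SpinCM.dirDeriv ξ F x := by
  obtain ⟨n, f, u, hf, e⟩ := anAt_iff.1 h
  rw [(dirDeriv_eventually hf e _).self_of_nhds, (dirDeriv_eventually hf e _).self_of_nhds]
  simp [mul_smul, Finset.smul_sum]

theorem HasDirDeriv.add {F G : CSpace N → U} {x ξ : CSpace N} {d e : U}
    (hF : HasDirDeriv ξ F x d) (hG : HasDirDeriv ξ G x e) :
    HasDirDeriv ξ (fun y => F y + G y) x (d + e) := by
  intro φ
  simp only [map_add]
  exact (hF φ).add (hG φ)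

theorem HasDirDeriv.sub {F G : CSpace N → U} {x ξ : CSpace N} {d e : U}
    (hF : HasDirDeriv ξ F x d) (hG : HasDirDeriv ξ G x e) :
    HasDirDeriv ξ (fun y => F y - G y) x (d - e) := by
  intro φ
  simp only [map_sub]
  exact (hF φ).sub (hG φ)

theorem HasDirDeriv.const_smul {F : CSpace N → U} {x ξ : CSpace N} {d : U}
    (hF : HasDirDeriv ξ F x d) (t : ℂ) : HasDirDeriv ξ (fun y => t • F y) x (t • d) := by
  intro φ
  simp only [map_smul]
  exact (hF φ).const_mul t

theorem HasDirDeriv.postcomp {U' : Type*} [AddCommGroup U'] [Module ℂ U'] {F : CSpace N → U}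
    {x ξ : CSpace N} {d : U} (hF : HasDirDeriv ξ F x d) (L : U →ₗ[ℂ] U') :
    HasDirDeriv ξ (fun y => L (F y)) x (L d) :=
  fun φ => hF (φ ∘ₗ L)

theorem HasDirDeriv.dot_smul {F : CSpace N → U} {x ξ : CSpace N} {d : U}
    (hF : HasDirDeriv ξ F x d) (η : CSpace N) :
    HasDirDeriv ξ (fun y => (η ⬝ᵥ y) • F y) x ((η ⬝ᵥ ξ) • F x + (η ⬝ᵥ x) • d) := by
  intro φ
  simp only [map_smul, map_add, smul_eq_mul, dotProduct_add, dotProduct_smul]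
  have h1 : HasDerivAt (fun t : ℂ => η ⬝ᵥ x + t * (η ⬝ᵥ ξ)) (η ⬝ᵥ ξ) 0 := by
    simpa using ((hasDerivAt_id (0 : ℂ)).mul_const (η ⬝ᵥ ξ)).const_add (η ⬝ᵥ x)
  have := h1.fun_mul (hF φ)
  simpa using this

/-! ### Divided differences -/

theorem divDiff_of_ne {α : RSpace N} {F : CSpace N → U} {x : CSpace N} (h : cx α ⬝ᵥ x ≠ 0) :
    divDiff α F x = (cx α ⬝ᵥ x)⁻¹ • (F x - F (refl α x)) := by
  rw [divDiff, if_neg h]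

theorem divDiff_of_eq {α : RSpace N} {F : CSpace N → U} {x : CSpace N} (h : cx α ⬝ᵥ x = 0) :
    divDiff α F x = (2 / (cx α ⬝ᵥ cx α)) • dirDeriv (cx α) F x := by
  rw [divDiff, if_pos h]

theorem divDiff_congr {α : RSpace N} {F G : CSpace N → U} {x : CSpace N}
    (h : F =ᶠ[𝓝 x] G) (h' : F (refl α x) = G (refl α x)) : divDiff α F x = divDiff α G x := by
  unfold divDiff
  rw [dirDeriv_congr h, h.self_of_nhds, h']

/-- An analytic quotient of `F - s_α F` by `(α, ·)` is the divided difference, also on the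
mirror. -/
theorem divDiff_eq_of_quotient {α : RSpace N} (hα : α ≠ 0) {F H : CSpace N → U} {x : CSpace N}
    (hx : cx α ⬝ᵥ x = 0) (hF : AnAt F x) (hH : AnAt H x)
    (h : ∀ᶠ y in 𝓝 x, (cx α ⬝ᵥ y) • H y = F y - F (refl α y)) : divDiff α F x = H x := by
  have hαα := cx_dot_self_ne_zero hα
  have hsx := refl_eq_self hx
  have hFs : AnAt F (refl α x) := by rwa [hsx]
  have e1 : dirDeriv (cx α) (fun y => (cx α ⬝ᵥ y) • H y) x = (cx α ⬝ᵥ cx α) • H x := by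
    rw [((hH.hasDirDeriv _).dot_smul (cx α)).dirDeriv_eq, hx, zero_smul, add_zero]
  have e2 : dirDeriv (cx α) (fun y => F y - F (refl α y)) x = (2 : ℂ) • dirDeriv (cx α) F x := by
    rw [((hF.hasDirDeriv _).sub ((hFs.comp_equiv (refl α)).hasDirDeriv _)).dirDeriv_eq,
      dirDeriv_comp_equiv, hsx, refl_cx, rrefl_self]
    have : cx (-α) = (-1 : ℂ) • cx α := by rw [cx_neg]; simp
    rw [this, hF.dirDeriv_smul_vec, neg_smul, one_smul, sub_neg_eq_add, two_smul]
  rw [dirDeriv_congr h, e2] at e1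
  rw [divDiff_of_eq hx, div_eq_inv_mul, mul_smul, e1, smul_smul, inv_mul_cancel₀ hαα, one_smul]

/-- Near a point of its mirror, the linear form `(α, ·)` divides `F - s_α F`. -/
theorem AnAt.exists_quotient {α : RSpace N} (hα : α ≠ 0) {F : CSpace N → U} {x : CSpace N}
    (hx : cx α ⬝ᵥ x = 0) (hF : AnAt F x) :
    ∃ H : CSpace N → U, AnAt H x ∧
      ∀ᶠ y in 𝓝 x, (cx α ⬝ᵥ y) • H y = F y - F (refl α y) := by
  have hαα := cx_dot_self_ne_zero hα
  obtain ⟨n, f, u, hf, e⟩ := anAt_iff.1 hF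
  let s : CSpace N →L[ℂ] CSpace N := (refl α).toContinuousLinearEquiv
  let ℓ : CSpace N →L[ℂ] ℂ := LinearMap.toContinuousLinearMap
    { toFun := fun y => cx α ⬝ᵥ y
      map_add' := fun a b => dotProduct_add _ _ _
      map_smul' := fun t a => dotProduct_smul _ _ _ }
  have hs : ∀ y, y - s y = ℓ y • ((2 / (cx α ⬝ᵥ cx α)) • cx α) := by
    intro y
    change y - refl α y = (cx α ⬝ᵥ y) • _
    rw [refl_apply, sub_sub_cancel, smul_smul]
    congr 1
    ring
  choose h hh he using fun j => exists_analytic_quotient (hf j) s _ ℓ hs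
  have hsub : ∀ y, x + s (y - x) = refl α y := by
    intro y
    change x + refl α (y - x) = _
    rw [map_sub, refl_eq_self hx, add_sub_cancel]
  refine ⟨fun y => ∑ j, h j y • u j, anAt_iff.2 ⟨n, h, u, hh, Eventually.of_forall fun _ => rfl⟩, ?_⟩
  have e' : ∀ᶠ y in 𝓝 x, F (refl α y) = ∑ j, f j (refl α y) • u j := by
    have hc : Tendsto (fun y => refl α y) (𝓝 x) (𝓝 x) := by
      have := (continuous_equiv (refl α)).tendsto x
      rwa [refl_eq_self hx] at this
    exact hc.eventually e
  filter_upwards [e, e', Filter.eventually_all.2 he] with y h1 h2 h3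
  rw [h1, h2, ← Finset.sum_sub_distrib, Finset.smul_sum]
  refine Finset.sum_congr rfl fun j _ => ?_
  have h4 := h3 j
  rw [hsub] at h4
  have h5 : ℓ (y - x) = cx α ⬝ᵥ y := by
    change cx α ⬝ᵥ (y - x) = _
    rw [dotProduct_sub, hx, sub_zero]
  rw [← sub_smul, h4, h5, smul_smul, smul_eq_mul]

theorem analyticAt_dot (a x : CSpace N) : AnalyticAt ℂ (fun y : CSpace N => a ⬝ᵥ y) x :=
  (LinearMap.toContinuousLinearMap (𝕜 := ℂ)
    { toFun := fun y : CSpace N => a ⬝ᵥ y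
      map_add' := fun _ _ => dotProduct_add _ _ _
      map_smul' := fun _ _ => dotProduct_smul _ _ _ }).analyticAt x

theorem AnAt.divDiff {α : RSpace N} {F : CSpace N → U} {x : CSpace N}
    (hF : AnAt F x) (hF' : AnAt F (refl α x)) : AnAt (divDiff α F) x := by
  by_cases hα : α = 0
  · refine anAt_zero.congr (Eventually.of_forall fun y => ?_)
    have : cx α = 0 := by funext i; simp [hα, cx]
    rw [divDiff_of_eq (by rw [this, zero_dotProduct]), this, dotProduct_zero, div_zero, zero_smul]
  by_cases hx : cx α ⬝ᵥ x = 0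
  · obtain ⟨H, hH, e⟩ := hF.exists_quotient hα hx
    refine hH.congr ?_
    filter_upwards [eventually_eventually_nhds.2 e, hF.eventually, hH.eventually] with y h1 h2 h3
    by_cases hy : cx α ⬝ᵥ y = 0
    · exact (divDiff_eq_of_quotient hα hy h2 h3 h1).symm
    · rw [divDiff_of_ne hy, ← h1.self_of_nhds, smul_smul, inv_mul_cancel₀ hy, one_smul]
  · have h1 : AnAt (fun y => (cx α ⬝ᵥ y)⁻¹ • (F y - F (refl α y))) x :=
      (hF.sub (hF'.comp_equiv _)).smul ((analyticAt_dot _ x).inv hx)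
    refine h1.congr ?_
    filter_upwards [(continuous_dot (cx α)).continuousAt.eventually_ne hx] with y hy
    exact (divDiff_of_ne hy).symm

/-! ### Hadamard's lemma along a finite set -/

theorem AnAt.hadamard {F : CSpace N → U} {x : CSpace N} (hF : AnAt F x) :
    ∃ H : Fin N → CSpace N → U, (∀ i, AnAt (H i) x) ∧
      ∀ᶠ y in 𝓝 x, F y = F x + ∑ i, (y i - x i) • H i y := by
  obtain ⟨n, f, u, hf, e⟩ := anAt_iff.1 hF
  choose G hG he using fun j => exists_analytic_hadamard (hf j)
  refine ⟨fun i y => ∑ j, G j y (Pi.single i 1) • u j, fun i => anAt_iff.2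
    ⟨n, fun j y => G j y (Pi.single i 1), u, fun j => ?_, Eventually.of_forall fun _ => rfl⟩, ?_⟩
  · exact (ContinuousLinearMap.apply ℂ ℂ (Pi.single i (1 : ℂ))).analyticAt _ |>.comp (hG j)
  filter_upwards [e, Filter.eventually_all.2 he] with y h1 h2
  rw [h1, e.self_of_nhds, ← sub_eq_iff_eq_add', ← Finset.sum_sub_distrib]
  simp only [Finset.smul_sum]
  rw [Finset.sum_comm]
  refine Finset.sum_congr rfl fun j _ => ?_
  rw [← sub_smul, h2 j]
  have hy : y - x = ∑ i, (y i - x i) • (Pi.single i (1 : ℂ) : CSpace N) := by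
    funext k; simp [Finset.sum_apply, Pi.single_apply]
  conv_lhs => rw [hy, map_sum, Finset.sum_smul]
  refine Finset.sum_congr rfl fun i _ => ?_
  rw [map_smul, smul_assoc]

/-- A function with prescribed germs at the points of a finite set. -/
theorem exists_glue {X Y : Type*} [TopologicalSpace X] [T2Space X] {s : Set X} (hs : s.Finite)
    (y₀ : Y) (G : X → X → Y) : ∃ H : X → Y, ∀ x ∈ s, H =ᶠ[𝓝 x] G x := by
  classical
  obtain ⟨V, hV, hdisj⟩ := hs.t2_separation
  refine ⟨fun y => if h : ∃ x ∈ s, y ∈ V x then G h.choose y else y₀, fun x hx => ?_⟩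
  filter_upwards [(hV x).2.mem_nhds (hV x).1] with y hy
  have h : ∃ x ∈ s, y ∈ V x := ⟨x, hx, hy⟩
  have hch : h.choose = x := by
    by_contra hne
    exact Set.disjoint_left.1 (hdisj h.choose_spec.1 hx hne) h.choose_spec.2 hy
  rw [dif_pos h, hch]

/-- Hadamard's lemma at `x`, simultaneously near all points of a finite set: away from `x` some
coordinate difference `y_k - x_k` is invertible. -/
theorem hadamard_finite {s : Set (CSpace N)} (hs : s.Finite) {F : CSpace N → U}
    (hF : ∀ z ∈ s, AnAt F z) {x : CSpace N} (hx : x ∈ s) :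
    ∃ H : Fin N → CSpace N → U, (∀ i, ∀ z ∈ s, AnAt (H i) z) ∧
      ∀ z ∈ s, ∀ᶠ y in 𝓝 z, F y = F x + ∑ i, (y i - x i) • H i y := by
  have hloc : ∀ z ∈ s, ∃ H : Fin N → CSpace N → U, (∀ i, AnAt (H i) z) ∧
      ∀ᶠ y in 𝓝 z, F y = F x + ∑ i, (y i - x i) • H i y := by
    intro z hz
    by_cases hzx : z = x
    · subst hzx; exact (hF z hz).hadamard
    obtain ⟨k, hk⟩ := Function.ne_iff.1 hzx
    have hk' : z k - x k ≠ 0 := sub_ne_zero.2 hk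
    have hc : AnalyticAt ℂ (fun y : CSpace N => y k - x k) z :=
      ((ContinuousLinearMap.proj (R := ℂ) (φ := fun _ : Fin N => ℂ) k).analyticAt z).sub
        analyticAt_const
    refine ⟨fun i y => if i = k then (y k - x k)⁻¹ • (F y - F x) else 0, fun i => ?_, ?_⟩
    · by_cases hi : i = k
      · simp only [hi, if_true]
        exact ((hF z hz).sub (anAt_const _)).smul (hc.inv hk')
      · simp only [hi, if_false]
        exact anAt_zero
    · filter_upwards [hc.continuousAt.eventually_ne hk'] with y hy
      simp [smul_smul, mul_inv_cancel₀ hy]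
  choose! G hG he using hloc
  choose H hH using fun i => exists_glue hs (0 : U) (fun z => G z i)
  refine ⟨H, fun i z hz => (hG z hz i).congr (hH i z hz).symm, fun z hz => ?_⟩
  filter_upwards [he z hz, Filter.eventually_all.2 fun i => hH i z hz] with y h1 h2
  rw [h1]
  simp only [h2]

end AnalyticGerms

section Operators

variable {N : ℕ} {U : Type*} [AddCommGroup U] [Module ℂ U] {R S Γ₀ : Finset (RSpace N)}

/-! ### Operators on analytic functions on an invariant open set -/

/-- An open subset of `ℂ^N` invariant under the reflection group. -/
structure InvOpen (R : Finset (RSpace N)) where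
  /-- The underlying set. -/
  carrier : Set (CSpace N)
  isOpen : IsOpen carrier
  map_mem : ∀ w ∈ reflGroup R, ∀ y ∈ carrier, w y ∈ carrier

/-- An analytic `U`-valued function on `Ω`. It is extended by `0` to a function on the whole space,
so that equality is equality on `Ω`. -/
@[ext]
structure AnFun (Ω : InvOpen R) (U : Type*) [AddCommGroup U] [Module ℂ U] where
  /-- The underlying function. -/
  val : CSpace N → U
  anAt : ∀ x ∈ Ω.carrier, AnAt val x
  eq_zero : ∀ x ∉ Ω.carrier, val x = 0

variable {Ω : InvOpen R}

theorem anFun_anAt (F : AnFun Ω U) {x : CSpace N} (hx : x ∈ Ω.carrier) : AnAt F.1 x := F.2 x hx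

theorem AnFun.val_injective : Function.Injective (AnFun.val : AnFun Ω U → CSpace N → U) :=
  fun _ _ h => AnFun.ext h

instance : Zero (AnFun Ω U) := ⟨⟨0, fun _ _ => anAt_zero, fun _ _ => rfl⟩⟩

instance : Add (AnFun Ω U) :=
  ⟨fun F G => ⟨F.1 + G.1, fun x hx => (F.2 x hx).add (G.2 x hx), fun x hx => by
    rw [Pi.add_apply, F.3 x hx, G.3 x hx, add_zero]⟩⟩

instance : Sub (AnFun Ω U) :=
  ⟨fun F G => ⟨F.1 - G.1, fun x hx => (F.2 x hx).sub (G.2 x hx), fun x hx => by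
    rw [Pi.sub_apply, F.3 x hx, G.3 x hx, sub_zero]⟩⟩

instance : SMul ℂ (AnFun Ω U) :=
  ⟨fun t F => ⟨t • F.1, fun x hx => (F.2 x hx).const_smul t, fun x hx => by
    rw [Pi.smul_apply, F.3 x hx, smul_zero]⟩⟩

instance : Neg (AnFun Ω U) :=
  ⟨fun F => ⟨-F.1, fun x hx => (anAt_zero.sub (F.2 x hx)).congr
    (Eventually.of_forall fun y => zero_sub (F.1 y)), fun x hx => by
    rw [Pi.neg_apply, F.3 x hx, neg_zero]⟩⟩

instance : SMul ℕ (AnFun Ω U) :=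
  ⟨fun t F => ⟨t • F.1, fun x hx => ((F.2 x hx).const_smul (t : ℂ)).congr
    (Eventually.of_forall fun y => Nat.cast_smul_eq_nsmul ℂ t (F.1 y)), fun x hx => by
    rw [Pi.smul_apply, F.3 x hx, smul_zero]⟩⟩

instance : SMul ℤ (AnFun Ω U) :=
  ⟨fun t F => ⟨t • F.1, fun x hx => ((F.2 x hx).const_smul (t : ℂ)).congr
    (Eventually.of_forall fun y => Int.cast_smul_eq_zsmul ℂ t (F.1 y)), fun x hx => by
    rw [Pi.smul_apply, F.3 x hx, smul_zero]⟩⟩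

instance : AddCommGroup (AnFun Ω U) :=
  AnFun.val_injective.addCommGroup AnFun.val rfl (fun _ _ => rfl) (fun _ => rfl) (fun _ _ => rfl)
    (fun _ _ => rfl) fun _ _ => rfl

instance : Module ℂ (AnFun Ω U) :=
  AnFun.val_injective.module ℂ ⟨⟨AnFun.val, rfl⟩, fun _ _ => rfl⟩ fun _ _ => rfl

theorem AnFun.ext_on {F G : AnFun Ω U} (h : ∀ x ∈ Ω.carrier, F.1 x = G.1 x) : F = G := by
  apply AnFun.ext
  funext x
  by_cases hx : x ∈ Ω.carrier
  · exact h x hx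
  · rw [F.3 x hx, G.3 x hx]

theorem InvOpen.inv_mem (Ω : InvOpen R) (w : reflGroup R) {x : CSpace N} :
    (w.1⁻¹ : CSpace N ≃ₗ[ℂ] CSpace N) x ∈ Ω.carrier ↔ x ∈ Ω.carrier := by
  constructor
  · intro h
    have := Ω.map_mem w.1 w.2 _ h
    have e : w.1 ((w.1⁻¹ : CSpace N ≃ₗ[ℂ] CSpace N) x) = x := w.1.apply_symm_apply x
    rwa [e] at this
  · exact Ω.map_mem _ (Subgroup.inv_mem _ w.2) x

/-- The restriction to `Ω` of a function analytic on `Ω`, as an element of `AnFun Ω U`. -/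
def cut (Ω : InvOpen R) (F : CSpace N → U) (hF : ∀ x ∈ Ω.carrier, AnAt F x) : AnFun Ω U :=
  ⟨Ω.carrier.indicator F, fun x hx => (hF x hx).congr (by
    filter_upwards [Ω.isOpen.mem_nhds hx] with y hy
    rw [Set.indicator_of_mem hy]), fun x hx => Set.indicator_of_notMem hx F⟩

theorem cut_apply {F : CSpace N → U} {hF : ∀ x ∈ Ω.carrier, AnAt F x} {x : CSpace N}
    (hx : x ∈ Ω.carrier) : (cut Ω F hF).1 x = F x := Set.indicator_of_mem hx F

theorem cut_eventuallyEq {F : CSpace N → U} {hF : ∀ x ∈ Ω.carrier, AnAt F x} {x : CSpace N}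
    (hx : x ∈ Ω.carrier) : (cut Ω F hF).1 =ᶠ[𝓝 x] F := by
  filter_upwards [Ω.isOpen.mem_nhds hx] with y hy
  exact cut_apply hy

theorem AnFun.add_apply (F G : AnFun Ω U) (x : CSpace N) : (F + G).1 x = F.1 x + G.1 x := rfl
theorem AnFun.sub_apply (F G : AnFun Ω U) (x : CSpace N) : (F - G).1 x = F.1 x - G.1 x := rfl
theorem AnFun.smul_apply (t : ℂ) (F : AnFun Ω U) (x : CSpace N) : (t • F).1 x = t • F.1 x := rfl
theorem AnFun.sum_apply {ι : Type*} (s : Finset ι) (F : ι → AnFun Ω U) (x : CSpace N) :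
    (∑ i ∈ s, F i).1 x = ∑ i ∈ s, (F i).1 x := by
  let e : AnFun Ω U →+ U := ⟨⟨fun F => F.1 x, rfl⟩, fun _ _ => rfl⟩
  exact map_sum e F s

/-- The directional derivative `∂_ξ`. -/
def der (Ω : InvOpen R) (U : Type*) [AddCommGroup U] [Module ℂ U] (ξ : CSpace N) :
    Module.End ℂ (AnFun Ω U) where
  toFun F := cut Ω (dirDeriv ξ F.1) fun _ hx => (anFun_anAt F hx).dirDeriv ξ
  map_add' F G := AnFun.ext_on fun x hx => by
    rw [AnFun.add_apply, cut_apply hx, cut_apply hx, cut_apply hx]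
    exact (((anFun_anAt F hx).hasDirDeriv ξ).add ((anFun_anAt G hx).hasDirDeriv ξ)).dirDeriv_eq
  map_smul' t F := AnFun.ext_on fun x hx => by
    rw [RingHom.id_apply, AnFun.smul_apply, cut_apply hx, cut_apply hx]
    exact (((anFun_anAt F hx).hasDirDeriv ξ).const_smul t).dirDeriv_eq

theorem der_apply (ξ : CSpace N) (F : AnFun Ω U) {x : CSpace N} (hx : x ∈ Ω.carrier) :
    (der Ω U ξ F).1 x = dirDeriv ξ F.1 x :=
  Set.indicator_of_mem hx _

theorem divDiff_add {α : RSpace N} {F G : CSpace N → U} {x : CSpace N} (hF : AnAt F x)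
    (hG : AnAt G x) : divDiff α (F + G) x = divDiff α F x + divDiff α G x := by
  unfold divDiff
  split_ifs
  · have := ((hF.hasDirDeriv (cx α)).add (hG.hasDirDeriv (cx α))).dirDeriv_eq
    change dirDeriv (cx α) (F + G) x = _ at this
    rw [this, smul_add]
  · rw [Pi.add_apply, Pi.add_apply, ← smul_add]
    congr 1
    abel

theorem divDiff_smul {α : RSpace N} {F : CSpace N → U} {x : CSpace N} (hF : AnAt F x) (t : ℂ) :
    divDiff α (t • F) x = t • divDiff α F x := by
  unfold divDiff
  split_ifs
  · have := ((hF.hasDirDeriv (cx α)).const_smul t).dirDeriv_eq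
    change dirDeriv (cx α) (t • F) x = _ at this
    rw [this, smul_comm]
  · rw [Pi.smul_apply, Pi.smul_apply, ← smul_sub, smul_comm]

/-- The divided difference operator `(α, x)⁻¹ (1 - s_α)`. -/
def dd (Ω : InvOpen R) (U : Type*) [AddCommGroup U] [Module ℂ U] (α : R) :
    Module.End ℂ (AnFun Ω U) where
  toFun F := cut Ω (divDiff α F.1) fun x hx =>
    (anFun_anAt F hx).divDiff (anFun_anAt F (Ω.map_mem _ (refl_mem_reflGroup α.2) x hx))
  map_add' F G := AnFun.ext_on fun x hx => by
    rw [AnFun.add_apply, cut_apply hx, cut_apply hx, cut_apply hx]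
    exact divDiff_add (anFun_anAt F hx) (anFun_anAt G hx)
  map_smul' t F := AnFun.ext_on fun x hx => by
    rw [RingHom.id_apply, AnFun.smul_apply, cut_apply hx, cut_apply hx]
    exact divDiff_smul (anFun_anAt F hx) t

theorem dd_apply (α : R) (F : AnFun Ω U) {x : CSpace N} (hx : x ∈ Ω.carrier) :
    (dd Ω U α F).1 x = divDiff (α : RSpace N) F.1 x :=
  Set.indicator_of_mem hx _

/-- The action `(w F)(x) = F (w⁻¹ x)` of the reflection group. -/
def act (Ω : InvOpen R) (U : Type*) [AddCommGroup U] [Module ℂ U] (w : reflGroup R) :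
    Module.End ℂ (AnFun Ω U) where
  toFun F := ⟨fun x => F.1 ((w.1⁻¹ : CSpace N ≃ₗ[ℂ] CSpace N) x),
    fun _ hx => (anFun_anAt F ((Ω.inv_mem w).2 hx)).comp_equiv _,
    fun _ hx => F.3 _ fun h => hx ((Ω.inv_mem w).1 h)⟩
  map_add' _ _ := rfl
  map_smul' _ _ := rfl

theorem act_apply (w : reflGroup R) (F : AnFun Ω U) (x : CSpace N) :
    (act Ω U w F).1 x = F.1 ((w.1⁻¹ : CSpace N ≃ₗ[ℂ] CSpace N) x) := rfl

/-- Multiplication by the linear form `(η, x)`. -/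
def mulDot (Ω : InvOpen R) (U : Type*) [AddCommGroup U] [Module ℂ U] (η : CSpace N) :
    Module.End ℂ (AnFun Ω U) where
  toFun F := ⟨fun x => (η ⬝ᵥ x) • F.1 x, fun x hx => (anFun_anAt F hx).smul (analyticAt_dot η x),
    fun _ hx => (congrArg _ (F.3 _ hx)).trans (smul_zero _)⟩
  map_add' F G := AnFun.ext <| funext fun x => smul_add (η ⬝ᵥ x) (F.1 x) (G.1 x)
  map_smul' t F := AnFun.ext <| funext fun x => smul_comm (η ⬝ᵥ x) t (F.1 x)

theorem mulDot_apply (η : CSpace N) (F : AnFun Ω U) (x : CSpace N) :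
    (mulDot Ω U η F).1 x = (η ⬝ᵥ x) • F.1 x := rfl

/-- Composition with an endomorphism of `U`. -/
def post (Ω : InvOpen R) {U : Type*} [AddCommGroup U] [Module ℂ U] (L : Module.End ℂ U) :
    Module.End ℂ (AnFun Ω U) where
  toFun F := ⟨fun x => L (F.1 x), fun _ hx => (anFun_anAt F hx).postcomp L,
    fun _ hx => (congrArg _ (F.3 _ hx)).trans (map_zero _)⟩
  map_add' F G := AnFun.ext <| funext fun x => map_add L (F.1 x) (G.1 x)
  map_smul' t F := AnFun.ext <| funext fun x => map_smul L t (F.1 x)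

theorem post_apply (L : Module.End ℂ U) (F : AnFun Ω U) (x : CSpace N) :
    (post Ω L F).1 x = L (F.1 x) := rfl

theorem end_ext {A B : Module.End ℂ (AnFun Ω U)}
    (h : ∀ F : AnFun Ω U, ∀ x ∈ Ω.carrier, (A F).1 x = (B F).1 x) : A = B :=
  LinearMap.ext fun F => AnFun.ext_on (h F)

/-! ### Commutation relations -/

theorem der_mulDot (ξ η : CSpace N) :
    der Ω U ξ * mulDot Ω U η = mulDot Ω U η * der Ω U ξ + (η ⬝ᵥ ξ) • 1 := by
  refine end_ext fun F x hx => ?_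
  rw [Module.End.mul_apply, der_apply ξ _ hx, LinearMap.add_apply, AnFun.add_apply,
    Module.End.mul_apply, mulDot_apply, der_apply ξ _ hx, LinearMap.smul_apply, AnFun.smul_apply,
    Module.End.one_apply, add_comm]
  exact (((anFun_anAt F hx).hasDirDeriv ξ).dot_smul η).dirDeriv_eq

/-- The twisted Leibniz rule for divided differences. -/
theorem dd_mulDot (α : R) (η : CSpace N) :
    dd Ω U α * mulDot Ω U η = mulDot Ω U η * dd Ω U α +
      (2 * (cx (α : RSpace N) ⬝ᵥ η) / (cx (α : RSpace N) ⬝ᵥ cx α)) • act Ω U (reflW α) := by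
  refine end_ext fun F x hx => ?_
  rw [Module.End.mul_apply, dd_apply α _ hx, LinearMap.add_apply, AnFun.add_apply,
    Module.End.mul_apply, mulDot_apply, dd_apply α _ hx, LinearMap.smul_apply, AnFun.smul_apply,
    act_apply]
  change divDiff (α : RSpace N) (fun y => (η ⬝ᵥ y) • F.1 y) x = (η ⬝ᵥ x) • divDiff α F.1 x +
    (2 * (cx (α : RSpace N) ⬝ᵥ η) / (cx (α : RSpace N) ⬝ᵥ cx α)) • F.1 (refl α x)
  by_cases h : cx (α : RSpace N) ⬝ᵥ x = 0
  · rw [divDiff_of_eq h, divDiff_of_eq h, (((anFun_anAt F hx).hasDirDeriv _).dot_smul η).dirDeriv_eq,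
      refl_eq_self h, smul_add, smul_smul, smul_smul, smul_smul, add_comm,
      dotProduct_comm η (cx (α : RSpace N))]
    congr 2 <;> ring
  · have h1 : η ⬝ᵥ refl (α : RSpace N) x = η ⬝ᵥ x -
        2 * (cx (α : RSpace N) ⬝ᵥ x) / (cx (α : RSpace N) ⬝ᵥ cx α) * (cx (α : RSpace N) ⬝ᵥ η) := by
      rw [refl_apply, dotProduct_sub, dotProduct_smul, smul_eq_mul, dotProduct_comm η (cx α)]
    rw [divDiff_of_ne h, divDiff_of_ne h, h1]
    simp only [smul_sub, sub_smul, smul_smul]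
    have h2 : (cx (α : RSpace N) ⬝ᵥ x)⁻¹ * (2 * (cx (α : RSpace N) ⬝ᵥ x) /
        (cx (α : RSpace N) ⬝ᵥ cx α) * (cx (α : RSpace N) ⬝ᵥ η)) =
        2 * (cx (α : RSpace N) ⬝ᵥ η) / (cx (α : RSpace N) ⬝ᵥ cx α) := by
      rw [div_mul_eq_mul_div, ← mul_div_assoc]
      congr 1
      field_simp
    rw [h2, mul_comm (η ⬝ᵥ x)]
    abel

theorem act_der (w : reflGroup R) (ξ : CSpace N) :
    act Ω U w * der Ω U ξ = der Ω U (w.1 ξ) * act Ω U w := by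
  refine end_ext fun F x hx => ?_
  rw [Module.End.mul_apply, act_apply, der_apply _ _ ((Ω.inv_mem w).2 hx), Module.End.mul_apply,
    der_apply _ _ hx]
  have := dirDeriv_comp_equiv (w.1⁻¹) (w.1 ξ) F.1 x
  have e : (w.1⁻¹ : CSpace N ≃ₗ[ℂ] CSpace N) (w.1 ξ) = ξ := w.1.symm_apply_apply ξ
  rw [e] at this
  exact this.symm

/-- Conjugation of reflections. -/
theorem refl_map {w : CSpace N ≃ₗ[ℂ] CSpace N} (hw : w ∈ reflGroup R) {α β : RSpace N}
    (h : cx β = w (cx α)) (x : CSpace N) : refl β (w x) = w (refl α x) := by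
  rw [refl_apply, refl_apply, h, reflGroup_dot_dot hw, reflGroup_dot_dot hw, map_sub, map_smul]

theorem act_dd (w : reflGroup R) {α β : R} (h : cx (β : RSpace N) = w.1 (cx α)) :
    act Ω U w * dd Ω U α = dd Ω U β * act Ω U w := by
  refine end_ext fun F x hx => ?_
  rw [Module.End.mul_apply, act_apply, dd_apply _ _ ((Ω.inv_mem w).2 hx), Module.End.mul_apply,
    dd_apply _ _ hx]
  obtain ⟨y, rfl⟩ := w.1.surjective x
  have e : ∀ y, (w.1⁻¹ : CSpace N ≃ₗ[ℂ] CSpace N) (w.1 y) = y := w.1.symm_apply_apply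
  have hdot : cx (β : RSpace N) ⬝ᵥ w.1 y = cx (α : RSpace N) ⬝ᵥ y := by
    rw [h, reflGroup_dot_dot w.2]
  unfold divDiff
  rw [e, hdot, act_apply, act_apply, refl_map w.2 h, e, e]
  have h1 : cx (β : RSpace N) ⬝ᵥ cx (β : RSpace N) = cx (α : RSpace N) ⬝ᵥ cx (α : RSpace N) := by
    rw [h, reflGroup_dot_dot w.2]
  have h2 := dirDeriv_comp_equiv (w.1⁻¹) (w.1 (cx α)) F.1 (w.1 y)
  rw [e, e, ← h] at h2
  rw [h1]
  change _ = if _ then _ • dirDeriv (cx (β : RSpace N))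
    (fun x => F.1 ((w.1⁻¹ : CSpace N ≃ₗ[ℂ] CSpace N) x)) (w.1 y) else _
  rw [h2]

theorem der_add (ξ η : CSpace N) : der Ω U (ξ + η) = der Ω U ξ + der Ω U η :=
  end_ext fun F x hx => by
    rw [LinearMap.add_apply, AnFun.add_apply, der_apply _ _ hx, der_apply _ _ hx, der_apply _ _ hx,
      (anFun_anAt F hx).dirDeriv_add_vec]

theorem der_smul (t : ℂ) (ξ : CSpace N) : der Ω U (t • ξ) = t • der Ω U ξ :=
  end_ext fun F x hx => by
    rw [LinearMap.smul_apply, AnFun.smul_apply, der_apply _ _ hx, der_apply _ _ hx,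
      (anFun_anAt F hx).dirDeriv_smul_vec]

theorem dd_neg {α β : R} (h : (β : RSpace N) = -α) : dd Ω U β = -dd Ω U α :=
  end_ext fun F x hx => by
    rw [LinearMap.neg_apply]
    change _ = -(dd Ω U α F).1 x
    rw [dd_apply _ _ hx, dd_apply _ _ hx]
    have h1 : cx (β : RSpace N) = -cx α := by rw [h, cx_neg]
    have h2 : refl (β : RSpace N) x = refl α x := by
      rw [refl_apply, refl_apply, h1]
      simp [neg_div]
    unfold divDiff
    rw [h2, h1]
    simp only [neg_dotProduct, dotProduct_neg, neg_neg, neg_eq_zero]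
    split_ifs
    · have : -cx (α : RSpace N) = (-1 : ℂ) • cx (α : RSpace N) := by simp
      rw [this, (anFun_anAt F hx).dirDeriv_smul_vec, neg_smul, one_smul, smul_neg]
    · rw [inv_neg, neg_smul]

theorem post_der (L : Module.End ℂ U) (ξ : CSpace N) :
    post Ω L * der Ω U ξ = der Ω U ξ * post Ω L :=
  end_ext fun F x hx => by
    rw [Module.End.mul_apply, post_apply, der_apply _ _ hx, Module.End.mul_apply, der_apply _ _ hx]
    exact (((anFun_anAt F hx).hasDirDeriv ξ).postcomp L).dirDeriv_eq.symm

theorem post_dd (L : Module.End ℂ U) (α : R) :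
    post Ω L * dd Ω U α = dd Ω U α * post Ω L :=
  end_ext fun F x hx => by
    rw [Module.End.mul_apply, post_apply, dd_apply _ _ hx, Module.End.mul_apply, dd_apply _ _ hx]
    unfold divDiff
    have := (((anFun_anAt F hx).hasDirDeriv (cx α)).postcomp L).dirDeriv_eq
    change dirDeriv _ (post Ω L F).1 x = _ at this
    rw [this, post_apply, post_apply]
    split_ifs <;> simp

/-! ### Vanishing of natural families of operators -/

/-- Restriction to a smaller invariant open set. -/
def res {Ω Ω' : InvOpen R} (h : Ω'.carrier ⊆ Ω.carrier) : AnFun Ω U →ₗ[ℂ] AnFun Ω' U where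
  toFun F := cut Ω' F.1 fun _ hx => anFun_anAt F (h hx)
  map_add' F G := AnFun.ext_on fun x hx => by
    rw [AnFun.add_apply, cut_apply hx, cut_apply hx, cut_apply hx]; rfl
  map_smul' t F := AnFun.ext_on fun x hx => by
    rw [RingHom.id_apply, AnFun.smul_apply, cut_apply hx, cut_apply hx]; rfl

theorem res_apply {Ω Ω' : InvOpen R} (h : Ω'.carrier ⊆ Ω.carrier) (F : AnFun Ω U) {x : CSpace N}
    (hx : x ∈ Ω'.carrier) : (res h F).1 x = F.1 x := Set.indicator_of_mem hx _

theorem res_eventuallyEq {Ω Ω' : InvOpen R} (h : Ω'.carrier ⊆ Ω.carrier) (F : AnFun Ω U)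
    {x : CSpace N} (hx : x ∈ Ω'.carrier) : (res h F).1 =ᶠ[𝓝 x] F.1 := by
  filter_upwards [Ω'.isOpen.mem_nhds hx] with y hy
  exact res_apply h F hy

/-- A family of operators, one for each invariant open set, is natural if it commutes with
restrictions. -/
def IsNatural (T : ∀ Ω : InvOpen R, Module.End ℂ (AnFun Ω U)) : Prop :=
  ∀ (Ω Ω' : InvOpen R) (h : Ω'.carrier ⊆ Ω.carrier), res h ∘ₗ T Ω = T Ω' ∘ₗ res h

theorem isNatural_der (ξ : CSpace N) : IsNatural (R := R) fun Ω => der Ω U ξ :=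
  fun Ω Ω' h => LinearMap.ext fun F => AnFun.ext_on fun x hx => by
    rw [LinearMap.comp_apply, LinearMap.comp_apply, res_apply h _ hx, der_apply _ _ (h hx),
      der_apply _ _ hx]
    exact dirDeriv_congr (res_eventuallyEq h F hx).symm

theorem isNatural_dd (α : R) : IsNatural (R := R) fun Ω => dd Ω U α :=
  fun Ω Ω' h => LinearMap.ext fun F => AnFun.ext_on fun x hx => by
    rw [LinearMap.comp_apply, LinearMap.comp_apply, res_apply h _ hx, dd_apply _ _ (h hx),
      dd_apply _ _ hx]
    exact divDiff_congr (res_eventuallyEq h F hx).symm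
      (res_apply h F (Ω'.map_mem _ (refl_mem_reflGroup α.2) x hx)).symm

theorem IsNatural.sub {T T' : ∀ Ω : InvOpen R, Module.End ℂ (AnFun Ω U)} (h : IsNatural T)
    (h' : IsNatural T') : IsNatural fun Ω => T Ω - T' Ω := fun Ω Ω' hΩ => by
  rw [LinearMap.comp_sub, LinearMap.sub_comp, h Ω Ω' hΩ, h' Ω Ω' hΩ]

theorem IsNatural.smul {T : ∀ Ω : InvOpen R, Module.End ℂ (AnFun Ω U)} (h : IsNatural T)
    (t : ℂ) : IsNatural fun Ω => t • T Ω := fun Ω Ω' hΩ => by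
  rw [LinearMap.comp_smul, LinearMap.smul_comp, h Ω Ω' hΩ]

theorem IsNatural.mul {T T' : ∀ Ω : InvOpen R, Module.End ℂ (AnFun Ω U)} (h : IsNatural T)
    (h' : IsNatural T') : IsNatural fun Ω => T Ω * T' Ω := fun Ω Ω' hΩ => by
  change res hΩ ∘ₗ T Ω ∘ₗ T' Ω = (T Ω' ∘ₗ T' Ω') ∘ₗ res hΩ
  rw [← LinearMap.comp_assoc, h Ω Ω' hΩ,
    LinearMap.comp_assoc, h' Ω Ω' hΩ, LinearMap.comp_assoc]

theorem IsNatural.sum {ι : Type*} (s : Finset ι)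
    {T : ι → ∀ Ω : InvOpen R, Module.End ℂ (AnFun Ω U)} (h : ∀ i ∈ s, IsNatural (T i)) :
    IsNatural fun Ω => ∑ i ∈ s, T i Ω := fun Ω Ω' hΩ => LinearMap.ext fun F => by
  simp only [LinearMap.comp_apply, LinearMap.sum_apply, map_sum]
  exact Finset.sum_congr rfl fun i hi => LinearMap.congr_fun (h i hi Ω Ω' hΩ) F

/-- The constant function `u` on `Ω`. -/
def constFun (Ω : InvOpen R) (u : U) : AnFun Ω U := cut Ω (fun _ => u) fun _ _ => anAt_const u

theorem constFun_apply (u : U) {x : CSpace N} (hx : x ∈ Ω.carrier) : (constFun Ω u).1 x = u :=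
  cut_apply (F := fun _ => u) (hF := fun _ _ => anAt_const u) hx

theorem constFun_eventuallyEq (u : U) {x : CSpace N} (hx : x ∈ Ω.carrier) :
    (constFun Ω u).1 =ᶠ[𝓝 x] fun _ => u :=
  cut_eventuallyEq (F := fun _ => u) (hF := fun _ _ => anAt_const u) hx

theorem dirDeriv_const (ξ x : CSpace N) (u : U) : dirDeriv ξ (fun _ => u) x = 0 :=
  HasDirDeriv.dirDeriv_eq fun φ => by simpa using hasDerivAt_const (0 : ℂ) (φ u)

theorem der_constFun (ξ : CSpace N) (u : U) : der Ω U ξ (constFun Ω u) = 0 :=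
  AnFun.ext_on fun x hx => by
    rw [der_apply _ _ hx, dirDeriv_congr (constFun_eventuallyEq u hx), dirDeriv_const]; rfl

theorem dd_constFun (α : R) (u : U) : dd Ω U α (constFun Ω u) = 0 :=
  AnFun.ext_on fun x hx => by
    have hx' := Ω.map_mem _ (refl_mem_reflGroup α.2) x hx
    rw [dd_apply _ _ hx, divDiff_congr (constFun_eventuallyEq u hx) (constFun_apply u hx')]
    unfold divDiff
    rw [dirDeriv_const, sub_self, smul_zero, smul_zero, ite_self]
    rfl

/-- A natural family of operators which commutes with the multiplication by linear forms and kills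
the constants vanishes: at a given point, Hadamard's lemma along the orbit writes every function as
a constant plus a combination of the linear forms that vanish at the point. -/
theorem IsNatural.eq_zero (hR : IsRootSystem R)
    {T : ∀ Ω : InvOpen R, Module.End ℂ (AnFun Ω U)} (h : IsNatural T)
    (hX : ∀ Ω η, T Ω * mulDot Ω U η = mulDot Ω U η * T Ω)
    (hconst : ∀ Ω u, T Ω (constFun Ω u) = 0) (Ω : InvOpen R) : T Ω = 0 := by
  refine end_ext fun F x hx => ?_
  set s : Set (CSpace N) := (fun w : CSpace N ≃ₗ[ℂ] CSpace N => w x) '' (reflGroup R) with hs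
  have hsf : s.Finite := hR.finite_reflGroup.image _
  have hxs : x ∈ s := ⟨1, one_mem _, rfl⟩
  have hsΩ : ∀ z ∈ s, z ∈ Ω.carrier := by
    rintro _ ⟨w, hw, rfl⟩; exact Ω.map_mem w hw x hx
  obtain ⟨H, hH, he⟩ := hadamard_finite hsf (fun z hz => anFun_anAt F (hsΩ z hz)) hxs
  obtain ⟨O, hO, hxO, hOW, hP⟩ := hR.exists_invariant_open (x := x)
    (P := fun y => y ∈ Ω.carrier ∧ (∀ i, AnAt (H i) y) ∧
      F.1 y = F.1 x + ∑ i, (y i - x i) • H i y) (fun w hw => by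
        have hz : w x ∈ s := ⟨w, hw, rfl⟩
        filter_upwards [Ω.isOpen.mem_nhds (hsΩ _ hz),
          Filter.eventually_all.2 fun i => (hH i _ hz).eventually, he _ hz] with y h1 h2 h3
        exact ⟨h1, h2, h3⟩)
  let Ω' : InvOpen R := ⟨O, hO, hOW⟩
  have hsub : Ω'.carrier ⊆ Ω.carrier := fun y hy => (hP y hy).1
  let K : Fin N → AnFun Ω' U := fun i => cut Ω' (H i) fun y hy => (hP y hy).2.1 i
  have hres : res hsub F = constFun Ω' (F.1 x) +
      ∑ i, (mulDot Ω' U (Pi.single i 1) (K i) - x i • K i) := by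
    refine AnFun.ext_on fun y hy => ?_
    rw [res_apply hsub F hy, AnFun.add_apply, AnFun.sum_apply]
    refine (hP y hy).2.2.trans ?_
    congr 1
    · exact (constFun_apply _ hy).symm
    · refine Finset.sum_congr rfl fun i _ => ?_
      rw [AnFun.sub_apply, mulDot_apply, AnFun.smul_apply, cut_apply hy, single_one_dotProduct,
        sub_smul]
  have h1 : (T Ω F).1 x = (T Ω' (res hsub F)).1 x := by
    rw [← res_apply hsub (T Ω F) hxO]
    exact congrArg (fun G : AnFun Ω' U => G.1 x) (LinearMap.congr_fun (h Ω Ω' hsub) F)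
  rw [h1, hres, map_add, hconst, zero_add, map_sum, AnFun.sum_apply]
  refine Finset.sum_eq_zero fun i _ => ?_
  have h2 : T Ω' (mulDot Ω' U (Pi.single i 1) (K i)) = mulDot Ω' U (Pi.single i 1) (T Ω' (K i)) :=
    LinearMap.congr_fun (hX Ω' (Pi.single i 1)) (K i)
  rw [map_sub, map_smul, h2, AnFun.sub_apply, AnFun.smul_apply, mulDot_apply,
    single_one_dotProduct, sub_self]

end Operators

section Dunkl

variable {N : ℕ} {U : Type*} [AddCommGroup U] [Module ℂ U] {R S Γ₀ : Finset (RSpace N)}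
variable {Ω : InvOpen R}

/-! ### Dunkl operators -/

/-- The Dunkl operator `∇_ξ` on analytic functions on `Ω`. -/
def dunklEnd (Ω : InvOpen R) (U : Type*) [AddCommGroup U] [Module ℂ U] (S : Finset (RSpace N))
    (c : R → ℂ) (ξ : CSpace N) : Module.End ℂ (AnFun Ω U) :=
  der Ω U ξ - ∑ α ∈ posRoots R S, (c α * (cx α ⬝ᵥ ξ)) • dd Ω U α

variable {c : R → ℂ}

theorem dunklEnd_apply (ξ : CSpace N) (F : AnFun Ω U) {x : CSpace N} (hx : x ∈ Ω.carrier) :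
    (dunklEnd Ω U S c ξ F).1 x = dunkl S c ξ F.1 x := by
  rw [dunklEnd, LinearMap.sub_apply, AnFun.sub_apply, der_apply _ _ hx, LinearMap.sum_apply,
    AnFun.sum_apply, dunkl]
  congr 1
  refine Finset.sum_congr rfl fun α _ => ?_
  rw [LinearMap.smul_apply, AnFun.smul_apply, dd_apply _ _ hx]

theorem dunklEnd_add (ξ η : CSpace N) :
    dunklEnd Ω U S c (ξ + η) = dunklEnd Ω U S c ξ + dunklEnd Ω U S c η := by
  simp only [dunklEnd, der_add, dotProduct_add, mul_add, add_smul, Finset.sum_add_distrib]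
  abel

theorem dunklEnd_smul (t : ℂ) (ξ : CSpace N) :
    dunklEnd Ω U S c (t • ξ) = t • dunklEnd Ω U S c ξ := by
  simp only [dunklEnd, der_smul, dotProduct_smul, smul_eq_mul, smul_sub, Finset.smul_sum,
    smul_smul]
  congr 1
  refine Finset.sum_congr rfl fun α _ => ?_
  congr 1
  ring

theorem eq_sum_of_linear {M : Type*} [AddCommGroup M] [Module ℂ M] (T : CSpace N → M)
    (hadd : ∀ ξ η, T (ξ + η) = T ξ + T η) (hsmul : ∀ (t : ℂ) ξ, T (t • ξ) = t • T ξ)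
    (ξ : CSpace N) : T ξ = ∑ i, ξ i • T (Pi.single i 1) := by
  let L : CSpace N →ₗ[ℂ] M := { toFun := T, map_add' := hadd, map_smul' := hsmul }
  have hξ : ξ = ∑ i, ξ i • (Pi.single i (1 : ℂ) : CSpace N) := by
    funext k; simp [Finset.sum_apply, Pi.single_apply]
  change L ξ = _
  conv_lhs => rw [hξ, map_sum]
  exact Finset.sum_congr rfl fun i _ => map_smul L _ _

theorem act_dunklEnd (hR : IsRootSystem R) (hS : IsSimpleSystem R S) (hc : IsInvariantMult c)
    (w : reflGroup R) (ξ : CSpace N) :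
    act Ω U w * dunklEnd Ω U S c ξ = dunklEnd Ω U S c (w.1 ξ) * act Ω U w := by
  obtain ⟨σ, hσ⟩ := hR.exists_perm w.2
  have h := hS.sum_posRoots_perm hR
    (fun β => (c β * (cx (β : RSpace N) ⬝ᵥ w.1 ξ)) • (dd Ω U β * act Ω U w))
    (fun α β e => by
      rw [hc.neg α β e, dd_neg e, e, cx_neg, neg_dotProduct, mul_neg, neg_mul, neg_smul_neg]) hσ
  rw [dunklEnd, dunklEnd, mul_sub, sub_mul, act_der, Finset.mul_sum, Finset.sum_mul]
  congr 1
  simp only [smul_mul_assoc]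
  rw [← h]
  refine Finset.sum_congr rfl fun α _ => ?_
  rw [mul_smul_comm, act_dd w (hσ α), hc.perm w.2 hσ, hσ, reflGroup_dot_dot w.2]

theorem dunklEnd_mulDot (ξ ζ : CSpace N) :
    dunklEnd Ω U S c ξ * mulDot Ω U ζ = mulDot Ω U ζ * dunklEnd Ω U S c ξ + (ζ ⬝ᵥ ξ) • 1 -
      ∑ α ∈ posRoots R S, (c α * (cx (α : RSpace N) ⬝ᵥ ξ) *
        (2 * (cx (α : RSpace N) ⬝ᵥ ζ) / (cx (α : RSpace N) ⬝ᵥ cx α))) • act Ω U (reflW α) := by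
  rw [dunklEnd, mul_sub, sub_mul, der_mulDot, Finset.mul_sum, Finset.sum_mul]
  simp only [smul_mul_assoc, mul_smul_comm, dd_mulDot, smul_add, Finset.sum_add_distrib, smul_smul]
  abel

theorem post_dunklEnd (L : Module.End ℂ U) (ξ : CSpace N) :
    post Ω L * dunklEnd Ω U S c ξ = dunklEnd Ω U S c ξ * post Ω L := by
  rw [dunklEnd, mul_sub, sub_mul, post_der, Finset.mul_sum, Finset.sum_mul]
  congr 1
  refine Finset.sum_congr rfl fun α _ => ?_
  rw [mul_smul_comm, smul_mul_assoc, post_dd]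

theorem isNatural_dunklEnd (ξ : CSpace N) :
    IsNatural (R := R) fun Ω => dunklEnd Ω U S c ξ :=
  (isNatural_der ξ).sub (IsNatural.sum _ fun α _ => (isNatural_dd α).smul _)

theorem dunklEnd_constFun (ξ : CSpace N) (u : U) : dunklEnd Ω U S c ξ (constFun Ω u) = 0 := by
  rw [dunklEnd, LinearMap.sub_apply, der_constFun, LinearMap.sum_apply, zero_sub, neg_eq_zero]
  exact Finset.sum_eq_zero fun α _ => by rw [LinearMap.smul_apply, dd_constFun, smul_zero]

/-- If `[a, X] = sa - ta` and `[b, X] = sb - tb`, where `sa` commutes with `b`, `sb` with `a`, and the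
reflection parts `ta` and `tb` satisfy `[b, ta] = [a, tb]`, then `[a, b]` commutes with `X`. -/
theorem commutator_mul_comm {A : Type*} [Ring A] {a b X sa sb ta tb : A}
    (ha : a * X = X * a + sa - ta) (hb : b * X = X * b + sb - tb) (hsa : sa * b = b * sa)
    (hsb : sb * a = a * sb) (h : b * ta - ta * b = a * tb - tb * a) :
    (a * b - b * a) * X = X * (a * b - b * a) := by
  have e1 : a * b * X = X * (a * b) + sa * b - ta * b + a * sb - a * tb := by
    rw [mul_assoc, hb, mul_sub, mul_add, ← mul_assoc, ha]
    noncomm_ring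
  have e2 : b * a * X = X * (b * a) + sb * a - tb * a + b * sa - b * ta := by
    rw [mul_assoc, ha, mul_sub, mul_add, ← mul_assoc, hb]
    noncomm_ring
  have h' : b * ta = a * tb - tb * a + ta * b := by rw [← h]; abel
  rw [sub_mul, e1, e2, mul_sub, hsa, hsb, h']
  abel

theorem act_reflW_dunklEnd (hR : IsRootSystem R) (hS : IsSimpleSystem R S)
    (hc : IsInvariantMult c) (α : R) (η : CSpace N) :
    act Ω U (reflW α) * dunklEnd Ω U S c η = dunklEnd Ω U S c η * act Ω U (reflW α) -
      (2 * (cx (α : RSpace N) ⬝ᵥ η) / (cx (α : RSpace N) ⬝ᵥ cx α)) •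
        (dunklEnd Ω U S c (cx α) * act Ω U (reflW α)) := by
  rw [act_dunklEnd hR hS hc]
  have e : (reflW α).1 η = η + (-(2 * (cx (α : RSpace N) ⬝ᵥ η) / (cx (α : RSpace N) ⬝ᵥ cx α))) •
      cx (α : RSpace N) := by
    rw [neg_smul, ← sub_eq_add_neg]; rfl
  rw [e, dunklEnd_add, dunklEnd_smul, add_mul, smul_mul_assoc, neg_smul, sub_eq_add_neg]

/-- Dunkl operators commute. The commutator commutes with the multiplication by linear forms, by
the commutation relations, and kills the constants. -/
theorem dunklEnd_comm (hR : IsRootSystem R) (hS : IsSimpleSystem R S) (hc : IsInvariantMult c)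
    (Ω : InvOpen R) (ξ η : CSpace N) :
    dunklEnd Ω U S c ξ * dunklEnd Ω U S c η = dunklEnd Ω U S c η * dunklEnd Ω U S c ξ := by
  rw [← sub_eq_zero]
  refine IsNatural.eq_zero hR (T := fun Ω => dunklEnd Ω U S c ξ * dunklEnd Ω U S c η -
    dunklEnd Ω U S c η * dunklEnd Ω U S c ξ)
    (((isNatural_dunklEnd ξ).mul (isNatural_dunklEnd η)).sub
      ((isNatural_dunklEnd η).mul (isNatural_dunklEnd ξ))) ?_ ?_ Ω
  · intro Ω ζ
    refine commutator_mul_comm (dunklEnd_mulDot ξ ζ) (dunklEnd_mulDot η ζ)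
      (by simp only [smul_mul_assoc, mul_smul_comm, one_mul, mul_one])
      (by simp only [smul_mul_assoc, mul_smul_comm, one_mul, mul_one]) ?_
    simp only [Finset.mul_sum, Finset.sum_mul, ← Finset.sum_sub_distrib, mul_smul_comm,
      smul_mul_assoc, act_reflW_dunklEnd hR hS hc, smul_sub, sub_sub_cancel, smul_smul]
    refine Finset.sum_congr rfl fun α _ => ?_
    congr 1
    ring
  · intro Ω u
    simp only [LinearMap.sub_apply, Module.End.mul_apply, dunklEnd_constFun, map_zero, sub_zero]

/-! ### The Dunkl Laplacian -/

/-- The part `∑ c_α c_β (α, β) (α, x)⁻¹ (1 - s_α) (β, x)⁻¹ (1 - s_β)` of the Dunkl Laplacian that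
is quadratic in the multiplicities vanishes. -/
theorem sum_dd_mul_dd (hR : IsRootSystem R) (hS : IsSimpleSystem R S) (hc : IsInvariantMult c)
    (Ω : InvOpen R) :
    ∑ α ∈ posRoots R S, ∑ β ∈ posRoots R S,
      (c α * c β * (cx (α : RSpace N) ⬝ᵥ cx β)) • (dd Ω U α * dd Ω U β) = 0 := by
  refine IsNatural.eq_zero hR (T := fun Ω => ∑ α ∈ posRoots R S, ∑ β ∈ posRoots R S,
      (c α * c β * (cx (α : RSpace N) ⬝ᵥ cx β)) • (dd Ω U α * dd Ω U β))
    (IsNatural.sum _ fun α _ => IsNatural.sum _ fun β _ =>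
      ((isNatural_dd α).mul (isNatural_dd β)).smul _) ?_ ?_ Ω
  · intro Ω ζ
    set m : R → ℂ := fun α => 2 * (cx (α : RSpace N) ⬝ᵥ ζ) / (cx (α : RSpace N) ⬝ᵥ cx α)
    -- The reflection `s_α` permutes the terms of the inner sum and changes the sign of `(α, β)`.
    have hanti : ∀ α : R, act Ω U (reflW α) *
        ∑ β ∈ posRoots R S, (c β * (cx (α : RSpace N) ⬝ᵥ cx β)) • dd Ω U β =
        -((∑ β ∈ posRoots R S, (c β * (cx (α : RSpace N) ⬝ᵥ cx β)) • dd Ω U β) *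
          act Ω U (reflW α)) := by
      intro α
      obtain ⟨σ, hσ⟩ := hR.exists_perm (reflW α).2
      have h := hS.sum_posRoots_perm hR
        (fun β => (c β * (cx (α : RSpace N) ⬝ᵥ cx β)) • (dd Ω U β * act Ω U (reflW α)))
        (fun β γ e => by
          rw [hc.neg β γ e, dd_neg e, e, cx_neg, dotProduct_neg, mul_neg, neg_mul,
            neg_smul_neg]) hσ
      simp only [Finset.mul_sum, Finset.sum_mul, mul_smul_comm, smul_mul_assoc]
      rw [← h, ← Finset.sum_neg_distrib]
      refine Finset.sum_congr rfl fun β _ => ?_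
      rw [act_dd _ (hσ β), hc.perm (reflW α).2 hσ, hσ, dot_apply_eq (reflW α).2, ← neg_smul]
      congr 1
      have : ((reflW α).1⁻¹ : CSpace N ≃ₗ[ℂ] CSpace N) (cx (α : RSpace N)) = -cx α := by
        change refl (α : RSpace N) (cx α) = _
        rw [refl_cx, rrefl_self, cx_neg]
      rw [this, neg_dotProduct]
      ring
    have hsum : ∑ α ∈ posRoots R S, (c α * m α) • (act Ω U (reflW α) *
          ∑ β ∈ posRoots R S, (c β * (cx (α : RSpace N) ⬝ᵥ cx β)) • dd Ω U β) +
        ∑ β ∈ posRoots R S, (c β * m β) • ((∑ α ∈ posRoots R S,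
          (c α * (cx (β : RSpace N) ⬝ᵥ cx α)) • dd Ω U α) * act Ω U (reflW β)) = 0 := by
      rw [← Finset.sum_add_distrib]
      refine Finset.sum_eq_zero fun α _ => ?_
      rw [hanti, smul_neg, neg_add_cancel]
    simp only [Finset.sum_mul, Finset.mul_sum, smul_mul_assoc, mul_smul_comm]
    rw [← sub_eq_zero, ← hsum]
    simp only [Finset.mul_sum, Finset.sum_mul, mul_smul_comm, smul_mul_assoc, Finset.smul_sum,
      smul_smul]
    conv_rhs => arg 2; rw [Finset.sum_comm]
    rw [← Finset.sum_sub_distrib, ← Finset.sum_add_distrib]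
    refine Finset.sum_congr rfl fun α _ => ?_
    rw [← Finset.sum_sub_distrib, ← Finset.sum_add_distrib]
    refine Finset.sum_congr rfl fun β _ => ?_
    have e : dd Ω U α * dd Ω U β * mulDot Ω U ζ = mulDot Ω U ζ * (dd Ω U α * dd Ω U β) +
        m α • (act Ω U (reflW α) * dd Ω U β) + m β • (dd Ω U α * act Ω U (reflW β)) := by
      rw [mul_assoc, dd_mulDot, mul_add, ← mul_assoc, dd_mulDot, add_mul, mul_assoc,
        smul_mul_assoc, mul_smul_comm]
    rw [e, smul_add, smul_add, smul_smul, smul_smul, add_assoc, add_sub_cancel_left,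
      dotProduct_comm (cx (β : RSpace N))]
    congr 2 <;> ring
  · intro Ω u
    simp only [LinearMap.sum_apply, LinearMap.smul_apply, Module.End.mul_apply, dd_constFun,
      map_zero, smul_zero, Finset.sum_const_zero]

/-- The Dunkl Laplacian: the terms linear in the multiplicities survive, the quadratic ones cancel
by `sum_dd_mul_dd`. -/
theorem sum_dunklEnd_mul_self (hR : IsRootSystem R) (hS : IsSimpleSystem R S)
    (hc : IsInvariantMult c) (Ω : InvOpen R) :
    ∑ i, dunklEnd Ω U S c (Pi.single i 1) * dunklEnd Ω U S c (Pi.single i 1) =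
      ∑ i, der Ω U (Pi.single i 1) * der Ω U (Pi.single i 1) -
        ∑ α ∈ posRoots R S, c α • (der Ω U (cx α) * dd Ω U α + dd Ω U α * der Ω U (cx α)) := by
  have hder : ∀ α : R, der Ω U (cx (α : RSpace N)) =
      ∑ i, cx (α : RSpace N) i • der Ω U (Pi.single i 1) := fun α =>
    eq_sum_of_linear (der Ω U) der_add der_smul _
  have e : ∀ i : Fin N, dunklEnd Ω U S c (Pi.single i 1) * dunklEnd Ω U S c (Pi.single i 1) =
      der Ω U (Pi.single i 1) * der Ω U (Pi.single i 1) -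
      ∑ α ∈ posRoots R S, c α • (cx (α : RSpace N) i • (der Ω U (Pi.single i 1) * dd Ω U α +
        dd Ω U α * der Ω U (Pi.single i 1))) +
      ∑ α ∈ posRoots R S, ∑ β ∈ posRoots R S,
        (c α * c β * (cx (α : RSpace N) i * cx (β : RSpace N) i)) • (dd Ω U α * dd Ω U β) := by
    intro i
    have h1 : ∑ α ∈ posRoots R S, c α • (cx (α : RSpace N) i • (der Ω U (Pi.single i 1) * dd Ω U α +
        dd Ω U α * der Ω U (Pi.single i 1))) =
        der Ω U (Pi.single i 1) * (∑ α ∈ posRoots R S, (c α * cx (α : RSpace N) i) • dd Ω U α) +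
        (∑ α ∈ posRoots R S, (c α * cx (α : RSpace N) i) • dd Ω U α) * der Ω U (Pi.single i 1) := by
      rw [Finset.mul_sum, Finset.sum_mul, ← Finset.sum_add_distrib]
      refine Finset.sum_congr rfl fun α _ => ?_
      rw [mul_smul_comm, smul_mul_assoc, smul_smul, smul_add]
    have h2 : ∑ α ∈ posRoots R S, ∑ β ∈ posRoots R S,
        (c α * c β * (cx (α : RSpace N) i * cx (β : RSpace N) i)) • (dd Ω U α * dd Ω U β) =
        (∑ α ∈ posRoots R S, (c α * cx (α : RSpace N) i) • dd Ω U α) *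
        (∑ α ∈ posRoots R S, (c α * cx (α : RSpace N) i) • dd Ω U α) := by
      rw [Finset.sum_mul_sum]
      refine Finset.sum_congr rfl fun α _ => Finset.sum_congr rfl fun β _ => ?_
      rw [smul_mul_smul_comm]
      congr 1
      ring
    rw [h1, h2, dunklEnd]
    simp only [dotProduct_single_one]
    noncomm_ring
  rw [Finset.sum_congr rfl fun i _ => e i, Finset.sum_add_distrib, Finset.sum_sub_distrib]
  have h3 : ∑ i : Fin N, ∑ α ∈ posRoots R S, ∑ β ∈ posRoots R S,
      (c α * c β * (cx (α : RSpace N) i * cx (β : RSpace N) i)) • (dd Ω U α * dd Ω U β) = 0 := by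
    rw [← sum_dd_mul_dd hR hS hc Ω, Finset.sum_comm]
    refine Finset.sum_congr rfl fun α _ => ?_
    rw [Finset.sum_comm]
    refine Finset.sum_congr rfl fun β _ => ?_
    rw [← Finset.sum_smul, ← Finset.mul_sum]
    rfl
  rw [h3, add_zero]
  congr 1
  rw [Finset.sum_comm]
  refine Finset.sum_congr rfl fun α _ => ?_
  rw [← Finset.smul_sum, hder, Finset.sum_mul, Finset.mul_sum, ← Finset.sum_add_distrib]
  congr 1
  refine Finset.sum_congr rfl fun i _ => ?_
  rw [smul_add, smul_mul_assoc, mul_smul_comm]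

/-! ### Polynomials in the Dunkl operators -/

/-- Polynomials in pairwise commuting elements of an algebra. -/
theorem exists_aeval_of_commute {A σ : Type*} [Ring A] [Algebra ℂ A] (T : σ → A)
    (h : ∀ i j, T i * T j = T j * T i) :
    ∃ f : MvPolynomial σ ℂ →ₐ[ℂ] A, ∀ i, f (MvPolynomial.X i) = T i := by
  have := Algebra.isMulCommutative_adjoin ℂ (s := Set.range T) (by
    rintro _ ⟨i, rfl⟩ _ ⟨j, rfl⟩
    exact h i j)
  let : CommRing (Algebra.adjoin ℂ (Set.range T)) := { mul_comm := mul_comm' }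
  let g : MvPolynomial σ ℂ →ₐ[ℂ] Algebra.adjoin ℂ (Set.range T) :=
    MvPolynomial.aeval fun i => ⟨T i, Algebra.subset_adjoin ⟨i, rfl⟩⟩
  refine ⟨(Algebra.adjoin ℂ (Set.range T)).val.comp g, fun i => ?_⟩
  rw [AlgHom.comp_apply, MvPolynomial.aeval_X]
  rfl

theorem dunkl_eqOn {F : AnFun Ω U} {G : CSpace N → U} (h : Set.EqOn F.1 G Ω.carrier)
    (ξ : CSpace N) : Set.EqOn (dunklEnd Ω U S c ξ F).1 (dunkl S c ξ G) Ω.carrier := by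
  intro x hx
  rw [dunklEnd_apply _ _ hx]
  have e : F.1 =ᶠ[𝓝 x] G := by
    filter_upwards [Ω.isOpen.mem_nhds hx] with y hy using h hy
  unfold dunkl
  rw [dirDeriv_congr e]
  congr 1
  refine Finset.sum_congr rfl fun α _ => ?_
  rw [divDiff_congr e (h (Ω.map_mem _ (refl_mem_reflGroup α.2) x hx))]

/-- On `Ω`, the operator `f p` is the `p(∇)` of plain functions. -/
theorem dunklPoly_eqOn {f : Poly N →ₐ[ℂ] Module.End ℂ (AnFun Ω U)}
    (hf : ∀ i, f (MvPolynomial.X i) = dunklEnd Ω U S c (Pi.single i 1)) (p : Poly N)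
    {F : AnFun Ω U} {G : CSpace N → U} (h : Set.EqOn F.1 G Ω.carrier) :
    Set.EqOn (f p F).1 (dunklPoly S c p G) Ω.carrier := by
  have hpow : ∀ (i : Fin N) (k : ℕ) (F : AnFun Ω U) (G : CSpace N → U),
      Set.EqOn F.1 G Ω.carrier → Set.EqOn ((dunklEnd Ω U S c (Pi.single i 1) ^ k) F).1
        ((dunkl S c (Pi.single i 1))^[k] G) Ω.carrier := by
    intro i k
    induction k with
    | zero => intro F G h; exact h
    | succ k ih =>
      intro F G h
      rw [pow_succ, Module.End.mul_apply, Function.iterate_succ_apply]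
      exact ih _ _ (dunkl_eqOn h _)
  have hlist : ∀ (m : Fin N →₀ ℕ) (l : List (Fin N)), Set.EqOn
      (((l.map fun i => dunklEnd Ω U S c (Pi.single i 1) ^ m i).prod) F).1
      (l.foldr (fun i G => (dunkl S c (Pi.single i 1))^[m i] G) G) Ω.carrier := by
    intro m l
    induction l with
    | nil => exact h
    | cons i t ih =>
      rw [List.map_cons, List.prod_cons, Module.End.mul_apply, List.foldr_cons]
      exact hpow i _ _ _ ih
  have hmon : ∀ m a, f (MvPolynomial.monomial m a) =
      a • ((List.finRange N).map fun i => dunklEnd Ω U S c (Pi.single i 1) ^ m i).prod := by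
    intro m a
    rw [MvPolynomial.monomial_eq, Finsupp.prod_fintype _ _ (fun i => pow_zero _), Fin.prod_univ_def,
      map_mul, map_list_prod, MvPolynomial.algHom_C, List.map_map, Algebra.algebraMap_eq_smul_one,
      smul_mul_assoc, one_mul]
    congr 3
    funext i
    rw [Function.comp_apply, map_pow, hf]
  intro x hx
  conv_lhs => rw [p.as_sum, map_sum, LinearMap.sum_apply, AnFun.sum_apply]
  rw [dunklPoly, Finset.sum_apply]
  refine Finset.sum_congr rfl fun m _ => ?_
  rw [hmon, LinearMap.smul_apply, AnFun.smul_apply, Pi.smul_apply, hlist m _ hx]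
  rfl

/-- Equivariance of `p(∇)`; in particular `p(∇)` commutes with the group if `p` is invariant. -/
theorem act_dunklPoly (hR : IsRootSystem R) (hS : IsSimpleSystem R S) (hc : IsInvariantMult c)
    {f : Poly N →ₐ[ℂ] Module.End ℂ (AnFun Ω U)}
    (hf : ∀ i, f (MvPolynomial.X i) = dunklEnd Ω U S c (Pi.single i 1)) (w : reflGroup R)
    (p : Poly N) : act Ω U w * f p = f (polyAct w.1 p) * act Ω U w := by
  have hX : ∀ i, f (polyAct w.1 (MvPolynomial.X i)) = dunklEnd Ω U S c (w.1 (Pi.single i 1)) := by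
    intro i
    rw [eq_sum_of_linear (dunklEnd Ω U S c) dunklEnd_add dunklEnd_smul, polyAct,
      MvPolynomial.aeval_X, map_sum]
    refine Finset.sum_congr rfl fun j _ => ?_
    rw [map_mul, hf, MvPolynomial.algHom_C, Algebra.algebraMap_eq_smul_one, smul_mul_assoc, one_mul]
    congr 1
    have h1 := dot_apply_eq w.2 (Pi.single j (1 : ℂ)) (Pi.single i (1 : ℂ))
    rw [single_one_dotProduct, dotProduct_single_one] at h1
    exact h1.symm
  induction p using MvPolynomial.induction_on with
  | C a =>
    have : polyAct w.1 (MvPolynomial.C a) = MvPolynomial.C a := AlgHom.commutes _ a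
    rw [this, MvPolynomial.algHom_C, Algebra.algebraMap_eq_smul_one, smul_mul_assoc,
      mul_smul_comm, one_mul, mul_one]
  | add p q hp hq => rw [map_add, map_add, map_add, mul_add, add_mul, hp, hq]
  | mul_X p i hp =>
    rw [map_mul, map_mul, map_mul, hX, hf, ← mul_assoc, hp, mul_assoc, act_dunklEnd hR hS hc,
      mul_assoc]

theorem post_dunklPoly {f : Poly N →ₐ[ℂ] Module.End ℂ (AnFun Ω U)}
    (hf : ∀ i, f (MvPolynomial.X i) = dunklEnd Ω U S c (Pi.single i 1)) (L : Module.End ℂ U)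
    (p : Poly N) : post Ω L * f p = f p * post Ω L := by
  induction p using MvPolynomial.induction_on with
  | C a =>
    rw [MvPolynomial.algHom_C, Algebra.algebraMap_eq_smul_one, smul_mul_assoc,
      mul_smul_comm, one_mul, mul_one]
  | add p q hp hq => rw [map_add, mul_add, add_mul, hp, hq]
  | mul_X p i hp => rw [map_mul, hf, ← mul_assoc, hp, mul_assoc, post_dunklEnd, mul_assoc]

/-- A subspace stable under the Dunkl operators is stable under polynomials in them. -/
theorem dunklPoly_mem {f : Poly N →ₐ[ℂ] Module.End ℂ (AnFun Ω U)}
    (hf : ∀ i, f (MvPolynomial.X i) = dunklEnd Ω U S c (Pi.single i 1))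
    {I : Submodule ℂ (AnFun Ω U)} (hI : ∀ ξ, ∀ F ∈ I, dunklEnd Ω U S c ξ F ∈ I) (p : Poly N) :
    ∀ F ∈ I, f p F ∈ I := by
  induction p using MvPolynomial.induction_on with
  | C a =>
    intro F hF
    rw [MvPolynomial.algHom_C, Algebra.algebraMap_eq_smul_one]
    exact I.smul_mem a hF
  | add p q hp hq => intro F hF; rw [map_add]; exact I.add_mem (hp F hF) (hq F hF)
  | mul_X p i hp =>
    intro F hF
    rw [map_mul, hf]
    exact hp _ (hI _ F hF)

end Dunkl

section Stratum

variable {N : ℕ} {U : Type*} [AddCommGroup U] [Module ℂ U] {R S Γ₀ : Finset (RSpace N)}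
variable {Ω : InvOpen R} {c : R → ℂ}

/-! ### The invariance condition on the multiplicities -/

theorem anAt_eval (p : Poly N) (x : CSpace N) :
    AnAt (fun y : CSpace N => MvPolynomial.eval y p) x := by
  have h : AnalyticAt ℂ (fun y : CSpace N => MvPolynomial.eval y p) x :=
    AnalyticAt.aeval_mvPolynomial (f := fun y : CSpace N => y) (fun i =>
      (ContinuousLinearMap.proj (R := ℂ) (φ := fun _ : Fin N => ℂ) i).analyticAt x) p
  simpa using anAt_smul_const h (1 : ℂ)

theorem hasDirDeriv_eval (ξ x : CSpace N) (p : Poly N) :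
    HasDirDeriv ξ (fun y : CSpace N => MvPolynomial.eval y p) x
      (∑ i, ξ i * MvPolynomial.eval x (MvPolynomial.pderiv i p)) := by
  induction p using MvPolynomial.induction_on with
  | C a =>
    intro φ
    simpa using hasDerivAt_const (0 : ℂ) (φ a)
  | add p q hp hq =>
    simp only [map_add, mul_add, Finset.sum_add_distrib]
    exact hp.add hq
  | mul_X p k hp =>
    have h := hp.dot_smul (Pi.single k (1 : ℂ))
    simp only [single_one_dotProduct, smul_eq_mul] at h
    convert h using 1
    · funext y
      rw [map_mul, MvPolynomial.eval_X, mul_comm]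
    · simp only [Derivation.leibniz, MvPolynomial.pderiv_X, smul_eq_mul, map_add, map_mul,
        MvPolynomial.eval_X, mul_add, Finset.sum_add_distrib, Finset.mul_sum]
      congr 1
      · rw [Finset.sum_eq_single k]
        · simp
        · intro i _ hik; simp [hik.symm]
        · simp
      · exact Finset.sum_congr rfl fun i _ => by ring

theorem eval_linForm (α : RSpace N) (x : CSpace N) :
    MvPolynomial.eval x (linForm α) = cx α ⬝ᵥ x := by
  simp [linForm, dotProduct]

theorem linForm_ne_zero {α : RSpace N} (h : α ≠ 0) : linForm α ≠ 0 := by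
  intro h0
  apply cx_dot_self_ne_zero h
  rw [← eval_linForm, h0, map_zero]

theorem eval_polyDivDiff {α : RSpace N} (hα : α ≠ 0) (p : Poly N) (x : CSpace N) :
    MvPolynomial.eval x (polyDivDiff α p) =
      divDiff α (fun y : CSpace N => MvPolynomial.eval y p) x := by
  have hne := linForm_ne_zero hα
  have hspec : ∀ y : CSpace N, (cx α ⬝ᵥ y) * MvPolynomial.eval y (polyDivDiff α p) =
      MvPolynomial.eval y p - MvPolynomial.eval (refl α y) p := by
    intro y
    have h1 : linForm α * polyDivDiff α p = p - polyAct (refl α) p := by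
      simp only [polyDivDiff, LinearMap.coe_mk, AddHom.coe_mk, if_neg hne]
      exact (linForm_dvd α p).choose_spec.symm
    have := congrArg (MvPolynomial.eval y) h1
    rwa [map_mul, map_sub, eval_polyAct, eval_linForm, refl_inv] at this
  by_cases hx : cx α ⬝ᵥ x = 0
  · exact (divDiff_eq_of_quotient hα hx (anAt_eval p x) (anAt_eval (polyDivDiff α p) x)
      (Eventually.of_forall hspec)).symm
  · rw [divDiff_of_ne hx, ← hspec, smul_eq_mul, inv_mul_cancel_left₀ hx]

theorem eval_polyDunkl (hR : IsRootSystem R) (ξ : CSpace N) (p : Poly N) (x : CSpace N) :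
    MvPolynomial.eval x (polyDunkl S c ξ p) =
      dunkl S c ξ (fun y : CSpace N => MvPolynomial.eval y p) x := by
  rw [dunkl, (hasDirDeriv_eval ξ x p).dirDeriv_eq, polyDunkl, LinearMap.sub_apply,
    LinearMap.sum_apply, LinearMap.sum_apply, map_sub, map_sum, map_sum]
  congr 1
  · refine Finset.sum_congr rfl fun i _ => ?_
    rw [LinearMap.smul_apply, MvPolynomial.smul_eval]
    rfl
  · refine Finset.sum_congr rfl fun α _ => ?_
    rw [LinearMap.smul_apply, MvPolynomial.smul_eval, eval_polyDivDiff (hR.ne_zero α.2), smul_eq_mul]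

open Classical in
/-- The vector `ξ - ∑ 2 c_α (α, ξ) / (α, α) α`, the sum being over the positive roots `α` that are
orthogonal to `π`. On functions vanishing on the stratum, the operator `∇_ξ` is the derivative in
the direction of this vector. -/
def residue (S Γ₀ : Finset (RSpace N)) (c : R → ℂ) (ξ : CSpace N) : CSpace N :=
  ξ - ∑ α ∈ posRoots R S, (if proj Γ₀ (α : RSpace N) = 0 then
    (c α * (cx (α : RSpace N) ⬝ᵥ ξ)) * (2 / (cx (α : RSpace N) ⬝ᵥ cx α)) else 0) • cx (α : RSpace N)

/-- For a function vanishing along the orbit of a generic point of `π`, the divided differences of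
the roots not orthogonal to `π` vanish there and the others are normal derivatives. -/
theorem dunkl_eq_residue {F : CSpace N → U} {x : CSpace N} (hF : AnAt F x)
    (hx : IsGeneric R Γ₀ x) (h0 : F x = 0) (h1 : ∀ α ∈ R, F (refl α x) = 0) (ξ : CSpace N) :
    dunkl S c ξ F x = dirDeriv (residue S Γ₀ c ξ) F x := by
  let L : CSpace N →ₗ[ℂ] U :=
    { toFun := fun ξ => dirDeriv ξ F x
      map_add' := hF.dirDeriv_add_vec
      map_smul' := hF.dirDeriv_smul_vec }
  change _ = L _
  rw [residue, map_sub, map_sum, dunkl]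
  congr 1
  refine Finset.sum_congr rfl fun α _ => ?_
  rw [map_smul]
  split_ifs with h
  · rw [divDiff_of_eq ((hx.proj_eq_zero_iff α.2).1 h), smul_smul]
    rfl
  · rw [divDiff_of_ne (fun h' => h ((hx.proj_eq_zero_iff α.2).2 h')), h0, h1 α α.2, sub_zero,
      smul_zero, smul_zero, zero_smul]

/-- Invariance of the ideal of the stratum forces the vectors `residue` to lie in `π`: it suffices
to apply `∇_ξ` to polynomials vanishing on the stratum whose differential at the generic point is a
given root `β` in `Γ₀`. -/
theorem residue_mem_plane (hR : IsRootSystem R) (hΓ : Γ₀ ⊆ R)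
    (hinv : IsInvariantParabolic S Γ₀ c) {x : CSpace N} (hx : IsGeneric R Γ₀ x) (ξ : CSpace N) :
    residue S Γ₀ c ξ ∈ plane Γ₀ := by
  classical
  intro β hβ
  have hex : ∀ w : CSpace N ≃ₗ[ℂ] CSpace N, w x ∉ plane Γ₀ →
      ∃ b ∈ Γ₀, cx b ⬝ᵥ w x ≠ 0 := by
    intro w hw
    by_contra! hc
    exact hw hc
  choose! b hb hbx using hex
  -- `Q` vanishes on the sheets of the stratum that do not contain `x`, but not at `x`.
  set Q : Poly N := ∏ w ∈ hR.finite_reflGroup.toFinset,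
    if w x ∈ plane Γ₀ then 1 else polyAct w⁻¹ (linForm (b w)) with hQ
  have hQx : MvPolynomial.eval x Q ≠ 0 := by
    rw [hQ, map_prod, Finset.prod_ne_zero_iff]
    intro w _
    split_ifs with h
    · simp
    · rw [eval_polyAct, eval_linForm, inv_inv]; exact hbx w h
  have hvan : ∀ y ∈ stratum R Γ₀, MvPolynomial.eval y (linForm β * Q) = 0 := by
    intro y hy
    obtain ⟨w, hw, hwy⟩ := mem_stratum.1 hy
    rw [map_mul]
    by_cases hwx : w x ∈ plane Γ₀
    · rw [eval_linForm, ((hx.map_mem hR hΓ hw hwx y).1 hwy) β hβ, zero_mul]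
    · have : MvPolynomial.eval y Q = 0 := by
        rw [hQ, map_prod]
        refine Finset.prod_eq_zero (i := w) ((Set.Finite.mem_toFinset _).2 hw) ?_
        rw [if_neg hwx, eval_polyAct, eval_linForm, inv_inv]
        exact hwy _ (hb w hwx)
      rw [this, mul_zero]
  have hmem : linForm β * Q ∈ MvPolynomial.vanishingIdeal ℂ (stratum R Γ₀) := by
    intro y hy
    rw [MvPolynomial.aeval_eq_eval]
    exact hvan y hy
  have hxD : x ∈ stratum R Γ₀ := plane_subset_stratum hx.1
  have h1 := hinv (polyDunkl S c ξ) (Algebra.subset_adjoin (Or.inr ⟨ξ, rfl⟩)) _ hmem x hxD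
  rw [MvPolynomial.aeval_eq_eval] at h1
  change MvPolynomial.eval x _ = 0 at h1
  rw [eval_polyDunkl hR, dunkl_eq_residue (anAt_eval _ x) hx (hvan x hxD)
    (fun α hα => hvan _ (map_mem_stratum (refl_mem_reflGroup hα) hxD))] at h1
  have h2 := ((hasDirDeriv_eval (residue S Γ₀ c ξ) x Q).dot_smul (cx β)).dirDeriv_eq
  have h3 : (fun y : CSpace N => MvPolynomial.eval y (linForm β * Q)) =
      fun y => (cx β ⬝ᵥ y) • MvPolynomial.eval y Q := by
    funext y
    rw [map_mul, eval_linForm, smul_eq_mul]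
  rw [h3, h2, hx.1 β hβ, zero_smul, add_zero, smul_eq_mul] at h1
  exact (mul_eq_zero.1 h1).resolve_right hQx

/-! ### Functions vanishing on the stratum -/

/-- The analytic functions on `Ω` that vanish on the stratum. -/
def vanishing (Ω : InvOpen R) (U : Type*) [AddCommGroup U] [Module ℂ U]
    (Γ₀ : Finset (RSpace N)) : Submodule ℂ (AnFun Ω U) where
  carrier := {F | ∀ x ∈ Ω.carrier, x ∈ stratum R Γ₀ → F.1 x = 0}
  add_mem' := fun {F G} hF hG x hx hD => by
    rw [AnFun.add_apply, hF x hx hD, hG x hx hD, add_zero]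
  zero_mem' := fun _ _ _ => rfl
  smul_mem' := fun t F hF x hx hD => by
    rw [AnFun.smul_apply, hF x hx hD, smul_zero]

theorem act_mem_vanishing (w : reflGroup R) {F : AnFun Ω U} (hF : F ∈ vanishing Ω U Γ₀) :
    act Ω U w F ∈ vanishing Ω U Γ₀ := fun x hx hD => by
  rw [act_apply]
  exact hF _ ((Ω.inv_mem w).2 hx) (map_mem_stratum (Subgroup.inv_mem _ w.2) hD)

/-- The Dunkl operators preserve the analytic functions vanishing on the stratum: at points of `π`
they differentiate along `π` by `residue_mem_plane`, and equivariance gives the other sheets. -/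
theorem dunklEnd_mem_vanishing (hR : IsRootSystem R) (hS : IsSimpleSystem R S) (hΓ : Γ₀ ⊆ R)
    (hc : IsInvariantMult c) (hinv : IsInvariantParabolic S Γ₀ c)
    (hΩ : ∀ x ∈ Ω.carrier, OrbitGeneric R Γ₀ x) (ξ : CSpace N) :
    ∀ F ∈ vanishing Ω U Γ₀, dunklEnd Ω U S c ξ F ∈ vanishing Ω U Γ₀ := by
  have key : ∀ F ∈ vanishing Ω U Γ₀, ∀ ξ, ∀ z ∈ Ω.carrier, IsGeneric R Γ₀ z →
      (dunklEnd Ω U S c ξ F).1 z = 0 := by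
    intro F hF ξ z hz hg
    have hD := plane_subset_stratum (R := R) hg.1
    rw [dunklEnd_apply _ _ hz, dunkl_eq_residue (Γ₀ := Γ₀) (anFun_anAt F hz) hg (hF z hz hD)
      (fun α hα => hF _ (Ω.map_mem _ (refl_mem_reflGroup hα) z hz)
        (map_mem_stratum (refl_mem_reflGroup hα) hD))]
    rw [dirDeriv_congr_line (G := fun _ => (0 : U)), dirDeriv_const]
    filter_upwards [(tendsto_line (residue S Γ₀ c ξ) z).eventually (Ω.isOpen.mem_nhds hz)]
      with t ht
    refine hF _ ht (plane_subset_stratum ?_)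
    exact add_mem hg.1 (Submodule.smul_mem _ t (residue_mem_plane hR hΓ hinv hg ξ))
  intro F hF x hx hD
  obtain ⟨w, hw, hwx⟩ := mem_stratum.1 hD
  have h1 := key _ (act_mem_vanishing ⟨w, hw⟩ hF) (w ξ) (w x) (Ω.map_mem w hw x hx)
    (hΩ x hx w hw hwx)
  have h2 := LinearMap.congr_fun (act_dunklEnd (Ω := Ω) (U := U) hR hS hc ⟨w, hw⟩ ξ) F
  rw [Module.End.mul_apply, Module.End.mul_apply] at h2
  rw [← h2, act_apply] at h1
  have e : (w⁻¹ : CSpace N ≃ₗ[ℂ] CSpace N) (w x) = x := w.symm_apply_apply x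
  rwa [e] at h1

end Stratum

section Restriction

variable {N : ℕ} {U : Type*} [AddCommGroup U] [Module ℂ U] {R S Γ₀ : Finset (RSpace N)}
variable {Ω : InvOpen R} {c : R → ℂ} {ρ : Representation ℂ (reflGroup R)ᵐᵒᵖ U} {x₀ : CSpace N}

/-! ### Invariant germs and their extensions -/

theorem diagAct_mul (u w : reflGroup R) (F : CSpace N → U) :
    diagAct ρ (u * w) F = diagAct ρ u (diagAct ρ w F) := by
  funext y
  simp only [diagAct, _root_.mul_inv_rev, MulOpposite.op_mul, map_mul, Module.End.mul_apply]
  rfl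

theorem diagAct_one (F : CSpace N → U) : diagAct ρ 1 F = F := by
  funext y
  simp only [diagAct, inv_one, MulOpposite.op_one, map_one, Module.End.one_apply]
  rfl

theorem diagAct_eventuallyEq (w : reflGroup R) {F G : CSpace N → U} {x : CSpace N}
    (h : F =ᶠ[𝓝[stratum R Γ₀] x] G) :
    diagAct ρ w F =ᶠ[𝓝[stratum R Γ₀] (w.1 x)] diagAct ρ w G := by
  have hx : (w.1⁻¹ : CSpace N ≃ₗ[ℂ] CSpace N) (w.1 x) = x := w.1.symm_apply_apply x
  have ht : Tendsto (w.1⁻¹ : CSpace N ≃ₗ[ℂ] CSpace N) (𝓝[stratum R Γ₀] (w.1 x))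
      (𝓝[stratum R Γ₀] x) := by
    refine tendsto_nhdsWithin_of_tendsto_nhds_of_eventually_within _ ?_ ?_
    · have := (continuous_equiv (w.1⁻¹)).tendsto (w.1 x)
      rw [hx] at this
      exact this.mono_left nhdsWithin_le_nhds
    · filter_upwards [self_mem_nhdsWithin] with y hy
      exact map_mem_stratum (Subgroup.inv_mem _ w.2) hy
  filter_upwards [ht.eventually h] with y hy
  exact congrArg _ hy

theorem AnAt.diagAct {F : CSpace N → U} {x : CSpace N} (h : AnAt F x) (w : reflGroup R) :
    AnAt (diagAct ρ w F) (w.1 x) := by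
  have hx : (w.1⁻¹ : CSpace N ≃ₗ[ℂ] CSpace N) (w.1 x) = x := w.1.symm_apply_apply x
  exact (AnAt.comp_equiv (w.1⁻¹) (by rwa [hx])).postcomp _

theorem AnAt.mem_analyticGerms {F : CSpace N → U} {x : CSpace N} (h : AnAt F x)
    (D : Set (CSpace N)) : (F : Germ (𝓝[D] x) U) ∈ analyticGerms U (𝓝[D] x) x := by
  obtain ⟨n, f, u, hf, e⟩ := anAt_iff.1 h
  exact mem_analyticGerms_iff.2 ⟨n, f, u, hf, Germ.coe_eq.2 (e.filter_mono nhdsWithin_le_nhds)⟩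

theorem exists_anAt_of_mem {x : CSpace N} {D : Set (CSpace N)} {g : Germ (𝓝[D] x) U}
    (h : g ∈ analyticGerms U (𝓝[D] x) x) :
    ∃ F : CSpace N → U, AnAt F x ∧ (F : Germ (𝓝[D] x) U) = g := by
  obtain ⟨n, f, u, hf, e⟩ := mem_analyticGerms_iff.1 h
  exact ⟨_, anAt_iff.2 ⟨n, f, u, hf, EventuallyEq.rfl⟩, e.symm⟩

/-- Every analytic extension near `x₀` of an invariant germ is the restriction to a neighbourhood
of `x₀` of a function representing the germ. The translates of the extension are glued along the
orbit; the choice of the translating elements does not matter on the stratum, because the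
stabilizer of `x₀` is `W₀`. -/
theorem exists_represents (hR : IsRootSystem R) (hS : IsSimpleSystem R S) (hΓ : Γ₀ ⊆ S)
    (hx₀ : IsGeneric R Γ₀ x₀) (g : invGerms Γ₀ ρ x₀) {h : CSpace N → U} (hh : AnAt h x₀)
    (hg : (h : Germ (𝓝[stratum R Γ₀] x₀) U) = g) :
    ∃ F, Represents Γ₀ ρ x₀ F g ∧ F =ᶠ[𝓝 x₀] h := by
  classical
  -- Elements fixing `x₀` lie in `W₀` and preserve the germ.
  have hstab : ∀ u : reflGroup R, u.1 x₀ = x₀ →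
      diagAct ρ u h =ᶠ[𝓝[stratum R Γ₀] x₀] h := by
    intro u hu
    obtain ⟨-, F, hF, hinv⟩ := g.2
    have e : F =ᶠ[𝓝[stratum R Γ₀] x₀] h := Germ.coe_eq.1 (hF.trans hg.symm)
    have e' := diagAct_eventuallyEq (ρ := ρ) u e
    rw [hu] at e'
    exact e'.symm.trans ((hinv u (hx₀.stabilizer hR hS hΓ u.2 hu)).trans e)
  have hfin : (orbit R x₀).Finite := hR.finite_reflGroup.image fun w : CSpace N ≃ₗ[ℂ] CSpace N => w x₀
  have hω : ∀ x, ∃ w : reflGroup R, (x ∈ orbit R x₀ → w.1 x₀ = x) ∧ (x = x₀ → w = 1) := by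
    intro x
    by_cases hx : x = x₀
    · exact ⟨1, fun _ => hx.symm, fun _ => rfl⟩
    · by_cases hxo : x ∈ orbit R x₀
      · obtain ⟨w, hw, hwx⟩ := hxo
        exact ⟨⟨w, hw⟩, fun _ => hwx, fun h => absurd h hx⟩
      · exact ⟨1, fun h => absurd h hxo, fun _ => rfl⟩
  choose ω hω hω₁ using hω
  obtain ⟨F, hF⟩ := exists_glue hfin (0 : U) fun x => diagAct ρ (ω x) h
  -- On the stratum every translate agrees with the glued function, not only the chosen ones.
  have hFw : ∀ w : reflGroup R, F =ᶠ[𝓝[stratum R Γ₀] (w.1 x₀)] diagAct ρ w h := by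
    intro w
    have hmem : w.1 x₀ ∈ orbit R x₀ := ⟨w.1, w.2, rfl⟩
    refine ((hF _ hmem).filter_mono nhdsWithin_le_nhds).trans ?_
    have hu : ((ω (w.1 x₀))⁻¹ * w).1 x₀ = x₀ := by
      change ((ω (w.1 x₀)).1.symm) (w.1 x₀) = x₀
      rw [LinearEquiv.symm_apply_eq]
      exact (hω _ hmem).symm
    have e := diagAct_eventuallyEq (ρ := ρ) (ω (w.1 x₀)) (hstab _ hu)
    rw [← diagAct_mul, mul_inv_cancel_left, hω _ hmem] at e
    exact e.symm
  have hx₀o : x₀ ∈ orbit R x₀ := ⟨1, one_mem _, rfl⟩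
  have hFx₀ : F =ᶠ[𝓝 x₀] h := by
    have := hF x₀ hx₀o
    rwa [hω₁ x₀ rfl, diagAct_one] at this
  refine ⟨F, ⟨fun x hx => ?_, fun w x hx => ?_, ?_⟩, hFx₀⟩
  · have h1 : AnAt (diagAct ρ (ω x) h) x := by
      have := hh.diagAct (ρ := ρ) (ω x)
      rwa [hω x hx] at this
    exact h1.congr (hF x hx).symm
  · obtain ⟨v, hv, rfl⟩ := hx
    have e := diagAct_eventuallyEq (ρ := ρ) w (hFw (w⁻¹ * ⟨v, hv⟩))
    have hx : w.1 ((w⁻¹ * ⟨v, hv⟩ : reflGroup R).1 x₀) = v x₀ := w.1.apply_symm_apply (v x₀)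
    rw [hx, ← diagAct_mul, mul_inv_cancel_left] at e
    exact e.trans (hFw ⟨v, hv⟩).symm
  · rw [← hg]
    exact Germ.coe_eq.2 (hFx₀.filter_mono nhdsWithin_le_nhds)

theorem exists_represents_germ {F : CSpace N → U} (ha : ∀ x ∈ orbit R x₀, AnAt F x)
    (hi : ∀ w : reflGroup R, ∀ x ∈ orbit R x₀, diagAct ρ w F =ᶠ[𝓝[stratum R Γ₀] x] F) :
    ∃ g, Represents Γ₀ ρ x₀ F g := by
  have hx₀o : x₀ ∈ orbit R x₀ := ⟨1, one_mem _, rfl⟩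
  exact ⟨⟨F, (ha x₀ hx₀o).mem_analyticGerms _, F, rfl, fun w _ => hi w x₀ hx₀o⟩, ha, hi, rfl⟩

theorem exists_represents_of_germ (hR : IsRootSystem R) (hS : IsSimpleSystem R S) (hΓ : Γ₀ ⊆ S)
    (hx₀ : IsGeneric R Γ₀ x₀) (g : invGerms Γ₀ ρ x₀) : ∃ F, Represents Γ₀ ρ x₀ F g := by
  obtain ⟨h, hh, hg⟩ := exists_anAt_of_mem g.2.1
  obtain ⟨F, hF, -⟩ := exists_represents hR hS hΓ hx₀ g hh hg
  exact ⟨F, hF⟩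

theorem Represents.germ_unique {F : CSpace N → U} {g g' : invGerms Γ₀ ρ x₀}
    (h : Represents Γ₀ ρ x₀ F g) (h' : Represents Γ₀ ρ x₀ F g') : g = g' :=
  Subtype.ext (h.germ_eq.symm.trans h'.germ_eq)

/-- A neighbourhood property of the orbit holds on an invariant open set of points with generic
orbit. -/
theorem exists_invOpen (hR : IsRootSystem R) (hΓ : Γ₀ ⊆ R) (hx₀ : IsGeneric R Γ₀ x₀)
    {P : CSpace N → Prop} (h : ∀ x ∈ orbit R x₀, ∀ᶠ y in 𝓝 x, P y) :
    ∃ Ω : InvOpen R, x₀ ∈ Ω.carrier ∧ (∀ y ∈ Ω.carrier, OrbitGeneric R Γ₀ y) ∧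
      ∀ y ∈ Ω.carrier, P y := by
  obtain ⟨O, hO, hx, hW, hP⟩ := hR.exists_invariant_open (x := x₀)
    (P := fun y => OrbitGeneric R Γ₀ y ∧ P y) fun w hw =>
      (((hx₀.orbitGeneric hR hΓ).map hw).eventually hR).and (h _ ⟨w, hw, rfl⟩)
  exact ⟨⟨O, hO, hW⟩, hx, fun y hy => (hP y hy).1, fun y hy => (hP y hy).2⟩

theorem mem_of_mem_orbit (hx : x₀ ∈ Ω.carrier) {x : CSpace N} (h : x ∈ orbit R x₀) :
    x ∈ Ω.carrier := by
  obtain ⟨w, hw, rfl⟩ := h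
  exact Ω.map_mem w hw _ hx

theorem Represents.eventually (hR : IsRootSystem R) {F : CSpace N → U} {g : invGerms Γ₀ ρ x₀}
    (h : Represents Γ₀ ρ x₀ F g) {x : CSpace N} (hx : x ∈ orbit R x₀) :
    ∀ᶠ y in 𝓝 x, AnAt F y ∧ ∀ w : reflGroup R, y ∈ stratum R Γ₀ → diagAct ρ w F y = F y := by
  have : Finite (reflGroup R) := hR.finite_reflGroup.to_subtype
  exact (AnAt.eventually (h.analytic x hx)).and
    (Filter.eventually_all.2 fun w => eventually_nhdsWithin_iff.1 (h.invariant w x hx))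

/-- Linear relations between germs at `x₀` propagate along the orbit. -/
theorem Represents.eventually_linear {F₁ F₂ F₃ : CSpace N → U} {g₁ g₂ : invGerms Γ₀ ρ x₀} {a : ℂ}
    (h₁ : Represents Γ₀ ρ x₀ F₁ g₁) (h₂ : Represents Γ₀ ρ x₀ F₂ g₂)
    (h₃ : Represents Γ₀ ρ x₀ F₃ (a • g₁ + g₂)) {x : CSpace N} (hx : x ∈ orbit R x₀) :
    ∀ᶠ y in 𝓝[stratum R Γ₀] x, F₃ y = a • F₁ y + F₂ y := by
  have e : F₃ =ᶠ[𝓝[stratum R Γ₀] x₀] a • F₁ + F₂ := by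
    refine Germ.coe_eq.1 (h₃.germ_eq.trans ?_)
    rw [Submodule.coe_add, Submodule.coe_smul, ← h₁.germ_eq, ← h₂.germ_eq]
    rfl
  have hx' := hx
  obtain ⟨w, hw, rfl⟩ := hx
  filter_upwards [diagAct_eventuallyEq (ρ := ρ) ⟨w, hw⟩ e, h₁.invariant ⟨w, hw⟩ _ hx',
    h₂.invariant ⟨w, hw⟩ _ hx', h₃.invariant ⟨w, hw⟩ _ hx'] with y e0 e1 e2 e3
  rw [← e1, ← e2, ← e3, e0]
  simp [diagAct]

/-! ### Restriction of invariant Dunkl operators to the stratum -/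

/-- The Dunkl operators on `Ω` can be substituted into polynomials, since they commute. -/
theorem exists_dunklAlg (hR : IsRootSystem R) (hS : IsSimpleSystem R S) (hc : IsInvariantMult c)
    (Ω : InvOpen R) (U : Type*) [AddCommGroup U] [Module ℂ U] :
    ∃ f : Poly N →ₐ[ℂ] Module.End ℂ (AnFun Ω U),
      ∀ i, f (MvPolynomial.X i) = dunklEnd Ω U S c (Pi.single i 1) :=
  exists_aeval_of_commute _ fun _ _ => dunklEnd_comm hR hS hc Ω _ _

/-- `p(∇)` respects linear relations between the germs on the stratum: as it preserves the
functions vanishing on the stratum, it does not depend on the extensions. -/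
theorem Represents.dunklPoly_linear (hR : IsRootSystem R) (hS : IsSimpleSystem R S)
    (hΓ : Γ₀ ⊆ R) (hc : IsInvariantMult c) (hinv : IsInvariantParabolic S Γ₀ c)
    (hx₀ : IsGeneric R Γ₀ x₀) (p : Poly N)
    {F₁ F₂ F₃ : CSpace N → U} {g₁ g₂ g₁' g₂' g₃' : invGerms Γ₀ ρ x₀} {a : ℂ}
    (h₁ : Represents Γ₀ ρ x₀ F₁ g₁) (h₂ : Represents Γ₀ ρ x₀ F₂ g₂)
    (h₃ : Represents Γ₀ ρ x₀ F₃ (a • g₁ + g₂))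
    (h₁' : Represents Γ₀ ρ x₀ (dunklPoly S c p F₁) g₁')
    (h₂' : Represents Γ₀ ρ x₀ (dunklPoly S c p F₂) g₂')
    (h₃' : Represents Γ₀ ρ x₀ (dunklPoly S c p F₃) g₃') : g₃' = a • g₁' + g₂' := by
  obtain ⟨Ω, hxΩ, hgen, hP⟩ := exists_invOpen hR hΓ hx₀
    (P := fun y => AnAt F₁ y ∧ AnAt F₂ y ∧ AnAt F₃ y ∧
      (y ∈ stratum R Γ₀ → F₃ y = a • F₁ y + F₂ y)) fun x hx => by
    filter_upwards [AnAt.eventually (h₁.analytic x hx), AnAt.eventually (h₂.analytic x hx),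
      AnAt.eventually (h₃.analytic x hx),
      eventually_nhdsWithin_iff.1 (h₁.eventually_linear h₂ h₃ hx)] with y e1 e2 e3 e4
    exact ⟨e1, e2, e3, e4⟩
  obtain ⟨f, hf⟩ := exists_dunklAlg hR hS hc Ω U
  let G₁ : AnFun Ω U := cut Ω F₁ fun y hy => (hP y hy).1
  let G₂ : AnFun Ω U := cut Ω F₂ fun y hy => (hP y hy).2.1
  let G₃ : AnFun Ω U := cut Ω F₃ fun y hy => (hP y hy).2.2.1
  have hmem : G₃ - (a • G₁ + G₂) ∈ vanishing Ω U Γ₀ := by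
    intro y hy hD
    rw [AnFun.sub_apply, AnFun.add_apply, AnFun.smul_apply, cut_apply hy, cut_apply hy,
      cut_apply hy, (hP y hy).2.2.2 hD, sub_self]
  have hmem' := dunklPoly_mem hf (dunklEnd_mem_vanishing hR hS hΓ hc hinv hgen) p _ hmem
  rw [map_sub, map_add, map_smul] at hmem'
  apply Subtype.ext
  rw [Submodule.coe_add, Submodule.coe_smul, ← h₁'.germ_eq, ← h₂'.germ_eq, ← h₃'.germ_eq]
  suffices e : dunklPoly S c p F₃ =ᶠ[𝓝[stratum R Γ₀] x₀]
      a • dunklPoly S c p F₁ + dunklPoly S c p F₂ from Germ.coe_eq.2 e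
  filter_upwards [self_mem_nhdsWithin, mem_nhdsWithin_of_mem_nhds (Ω.isOpen.mem_nhds hxΩ)]
    with y hD hy
  have h := hmem' y hy hD
  rw [AnFun.sub_apply, AnFun.add_apply, AnFun.smul_apply,
    dunklPoly_eqOn hf p (fun z hz => cut_apply hz) hy,
    dunklPoly_eqOn hf p (fun z hz => cut_apply hz) hy,
    dunklPoly_eqOn hf p (fun z hz => cut_apply hz) hy] at h
  exact sub_eq_zero.1 h

/-- For invariant `p`, the restriction of `p(∇) F` to the stratum is again invariant. -/
theorem Represents.exists_dunklPoly (hR : IsRootSystem R) (hS : IsSimpleSystem R S)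
    (hΓ : Γ₀ ⊆ R) (hc : IsInvariantMult c) (hinv : IsInvariantParabolic S Γ₀ c)
    (hx₀ : IsGeneric R Γ₀ x₀) (p : invPoly R) {F : CSpace N → U} {g : invGerms Γ₀ ρ x₀}
    (h : Represents Γ₀ ρ x₀ F g) : ∃ g', Represents Γ₀ ρ x₀ (dunklPoly S c p F) g' := by
  obtain ⟨Ω, hxΩ, hgen, hP⟩ := exists_invOpen hR hΓ hx₀ fun x hx => h.eventually hR hx
  obtain ⟨f, hf⟩ := exists_dunklAlg hR hS hc Ω U
  let G : AnFun Ω U := cut Ω F fun y hy => (hP y hy).1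
  have hG : Set.EqOn (f p G).1 (dunklPoly S c p F) Ω.carrier :=
    dunklPoly_eqOn hf _ fun z hz => cut_apply hz
  refine exists_represents_germ (fun x hx => ?_) fun w x hx => ?_
  · have hx' := mem_of_mem_orbit hxΩ hx
    refine (anFun_anAt (f p G) hx').congr ?_
    filter_upwards [Ω.isOpen.mem_nhds hx'] with y hy using hG hy
  · have hx' := mem_of_mem_orbit hxΩ hx
    have hmem : post Ω (ρ (MulOpposite.op w⁻¹)) (act Ω U w G) - G ∈ vanishing Ω U Γ₀ := by
      intro y hy hD
      rw [AnFun.sub_apply, post_apply, act_apply, cut_apply hy, cut_apply ((Ω.inv_mem w).2 hy),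
        sub_eq_zero]
      exact (hP y hy).2 w hD
    have hmem' := dunklPoly_mem hf (dunklEnd_mem_vanishing hR hS hΓ hc hinv hgen) p _ hmem
    have e1 := LinearMap.congr_fun (post_dunklPoly hf (ρ (MulOpposite.op w⁻¹)) p) (act Ω U w G)
    have e2 := LinearMap.congr_fun (act_dunklPoly hR hS hc hf w p) G
    rw [p.2 w.1 w.2] at e2
    rw [Module.End.mul_apply, Module.End.mul_apply] at e1 e2
    rw [map_sub, ← e1, ← e2] at hmem'
    filter_upwards [self_mem_nhdsWithin, mem_nhdsWithin_of_mem_nhds (Ω.isOpen.mem_nhds hx')]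
      with y hD hy
    have h1 := hmem' y hy hD
    rw [AnFun.sub_apply, post_apply, act_apply, hG hy, hG ((Ω.inv_mem w).2 hy)] at h1
    exact sub_eq_zero.1 h1

theorem exists_isRestriction (hR : IsRootSystem R) (hS : IsSimpleSystem R S)
    (hΓ : Γ₀ ⊆ S) (hc : IsInvariantMult c) (hinv : IsInvariantParabolic S Γ₀ c)
    (hx₀ : IsGeneric R Γ₀ x₀) (p : invPoly R) :
    ∃ T : Module.End ℂ (invGerms Γ₀ ρ x₀), IsRestriction S Γ₀ c ρ x₀ p T := by
  have hΓR := hΓ.trans hS.subset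
  choose F hF using fun g : invGerms Γ₀ ρ x₀ => exists_represents_of_germ hR hS hΓ hx₀ g
  choose T hT using fun g => (hF g).exists_dunklPoly hR hS hΓR hc hinv hx₀ p
  have hlin : ∀ (a : ℂ) (g₁ g₂ : invGerms Γ₀ ρ x₀), T (a • g₁ + g₂) = a • T g₁ + T g₂ :=
    fun a g₁ g₂ => (hF g₁).dunklPoly_linear hR hS hΓR hc hinv hx₀ p (hF g₂) (hF _) (hT g₁) (hT g₂)
      (hT _)
  have h0 : T 0 = 0 := by simpa using hlin 1 0 0
  refine ⟨{ toFun := T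
            map_add' := fun g₁ g₂ => by simpa using hlin 1 g₁ g₂
            map_smul' := fun a g => by simpa [h0] using hlin a g 0 }, fun G g hG => ?_⟩
  obtain ⟨g', hg'⟩ := hG.exists_dunklPoly hR hS hΓR hc hinv hx₀ p
  have hG' : Represents Γ₀ ρ x₀ G ((0 : ℂ) • g + g) := by rwa [zero_smul, zero_add]
  have e := (hF g).dunklPoly_linear hR hS hΓR hc hinv hx₀ p (hF g) hG' (hT g) (hT g) hg'
  rw [zero_smul, zero_add] at e
  rw [e] at hg'
  exact hg'

theorem IsRestriction.unique (hR : IsRootSystem R) (hS : IsSimpleSystem R S) (hΓ : Γ₀ ⊆ S)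
    (hx₀ : IsGeneric R Γ₀ x₀) {p : Poly N} {T T' : Module.End ℂ (invGerms Γ₀ ρ x₀)}
    (h : IsRestriction S Γ₀ c ρ x₀ p T) (h' : IsRestriction S Γ₀ c ρ x₀ p T') : T = T' :=
  LinearMap.ext fun g => by
    obtain ⟨F, hF⟩ := exists_represents_of_germ hR hS hΓ hx₀ g
    exact (h F g hF).germ_unique (h' F g hF)

theorem IsRestriction.commute (hR : IsRootSystem R) (hS : IsSimpleSystem R S) (hΓ : Γ₀ ⊆ S)
    (hc : IsInvariantMult c) (hx₀ : IsGeneric R Γ₀ x₀) {p q : Poly N}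
    {T T' : Module.End ℂ (invGerms Γ₀ ρ x₀)}
    (h : IsRestriction S Γ₀ c ρ x₀ p T) (h' : IsRestriction S Γ₀ c ρ x₀ q T') : Commute T T' := by
  refine LinearMap.ext fun g => Subtype.ext ?_
  obtain ⟨F, hF⟩ := exists_represents_of_germ hR hS hΓ hx₀ g
  have h1 := (h _ _ (h' F g hF)).germ_eq
  have h2 := (h' _ _ (h F g hF)).germ_eq
  change (T (T' g)).1 = (T' (T g)).1
  rw [← h1, ← h2]
  obtain ⟨Ω, hxΩ, -, hP⟩ := exists_invOpen hR (hΓ.trans hS.subset) hx₀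
    fun x hx => hF.eventually hR hx
  obtain ⟨f, hf⟩ := exists_dunklAlg hR hS hc Ω U
  let G : AnFun Ω U := cut Ω F fun y hy => (hP y hy).1
  have hG : ∀ p, Set.EqOn (f p G).1 (dunklPoly S c p F) Ω.carrier := fun p =>
    dunklPoly_eqOn hf _ fun z hz => cut_apply hz
  refine Germ.coe_eq.2 ?_
  filter_upwards [mem_nhdsWithin_of_mem_nhds (Ω.isOpen.mem_nhds hxΩ)] with y hy
  rw [← dunklPoly_eqOn hf p (hG q) hy, ← dunklPoly_eqOn hf q (hG p) hy]
  have e : f p * f q = f q * f p := by rw [← map_mul, mul_comm, map_mul]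
  exact congrArg (fun H : AnFun Ω U => H.1 y) (LinearMap.congr_fun e G)

end Restriction

section Laplacian

variable {N : ℕ} {U : Type*} [AddCommGroup U] [Module ℂ U] {R S Γ₀ : Finset (RSpace N)}
variable {Ω : InvOpen R} {c : R → ℂ} {ρ : Representation ℂ (reflGroup R)ᵐᵒᵖ U} {x₀ : CSpace N}

/-! ### Orthogonal projection onto the plane -/

/-- The linear map `x ↦ ∑ (v_k, x) v_k`, which is the orthogonal projection onto `π` if `v` is an
orthonormal basis of `π`. -/
def frameProj {n : ℕ} (v : Fin n → CSpace N) : CSpace N →ₗ[ℂ] CSpace N where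
  toFun x := ∑ k, (v k ⬝ᵥ x) • v k
  map_add' x y := by simp only [dotProduct_add, add_smul, Finset.sum_add_distrib]
  map_smul' t x := by
    simp only [dotProduct_smul, smul_eq_mul, mul_smul, RingHom.id_apply, Finset.smul_sum]

variable {n : ℕ} {v : Fin n → CSpace N}

theorem frameProj_apply (x : CSpace N) : frameProj v x = ∑ k, (v k ⬝ᵥ x) • v k := rfl

theorem IsOrthonormalBasis.mem_plane (hv : IsOrthonormalBasis Γ₀ v) (k : Fin n) :
    v k ∈ plane Γ₀ := by
  rw [← hv.2]
  exact Submodule.subset_span ⟨k, rfl⟩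

theorem IsOrthonormalBasis.frameProj_mem (hv : IsOrthonormalBasis Γ₀ v) (x : CSpace N) :
    frameProj v x ∈ plane Γ₀ :=
  sum_mem fun k _ => Submodule.smul_mem _ _ (hv.mem_plane k)

theorem IsOrthonormalBasis.frameProj_eq (hv : IsOrthonormalBasis Γ₀ v) {x : CSpace N}
    (hx : x ∈ plane Γ₀) : frameProj v x = x := by
  rw [← hv.2] at hx
  have h : Set.EqOn (frameProj v) (LinearMap.id : CSpace N →ₗ[ℂ] CSpace N) (Set.range v) := by
    rintro _ ⟨k, rfl⟩
    simp [frameProj_apply, hv.1]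
  exact LinearMap.eqOn_span h hx

theorem IsOrthonormalBasis.frameProj_proj (hv : IsOrthonormalBasis Γ₀ v) (α : RSpace N) :
    frameProj v (cx (proj Γ₀ α)) = frameProj v (cx α) := by
  simp only [frameProj_apply]
  refine Finset.sum_congr rfl fun k _ => ?_
  rw [dotProduct_comm, proj_dot α (hv.mem_plane k), dotProduct_comm]

theorem AnAt.comp_linearMap {F : CSpace N → U} {x : CSpace N} (L : CSpace N →ₗ[ℂ] CSpace N)
    (h : AnAt F (L x)) : AnAt (fun y => F (L y)) x := by
  obtain ⟨n, f, u, hf, e⟩ := anAt_iff.1 h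
  refine anAt_iff.2 ⟨n, fun j y => f j (L y), u, fun j => ?_, ?_⟩
  · exact AnalyticAt.comp (hf j) ((LinearMap.toContinuousLinearMap L).analyticAt x)
  · exact (LinearMap.toContinuousLinearMap L).continuous.continuousAt.eventually e

theorem dirDeriv_comp_linearMap (L : CSpace N →ₗ[ℂ] CSpace N) (ξ : CSpace N) (F : CSpace N → U)
    (x : CSpace N) : dirDeriv ξ (fun y => F (L y)) x = dirDeriv (L ξ) F (L x) := by
  refine dirDeriv_eq_of_iff fun d => ?_
  simp only [HasDirDeriv, map_add, map_smul]

/-- A function constant along the fibres of a projection `L` has equal derivatives in the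
directions `ξ` and `L ξ`. -/
theorem dirDeriv_of_comp_eq {L : CSpace N →ₗ[ℂ] CSpace N} (hL : ∀ x, L (L x) = L x)
    {F : CSpace N → U} {x : CSpace N} (h : ∀ᶠ y in 𝓝 x, F y = F (L y)) (ξ : CSpace N) :
    ∀ᶠ y in 𝓝 x, dirDeriv ξ F y = dirDeriv (L ξ) F y := by
  filter_upwards [eventually_eventually_nhds.2 h] with y hy
  rw [dirDeriv_congr hy, dirDeriv_congr (ξ := L ξ) hy, dirDeriv_comp_linearMap,
    dirDeriv_comp_linearMap, hL]

/-- The derivatives of a function constant along the fibres of a projection are again constant along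
the fibres. -/
theorem dirDeriv_comp_eq {L : CSpace N →ₗ[ℂ] CSpace N} (hL : ∀ x, L (L x) = L x)
    {F : CSpace N → U} {x : CSpace N} (hx : L x = x) (h : ∀ᶠ y in 𝓝 x, F y = F (L y))
    (ξ : CSpace N) : ∀ᶠ y in 𝓝 x, dirDeriv ξ F y = dirDeriv ξ F (L y) := by
  have ht : Tendsto L (𝓝 x) (𝓝 x) := by
    have := (LinearMap.toContinuousLinearMap L).continuous.tendsto x
    change Tendsto L (𝓝 x) (𝓝 (L x)) at this
    rwa [hx] at this
  filter_upwards [eventually_eventually_nhds.2 h,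
    ht.eventually (eventually_eventually_nhds.2 h)] with y h1 h2
  rw [dirDeriv_congr h1, dirDeriv_congr h2, dirDeriv_comp_linearMap, dirDeriv_comp_linearMap, hL]

theorem sum_der_frameProj (hv : IsOrthonormalBasis Γ₀ v) :
    ∑ i, der Ω U (frameProj v (Pi.single i 1)) * der Ω U (frameProj v (Pi.single i 1)) =
      ∑ k, der Ω U (v k) * der Ω U (v k) := by
  let D : CSpace N →ₗ[ℂ] Module.End ℂ (AnFun Ω U) :=
    { toFun := der Ω U, map_add' := der_add, map_smul' := der_smul }
  have h : ∀ i, der Ω U (frameProj v (Pi.single i 1)) = ∑ k, v k i • der Ω U (v k) := by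
    intro i
    change D (frameProj v (Pi.single i 1)) = _
    rw [frameProj_apply, map_sum]
    refine Finset.sum_congr rfl fun k _ => ?_
    rw [map_smul, dotProduct_single_one]
    rfl
  simp only [h, Finset.sum_mul_sum, smul_mul_smul_comm]
  rw [Finset.sum_comm]
  refine Finset.sum_congr rfl fun k _ => ?_
  rw [Finset.sum_comm]
  simp only [← Finset.sum_smul]
  have h2 : ∀ l, ∑ i, v k i * v l i = if k = l then 1 else 0 := hv.1 k
  simp [h2]

/-! ### The Dunkl Laplacian on functions constant along the normal directions -/

theorem mulDot_mul_dd (α : R) :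
    mulDot Ω U (cx α) * dd Ω U α = 1 - act Ω U (reflW α) := by
  refine end_ext fun F x hx => ?_
  rw [Module.End.mul_apply, mulDot_apply, dd_apply α _ hx, LinearMap.sub_apply, AnFun.sub_apply,
    Module.End.one_apply, act_apply]
  change _ = F.1 x - F.1 (refl α x)
  by_cases h : cx (α : RSpace N) ⬝ᵥ x = 0
  · rw [h, zero_smul, refl_eq_self h, sub_self]
  · rw [divDiff_of_ne h, smul_smul, mul_inv_cancel₀ h, one_smul]

/-- The relation `(α, x) (∂_α d_α + d_α ∂_α) = 2 ∂_α - (α, α) d_α` for `d_α = (α, x)⁻¹ (1 - s_α)`. -/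
theorem mulDot_mul_der_dd (α : R) :
    mulDot Ω U (cx α) * (der Ω U (cx α) * dd Ω U α + dd Ω U α * der Ω U (cx α)) =
      (2 : ℂ) • der Ω U (cx α) - (cx (α : RSpace N) ⬝ᵥ cx α) • dd Ω U α := by
  have h1 : mulDot Ω U (cx α) * der Ω U (cx α) =
      der Ω U (cx α) * mulDot Ω U (cx α) - (cx (α : RSpace N) ⬝ᵥ cx α) • 1 := by
    rw [der_mulDot, add_sub_cancel_right]
  have h2 : act Ω U (reflW α) * der Ω U (cx α) = -(der Ω U (cx α) * act Ω U (reflW α)) := by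
    rw [act_der]
    have e : (reflW α).1 (cx (α : RSpace N)) = (-1 : ℂ) • cx (α : RSpace N) := by
      change refl (α : RSpace N) (cx α) = _
      rw [refl_cx, rrefl_self, cx_neg, neg_one_smul]
    rw [e, der_smul, neg_one_smul, neg_mul]
  rw [mul_add, ← mul_assoc, ← mul_assoc, h1, sub_mul, mul_assoc, mulDot_mul_dd, smul_mul_assoc,
    one_mul, sub_mul, h2, mul_sub, mul_one, one_mul, two_smul]
  abel

/-- The contribution of a root to the Dunkl Laplacian away from its mirror. -/
theorem der_dd_apply_of_ne (α : R) (F : AnFun Ω U) {x : CSpace N}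
    (hx : x ∈ Ω.carrier) (h : cx (α : RSpace N) ⬝ᵥ x ≠ 0) :
    ((der Ω U (cx α) * dd Ω U α + dd Ω U α * der Ω U (cx α)) F).1 x =
      (2 / (cx (α : RSpace N) ⬝ᵥ x)) • dirDeriv (cx α) F.1 x -
        ((cx (α : RSpace N) ⬝ᵥ cx α) / (cx (α : RSpace N) ⬝ᵥ x) ^ 2) •
          (F.1 x - F.1 (refl α x)) := by
  have h1 := congrArg (fun G : AnFun Ω U => G.1 x)
    (LinearMap.congr_fun (mulDot_mul_der_dd (Ω := Ω) (U := U) α) F)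
  simp only [Module.End.mul_apply, LinearMap.sub_apply, LinearMap.smul_apply] at h1
  rw [mulDot_apply, AnFun.sub_apply, AnFun.smul_apply, AnFun.smul_apply, der_apply _ _ hx,
    dd_apply _ _ hx, divDiff_of_ne h] at h1
  have h2 := congrArg (fun u => (cx (α : RSpace N) ⬝ᵥ x)⁻¹ • u) h1
  simp only [smul_smul, inv_mul_cancel₀ h, one_smul, smul_sub] at h2
  refine h2.trans ?_
  rw [smul_sub]
  congr 2
  · ring
  · congr 1
    ring
  · congr 1
    ring

/-- The contribution of a root orthogonal to `π` to the Dunkl Laplacian vanishes on functions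
constant along the normal directions. -/
theorem der_dd_apply_of_eq (α : R) (F : AnFun Ω U) {x : CSpace N}
    (hx : x ∈ Ω.carrier) (h : cx (α : RSpace N) ⬝ᵥ x = 0) {L : CSpace N →ₗ[ℂ] CSpace N}
    (hL : ∀ x, L (L x) = L x) (hLα : L (cx α) = 0) (hF : ∀ᶠ y in 𝓝 x, F.1 y = F.1 (L y)) :
    ((der Ω U (cx α) * dd Ω U α + dd Ω U α * der Ω U (cx α)) F).1 x = 0 := by
  have hder : ∀ᶠ y in 𝓝 x, dirDeriv (cx (α : RSpace N)) F.1 y = 0 := by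
    filter_upwards [dirDeriv_of_comp_eq hL hF (cx α), Ω.isOpen.mem_nhds hx] with y hy hyΩ
    have := (anFun_anAt F hyΩ).dirDeriv_smul_vec 0 (0 : CSpace N)
    rw [zero_smul, zero_smul] at this
    rw [hy, hLα, this]
  have hs : Tendsto (refl (α : RSpace N)) (𝓝 x) (𝓝 x) := by
    have := (continuous_equiv (refl (α : RSpace N))).tendsto x
    rwa [refl_eq_self h] at this
  have hdd : ∀ᶠ y in 𝓝 x, (dd Ω U α F).1 y = 0 := by
    filter_upwards [hder, hF, hs.eventually hF, Ω.isOpen.mem_nhds hx] with y h1 h2 h3 hyΩ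
    rw [dd_apply _ _ hyΩ]
    unfold divDiff
    split_ifs
    · rw [h1, smul_zero]
    · have : L (refl (α : RSpace N) y) = L y := by
        rw [refl_apply, map_sub, map_smul, hLα, smul_zero, sub_zero]
      rw [h2, h3, this, sub_self, smul_zero]
  have hder' : (der Ω U (cx α) F).1 =ᶠ[𝓝 x] fun _ => 0 := by
    filter_upwards [hder, Ω.isOpen.mem_nhds hx] with y hy hyΩ
    rw [der_apply _ _ hyΩ, hy]
  rw [LinearMap.add_apply, AnFun.add_apply, Module.End.mul_apply, Module.End.mul_apply,
    der_apply _ _ hx, dd_apply _ _ hx, divDiff_of_eq h, dirDeriv_congr (G := fun _ => (0 : U)) hdd,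
    dirDeriv_congr hder', dirDeriv_const, smul_zero, add_zero]

/-- The operator depends only on the restriction of the function to the stratum. -/
theorem spinCM_congr (hR : IsRootSystem R) (hΓ : Γ₀ ⊆ R) (hx₀ : IsGeneric R Γ₀ x₀)
    (hv : IsOrthonormalBasis Γ₀ v) {F G : CSpace N → U} (h : F =ᶠ[𝓝[stratum R Γ₀] x₀] G) :
    spinCM S Γ₀ c ρ v F =ᶠ[𝓝[stratum R Γ₀] x₀] spinCM S Γ₀ c ρ v G := by
  have h' : ∀ᶠ y in 𝓝 x₀, y ∈ plane Γ₀ → F y = G y := by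
    filter_upwards [eventually_nhdsWithin_iff.1 h] with y hy hyp
    exact hy (plane_subset_stratum hyp)
  have hline : ∀ {A B : CSpace N → U} {y : CSpace N},
      (∀ᶠ z in 𝓝 y, z ∈ plane Γ₀ → A z = B z) → y ∈ plane Γ₀ → ∀ ξ ∈ plane Γ₀,
        dirDeriv ξ A y = dirDeriv ξ B y := by
    intro A B y hAB hy ξ hξ
    refine dirDeriv_congr_line ?_
    filter_upwards [(tendsto_line ξ y).eventually hAB] with t ht
    exact ht (add_mem hy (Submodule.smul_mem _ t hξ))
  refine eventually_nhdsWithin_iff.2 ?_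
  filter_upwards [hx₀.eventually_mem_plane hR hΓ,
    eventually_eventually_nhds.2 h'] with y hyp hy hyD
  have hyπ := hyp hyD
  unfold spinCM
  rw [hy.self_of_nhds hyπ]
  congr 2
  · refine Finset.sum_congr rfl fun k _ => ?_
    refine hline ?_ hyπ _ (hv.mem_plane k)
    filter_upwards [eventually_eventually_nhds.2 hy] with z hz hzπ
    exact hline hz hzπ _ (hv.mem_plane k)
  · refine Finset.sum_congr rfl fun α _ => ?_
    rw [hline hy hyπ _ (cx_proj_mem_plane _)]

/-- The restriction of the Dunkl Laplacian. The germ is extended to a function constant along the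
normal directions of `π`, for which the normal derivatives and the roots orthogonal to `π` do not
contribute. -/
theorem IsRestriction.sumSq_eq (hR : IsRootSystem R) (hS : IsSimpleSystem R S) (hΓ : Γ₀ ⊆ S)
    (hc : IsInvariantMult c) (hx₀ : IsGeneric R Γ₀ x₀)
    {T : Module.End ℂ (invGerms Γ₀ ρ x₀)} (hT : IsRestriction S Γ₀ c ρ x₀ (sumSq R : Poly N) T)
    (hv : IsOrthonormalBasis Γ₀ v) (g : invGerms Γ₀ ρ x₀) {F : CSpace N → U}
    (hF : (F : Germ (𝓝[stratum R Γ₀] x₀) U) = g) :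
    (T g : Germ (𝓝[stratum R Γ₀] x₀) U) = (spinCM S Γ₀ c ρ v F : CSpace N → U) := by
  classical
  have hΓR := hΓ.trans hS.subset
  have hL : ∀ x, frameProj v (frameProj v x) = frameProj v x := fun x =>
    hv.frameProj_eq (hv.frameProj_mem x)
  have hLx₀ : frameProj v x₀ = x₀ := hv.frameProj_eq hx₀.1
  obtain ⟨h₀, hh₀, hg₀⟩ := exists_anAt_of_mem g.2.1
  have hh : AnAt (fun y => h₀ (frameProj v y)) x₀ := AnAt.comp_linearMap _ (by rwa [hLx₀])
  have hg : ((fun y => h₀ (frameProj v y) : CSpace N → U) : Germ (𝓝[stratum R Γ₀] x₀) U) = g := by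
    rw [← hg₀]
    refine Germ.coe_eq.2 (eventually_nhdsWithin_iff.2 ?_)
    filter_upwards [hx₀.eventually_mem_plane hR hΓR] with y hy hyD
    rw [hv.frameProj_eq (hy hyD)]
  obtain ⟨G, hG, hGh⟩ := exists_represents hR hS hΓ hx₀ g hh hg
  rw [← (hT G g hG).germ_eq]
  have hFG : F =ᶠ[𝓝[stratum R Γ₀] x₀] G := Germ.coe_eq.1 (hF.trans hG.germ_eq.symm)
  refine Germ.coe_eq.2 (EventuallyEq.trans ?_ (spinCM_congr hR hΓR hx₀ hv hFG).symm)
  have hGL : ∀ᶠ y in 𝓝 x₀, G y = G (frameProj v y) := by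
    have ht : Tendsto (frameProj v) (𝓝 x₀) (𝓝 x₀) := by
      have := (LinearMap.toContinuousLinearMap (frameProj v)).continuous.tendsto x₀
      change Tendsto (frameProj v) (𝓝 x₀) (𝓝 (frameProj v x₀)) at this
      rwa [hLx₀] at this
    filter_upwards [hGh, ht.eventually hGh] with y h1 h2
    rw [h1, h2, hL]
  obtain ⟨Ω, hxΩ, hgen, hP⟩ := exists_invOpen hR hΓR hx₀ fun x hx => hG.eventually hR hx
  obtain ⟨f, hf⟩ := exists_dunklAlg hR hS hc Ω U
  let H : AnFun Ω U := cut Ω G fun y hy => (hP y hy).1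
  refine eventually_nhdsWithin_iff.2 ?_
  filter_upwards [Ω.isOpen.mem_nhds hxΩ, eventually_eventually_nhds.2 hGL,
    hx₀.eventually_mem_plane hR hΓR] with y hy hyL hyp hyD
  have hyπ := hyp hyD
  have hyL' := hv.frameProj_eq hyπ
  have hyg : IsGeneric R Γ₀ y := hgen y hy 1 (one_mem _) hyπ
  have hHG : ∀ z ∈ Ω.carrier, H.1 =ᶠ[𝓝 z] G := fun z hz => cut_eventuallyEq hz
  have hHL : ∀ᶠ z in 𝓝 y, H.1 z = H.1 (frameProj v z) := by
    have ht : Tendsto (frameProj v) (𝓝 y) (𝓝 y) := by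
      have := (LinearMap.toContinuousLinearMap (frameProj v)).continuous.tendsto y
      change Tendsto (frameProj v) (𝓝 y) (𝓝 (frameProj v y)) at this
      rwa [hyL'] at this
    filter_upwards [hyL, hHG y hy, ht.eventually (hHG y hy)] with z h1 h2 h3
    rw [h2, h3, h1]
  have hfS : f (sumSq R : Poly N) =
      ∑ i, dunklEnd Ω U S c (Pi.single i 1) * dunklEnd Ω U S c (Pi.single i 1) := by
    change f (∑ i, MvPolynomial.X i ^ 2) = _
    rw [map_sum]
    exact Finset.sum_congr rfl fun i _ => by rw [map_pow, hf, sq]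
  -- Only the tangential part of the Laplacian contributes.
  have hlap : ((∑ i, der Ω U (Pi.single i 1) * der Ω U (Pi.single i 1)) H).1 y =
      ∑ k, dirDeriv (v k) (dirDeriv (v k) G) y := by
    have h1 : ((∑ i, der Ω U (Pi.single i 1) * der Ω U (Pi.single i 1)) H).1 y =
        ((∑ k, der Ω U (v k) * der Ω U (v k)) H).1 y := by
      rw [← sum_der_frameProj hv, LinearMap.sum_apply, LinearMap.sum_apply, AnFun.sum_apply,
        AnFun.sum_apply]
      refine Finset.sum_congr rfl fun i _ => ?_
      rw [Module.End.mul_apply, Module.End.mul_apply, der_apply _ _ hy, der_apply _ _ hy]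
      have e : (der Ω U (Pi.single i 1) H).1 =ᶠ[𝓝 y] dirDeriv (Pi.single i 1) H.1 := by
        filter_upwards [Ω.isOpen.mem_nhds hy] with z hz using der_apply _ _ hz
      have e' : (der Ω U (frameProj v (Pi.single i 1)) H).1 =ᶠ[𝓝 y]
          dirDeriv (Pi.single i 1) H.1 := by
        filter_upwards [Ω.isOpen.mem_nhds hy, dirDeriv_of_comp_eq hL hHL (Pi.single i 1)]
          with z hz h1
        rw [der_apply _ _ hz, h1]
      rw [dirDeriv_congr e, dirDeriv_congr e']
      exact (dirDeriv_of_comp_eq hL (dirDeriv_comp_eq hL hyL' hHL _) _).self_of_nhds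
    rw [h1, LinearMap.sum_apply, AnFun.sum_apply]
    refine Finset.sum_congr rfl fun k _ => ?_
    rw [Module.End.mul_apply, der_apply _ _ hy]
    refine dirDeriv_congr ?_
    filter_upwards [Ω.isOpen.mem_nhds hy] with z hz
    rw [der_apply _ _ hz, dirDeriv_congr (hHG z hz)]
  -- Off its mirror a root contributes through the values at `y` and `s_α y`. Both lie on the
  -- stratum, so that the invariance of the germ turns `s_α` into `P_α`.
  have hroot : ∀ α ∈ posRoots R S,
      ((c α • (der Ω U (cx α) * dd Ω U α + dd Ω U α * der Ω U (cx α))) H).1 y =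
        if proj Γ₀ (α : RSpace N) ≠ 0 then
          (2 * c α / (cx (proj Γ₀ α) ⬝ᵥ y)) • dirDeriv (cx (proj Γ₀ α)) G y -
            (c α * (cx (α : RSpace N) ⬝ᵥ cx (α : RSpace N)) / (cx (proj Γ₀ α) ⬝ᵥ y) ^ 2) •
              (G y - ρ (MulOpposite.op (reflW α)) (G y)) else 0 := by
    intro α _
    rw [LinearMap.smul_apply, AnFun.smul_apply]
    split_ifs with h
    · have hαy : cx (α : RSpace N) ⬝ᵥ y ≠ 0 := fun h0 => h ((hyg.proj_eq_zero_iff α.2).2 h0)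
      have hsy : refl (α : RSpace N) y ∈ Ω.carrier := Ω.map_mem _ (refl_mem_reflGroup α.2) y hy
      have hder : dirDeriv (cx (α : RSpace N)) H.1 y = dirDeriv (cx (proj Γ₀ α)) G y := by
        rw [(dirDeriv_of_comp_eq hL hHL _).self_of_nhds, ← hv.frameProj_proj,
          hv.frameProj_eq (cx_proj_mem_plane _), dirDeriv_congr (hHG y hy)]
      have hval : H.1 (refl α y) = ρ (MulOpposite.op (reflW α)) (G y) := by
        rw [cut_apply hsy, ← (hP _ hsy).2 (reflW α)
          (map_mem_stratum (refl_mem_reflGroup α.2) hyD)]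
        have e : (reflW α)⁻¹ = reflW α := rfl
        unfold diagAct
        rw [e]
        change ρ _ (G (refl α (refl α y))) = _
        rw [refl_refl]
      rw [der_dd_apply_of_ne α H hy hαy, hder, hval, cut_apply hy, proj_dot _ hyπ, smul_sub,
        smul_smul, smul_smul]
      congr 2
      · ring
      · ring
    · rw [not_not] at h
      have hα0 := (hyg.proj_eq_zero_iff α.2).1 h
      have hLα : frameProj v (cx (α : RSpace N)) = 0 := by
        have h0 : cx (0 : RSpace N) = 0 := by funext i; simp [cx]
        rw [← hv.frameProj_proj, h, h0, map_zero]
      rw [der_dd_apply_of_eq α H hy hα0 hL hLα hHL, smul_zero]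
  rw [← dunklPoly_eqOn hf (sumSq R : Poly N) (F := H) (fun z hz => cut_apply hz) hy, hfS,
    sum_dunklEnd_mul_self hR hS hc, LinearMap.sub_apply, AnFun.sub_apply, hlap,
    LinearMap.sum_apply, AnFun.sum_apply, Finset.sum_congr rfl hroot, ← Finset.sum_filter,
    Finset.sum_sub_distrib, spinCM]
  abel

end Laplacian

end

end SpinCM

theorem theorem3p2 {N : ℕ} (R S Γ₀ : Finset (RSpace N)) (hR : IsRootSystem R)
    (hS : IsSimpleSystem R S) (hΓ₀ : Γ₀ ⊆ S) (c : R → ℂ) (hc : IsInvariantMult c)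
    (hinv : IsInvariantParabolic S Γ₀ c)
    {U : Type*} [AddCommGroup U] [Module ℂ U] (ρ : Representation ℂ (reflGroup R)ᵐᵒᵖ U)
    (x₀ : CSpace N) (hx₀ : IsGeneric R Γ₀ x₀) :
    ∃ Res : invPoly R → Module.End ℂ (invGerms Γ₀ ρ x₀),
      (∀ (p : invPoly R) (T : Module.End ℂ (invGerms Γ₀ ρ x₀)),
        IsRestriction S Γ₀ c ρ x₀ (p : Poly N) T ↔ T = Res p) ∧
      (∀ (n : ℕ) (v : Fin n → CSpace N), IsOrthonormalBasis Γ₀ v →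
        ∀ (g : invGerms Γ₀ ρ x₀) (F : CSpace N → U),
          (F : Germ (𝓝[stratum R Γ₀] x₀) U) = g →
            (Res (sumSq R) g : Germ (𝓝[stratum R Γ₀] x₀) U) =
              (spinCM S Γ₀ c ρ v F : CSpace N → U)) ∧
      ∀ p q : invPoly R, Commute (Res p) (Res q) := by
  choose Res hRes using fun p : invPoly R =>
    exists_isRestriction (ρ := ρ) hR hS hΓ₀ hc hinv hx₀ p
  refine ⟨Res, fun p T => ⟨fun h => h.unique hR hS hΓ₀ hx₀ (hRes p), ?_⟩, ?_, fun p q => ?_⟩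
  · rintro rfl
    exact hRes p
  · intro n v hv g F hF
    exact (hRes (sumSq R)).sumSq_eq hR hS hΓ₀ hc hx₀ hv g hF
  · exact (hRes p).commute hR hS hΓ₀ hc hx₀ (hRes q)
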